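/- Let $N\ge 2$ and let $\mathcal M=\mathbb R^N\times\mathbb R_{>0}^N$ be the phase space of the periodic Toda lattice, with points $(b,a)=((b_n),(a_n))_{1\le n\le N}$, extended $N$-periodically in $n$. Let $C_1=-\frac1N\sum_{n=1}^N b_n$ and $C_2=\big(\prod_{n=1}^N a_n\big)^{1/N}$. For $(b,a)\in\mathcal M$ let $y_1(k,\lambda)$, $y_2(k,\lambda)$ be the solutions of $a_{k-1}y(k-1)+b_ky(k)+a_ky(k+1)=\lambda y(k)$ with $y_1(0)=1$, $y_1(1)=0$ and $y_2(0)=0$, $y_2(1)=1$, and let $\Delta(\lambda)=y_1(N,\lambda)+y_2(N+1,\lambda)$. Let $\lambda_1<\lambda_2\le\lambda_3<\dots<\lambda_{2N-2}\le\lambda_{2N-1}<\lambda_{2N}$ be the eigenvalues, with multiplicities, of the $2N\times 2N$ periodic Jacobi matrix $Q(b,a)$ with diagonal $b_1,\dots,b_N,b_1,\dots,b_N$, side diagonals $a_1,\dots,a_N,a_1,\dots,a_{N-1}$ and corner entries $a_N$, so that $\Delta(\lambda)^2-4=C_2^{-2N}\prod_{j=1}^{2N}(\lambda-\lambda_j)$.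 Let $\mu_1<\dots<\mu_{N-1}$ be the zeros of $y_1(N+1,\cdot)$; they satisfy $\lambda_{2n}\le\mu_n\le\lambda_{2n+1}$. Put $\gamma_n=\lambda_{2n+1}-\lambda_{2n}$ for $1\le n\le N-1$. Let $\Gamma_1,\dots,\Gamma_{N-1}$ be counterclockwise circles bounding pairwise disjoint closed discs that do not contain $\lambda_1$, $\lambda_{2N}$, with $[\lambda_{2n},\lambda_{2n+1}]$ in the interior of the $n$-th disc. Let $\sqrt[c]{\Delta^2-4}$ be the analytic square root of $\Delta^2-4$ on $\mathbb C\setminus\big((-\infty,\lambda_1]\cup\bigcup_{n=1}^{N-1}[\lambda_{2n},\lambda_{2n+1}]\cup[\lambda_{2N},\infty)\big)$ that is a positive multiple of $i$ on $(\lambda_{2N-1},\lambda_{2N})$. For $1\le n\le N-1$ define the action $$I_n=\frac1{2\pi}\int_{\Gamma_n}\lambda\,\frac{\Delta'(\lambda)}{\sqrt[c]{\Delta(\lambda)^2-4}}\,d\lambda\ \ge 0,$$ and let $\psi_n$ be the unique polynomial of degree at most $N-2$ with $\frac1{2\pi}\int_{\Gamma_k}\frac{\psi_n(\lambda)}{\sqrt[c]{\Delta(\lambda)^2-4}}\,d\lambda=\delta_{kn}$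 for $1\le k\le N-1$. If $\gamma_n>0$, define the angle, modulo $2\pi$, by $$\theta_n=\sum_{k=1}^{N-1}\int_{\lambda_{2k}}^{\mu_k^*}\frac{\psi_n(\lambda)}{\sqrt{\Delta(\lambda)^2-4}}\,d\lambda .$$ Here the $k$-th integral is taken on the curve $z^2=\Delta(\lambda)^2-4$, with $z$ as the value of the root, from $(\lambda_{2k},0)$ to $\mu_k^*=(\mu_k,\,y_1(N,\mu_k)-y_2(N+1,\mu_k))$ along a lift of the segment $[\lambda_{2k},\mu_k]$. Let $(x_n,y_n)=\sqrt{2I_n}\,(\cos\theta_n,\sin\theta_n)$ if $\gamma_n>0$, and $(x_n,y_n)=(0,0)$ if $\gamma_n=0$. Then the Birkhoff map $$\Omega:\mathcal M\to\mathcal P:=\mathbb R^{2(N-1)}\times\mathbb R\times\mathbb R_{>0},\qquad (b,a)\mapsto\big((x_n,y_n)_{1\le n\le N-1},\,C_1,\,C_2\big)$$ is proper: for every compact set $K\subset\mathcal P$ the preimage $\Omega^{-1}(K)$ is a compact subset of $\mathcal M$. -/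

import Mathlib

open Polynomial

noncomputable section

namespace Toda

/-- The phase space `ℝ^N × ℝ_{>0}^N` of the periodic Toda lattice. The `N`-periodic sequences
`(b_k)`, `(a_k)`, `k ∈ ℤ`, are functions on `ZMod N`; in particular `a_N = a_0`. -/
abbrev PhaseSpace (N : ℕ) : Type := (ZMod N → ℝ) × (ZMod N → Set.Ioi (0 : ℝ))

/-- The model space `ℝ^{2(N-1)} × ℝ × ℝ_{>0}`; the entry with index `i : Fin (N - 1)` is the
pair `(x_{i+1}, y_{i+1})`. -/
abbrev ModelSpace (N : ℕ) : Type := (Fin (N - 1) → ℝ × ℝ) × ℝ × Set.Ioi (0 : ℝ)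

/-- The Casimir function `C₁ = -(1/N) ∑ b_n`. -/
def casimir₁ (N : ℕ) (b : ZMod N → ℝ) : ℝ := -(1 / (N : ℝ)) * ∑ n ∈ Finset.Icc 1 N, b n

/-- The Casimir function `C₂ = (∏ a_n)^{1/N}`. -/
def casimir₂ (N : ℕ) (a : ZMod N → ℝ) : ℝ := (∏ n ∈ Finset.Icc 1 N, a n) ^ (1 / (N : ℝ))

theorem casimir₂_pos (N : ℕ) (a : ZMod N → ℝ) (ha : ∀ k, 0 < a k) : 0 < casimir₂ N a :=
  Real.rpow_pos_of_pos (Finset.prod_pos fun (n : ℕ) _ => ha (n : ZMod N)) _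

/-- The solution `k ↦ y(k, λ)`, `k ≥ 0`, of the difference equation
`a_{k-1} y(k-1) + b_k y(k) + a_k y(k+1) = λ y(k)` with initial values `y(0) = c₀`, `y(1) = c₁`,
as a polynomial in `λ`. -/
def solution (N : ℕ) (b a : ZMod N → ℝ) (c₀ c₁ : ℝ) : ℕ → ℝ[X]
  | 0 => C c₀
  | 1 => C c₁
  | k + 2 => C (a (k + 1 : ℕ))⁻¹ *
      ((X - C (b (k + 1 : ℕ))) * solution N b a c₀ c₁ (k + 1)
        - C (a (k : ℕ)) * solution N b a c₀ c₁ k)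

/-- The fundamental solution with `y₁(0) = 1`, `y₁(1) = 0`. -/
def y₁ (N : ℕ) (b a : ZMod N → ℝ) : ℕ → ℝ[X] := solution N b a 1 0

/-- The fundamental solution with `y₂(0) = 0`, `y₂(1) = 1`. -/
def y₂ (N : ℕ) (b a : ZMod N → ℝ) : ℕ → ℝ[X] := solution N b a 0 1

/-- The discriminant `Δ(λ) = y₁(N, λ) + y₂(N + 1, λ)`. -/
def discr (N : ℕ) (b a : ZMod N → ℝ) : ℝ[X] := y₁ N b a N + y₂ N b a (N + 1)

/-- The periodic Jacobi matrix `Q(b, a)` of size `2N` (for `N ≥ 2`): it has the diagonal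
`b_1, …, b_N, b_1, …, b_N`, the side diagonals `a_1, …, a_N, a_1, …, a_{N-1}`, and `a_N` in the
two corners. The index `i : Fin (2 * N)` stands for row or column `i + 1`. -/
def jacobiQ (N : ℕ) (b a : ZMod N → ℝ) : Matrix (Fin (2 * N)) (Fin (2 * N)) ℝ :=
  Matrix.of fun i j =>
    if i = j then b (i.val + 1 : ℕ)
    else if (i.val + 1) % (2 * N) = j.val then a (i.val + 1 : ℕ)
    else if (j.val + 1) % (2 * N) = i.val then a (j.val + 1 : ℕ)
    else 0

/-- `lam N b a j` is `λ_j`, `1 ≤ j ≤ 2N`: the `j`-th eigenvalue of `Q(b, a)`, in increasing order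
and with multiplicities. -/
def lam (N : ℕ) (b a : ZMod N → ℝ) (j : ℕ) : ℝ :=
  ((jacobiQ N b a).charpoly.roots.sort (· ≤ ·)).getD (j - 1) 0

/-- The gap length `γ_n = λ_{2n+1} - λ_{2n}`, `1 ≤ n ≤ N - 1`. -/
def gap (N : ℕ) (b a : ZMod N → ℝ) (n : ℕ) : ℝ := lam N b a (2 * n + 1) - lam N b a (2 * n)

/-- The midpoint `τ_n = (λ_{2n} + λ_{2n+1}) / 2` of the `n`-th gap. -/
def mid (N : ℕ) (b a : ZMod N → ℝ) (n : ℕ) : ℝ := (lam N b a (2 * n) + lam N b a (2 * n + 1)) / 2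

/-- `mu N b a n` is the `n`-th Dirichlet eigenvalue `μ_n`, `1 ≤ n ≤ N - 1`: the `n`-th zero, in
increasing order, of `y₁(N + 1, ·)`. -/
def mu (N : ℕ) (b a : ZMod N → ℝ) (n : ℕ) : ℝ :=
  ((y₁ N b a (N + 1)).roots.sort (· ≤ ·)).getD (n - 1) 0

/-- The analytic square root of `(z - λ_{2n}) (z - λ_{2n+1})` on `ℂ ∖ [λ_{2n}, λ_{2n+1}]` that
behaves like `z` at infinity (`Complex.sqrt` is the principal branch); `i` times it is the
standard root of `(λ_{2n+1} - z) (z - λ_{2n})`. -/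
def gapRoot (N : ℕ) (b a : ZMod N → ℝ) (n : ℕ) (z : ℂ) : ℂ :=
  (z - mid N b a n) * Complex.sqrt (1 - ((gap N b a n / 2 : ℝ) / (z - mid N b a n)) ^ 2)

/-- The canonical root of `Δ² - 4`: as `Δ² - 4 = C₂^{-2N} ∏ (λ - λ_j)`, this is the analytic
square root of `Δ² - 4` off `(-∞, λ_1]`, `[λ_{2n}, λ_{2n+1}]` (`1 ≤ n ≤ N - 1`) and
`[λ_{2N}, ∞)` that is a positive multiple of `i` on `(λ_{2N-1}, λ_{2N})`. -/
def canonicalRoot (N : ℕ) (b a : ZMod N → ℝ) (z : ℂ) : ℂ :=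
  Complex.I * ((casimir₂ N a ^ N)⁻¹ : ℝ) *
    Complex.sqrt ((z - lam N b a 1) * (lam N b a (2 * N) - z)) *
    ∏ n ∈ Finset.Icc 1 (N - 1), gapRoot N b a n z

/-- The integral over `Γ_n`, a counterclockwise circle around the `n`-th gap
`[λ_{2n}, λ_{2n+1}]`. The closed discs bounded by the circles `Γ_1, …, Γ_{N-1}` are pairwise
disjoint and do not contain `λ_1` and `λ_{2N}`. -/
def gapContourIntegral (N : ℕ) (b a : ZMod N → ℝ) (n : ℕ) (f : ℂ → ℂ) : ℂ :=
  ∮ z in C((mid N b a n : ℂ), gap N b a n / 2 +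
    min (lam N b a (2 * n) - lam N b a (2 * n - 1))
      (lam N b a (2 * n + 2) - lam N b a (2 * n + 1)) / 3), f z

/-- The action `I_n = (1/2π) ∫_{Γ_n} λ Δ'(λ) / √(Δ(λ)² - 4) dλ` (a real number), with the
canonical root. -/
def action (N : ℕ) (b a : ZMod N → ℝ) (n : ℕ) : ℝ :=
  (1 / (2 * Real.pi : ℂ) * gapContourIntegral N b a n fun z =>
    z * aeval z (derivative (discr N b a)) / canonicalRoot N b a z).re

/-- `p` is a polynomial of degree at most `N - 2` with
`(1/2π) ∫_{Γ_k} p(λ) / √(Δ(λ)² - 4) dλ = δ_{kn}` for `1 ≤ k ≤ N - 1`, with the canonical root. -/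
def IsPsi (N : ℕ) (b a : ZMod N → ℝ) (n : ℕ) (p : ℝ[X]) : Prop :=
  p.natDegree ≤ N - 2 ∧ ∀ k ∈ Finset.Icc 1 (N - 1),
    1 / (2 * Real.pi : ℂ) * gapContourIntegral N b a k
      (fun z => aeval z p / canonicalRoot N b a z) = if k = n then 1 else 0

/-- The polynomial `ψ_n`, the unique one that satisfies `IsPsi N b a n`. -/
def psi (N : ℕ) (b a : ZMod N → ℝ) (n : ℕ) : ℝ[X] := Classical.epsilon (IsPsi N b a n)

/-- The sign of the sheet on which the point `μ_k^* = (μ_k, y₁(N, μ_k) - y₂(N + 1, μ_k))` of the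
curve `z² = Δ(λ)² - 4` lies over the gap `[λ_{2k}, λ_{2k+1}]`; if `μ_k^*` is a branch point, then
it lies on both, and either can be taken. -/
def sheetSign (N : ℕ) (b a : ZMod N → ℝ) (k : ℕ) : ℝ :=
  if (y₁ N b a N).eval (mu N b a k) - (y₂ N b a (N + 1)).eval (mu N b a k) < 0 then -1 else 1

/-- The integral of `ψ_n(λ) / √(Δ(λ)² - 4) dλ` on the curve `z² = Δ(λ)² - 4` from the branch point
`(λ_{2k}, 0)` to `μ_k^*`, along the lift of the segment `[λ_{2k}, μ_k]`, which lies in the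
`k`-th gap. For `k = n` this is `η_n`, for `k ≠ n` it is `β_k^n`. -/
def abelianIntegral (N : ℕ) (b a : ZMod N → ℝ) (n k : ℕ) : ℝ :=
  ∫ x in (lam N b a (2 * k))..(mu N b a k),
    (psi N b a n).eval x / (sheetSign N b a k * √((discr N b a).eval x ^ 2 - 4))

/-- The angle `θ_n = η_n + ∑_{k ≠ n} β_k^n`; it matters modulo `2π` only. -/
def angle (N : ℕ) (b a : ZMod N → ℝ) (n : ℕ) : ℝ :=
  abelianIntegral N b a n n +
    ∑ k ∈ (Finset.Icc 1 (N - 1)).erase n, abelianIntegral N b a n k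

open Classical in
/-- The coordinates `(x_n, y_n)`: they are `√(2 I_n) (cos θ_n, sin θ_n)` where the `n`-th gap is
open, and are extended by `(0, 0)` to the points where it is collapsed. -/
def birkhoffCoord (N : ℕ) (b a : ZMod N → ℝ) (n : ℕ) : ℝ × ℝ :=
  if gap N b a n = 0 then (0, 0)
  else (√(2 * action N b a n) * Real.cos (angle N b a n),
    √(2 * action N b a n) * Real.sin (angle N b a n))

/-- The Birkhoff map `Ω(b, a) = ((x_n, y_n)_{1 ≤ n ≤ N - 1}, C₁, C₂)`. -/
def birkhoffMap (N : ℕ) (p : PhaseSpace N) : ModelSpace N :=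
  (fun i => birkhoffCoord N p.1 (fun k => p.2 k) (i.val + 1),
    casimir₁ N p.1,
    ⟨casimir₂ N fun k => p.2 k, casimir₂_pos N _ fun k => (p.2 k).2⟩)

end Toda

end

/-!
The preimage of a compact set is compact because `Ω` is continuous and because preimages of compact
sets are bounded in the `b_k`, bounded in the `a_k`, and stay away from `a_k = 0`.

**Continuity.** The `λ_j` and `μ_n` are the sorted roots of the polynomials `Δ² - 4` (see
`charpoly_jacobiQ`) and `y₁(N + 1, ·)`, which have real roots only and depend continuously on
`(b, a)`; hence they are continuous (`continuous_of_continuous_prod`). Each contour `Γ_k` can be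
shrunk to the gap (`gapContourIntegral_div_canonicalRoot`): in the parametrization
`λ = τ_k - (γ_k / 2) cos t` of the gap, `dλ / √(Δ² - 4)` becomes `w(λ) dt` with a
weight `w` that is continuous in all data and has no zero, also where `γ_k = 0`. So `I_k` is continuous and vanishes where `γ_k = 0`,
and `ψ_n` solves a linear system with continuous coefficients. The system is regular: a polynomial
of degree at most `N - 2` all of whose periods vanish has a zero in each of the `N - 1` disjoint
gaps.

For the angle, consider its summand for the `k`-th gap. Where `γ_k > 0`, it is continuous up to the
sign of the sheet of `μ_k^*`; the sign jumps only where `μ_k` is an end of the gap, and there the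
integral of `ψ_n dλ / √(Δ² - 4)` is `0` or a half period, which lies in `π ℤ`, so that both signs
give the same value modulo `2π`. Where `γ_k = 0` and `k ≠ n`, the polynomial `ψ_n` vanishes at the
collapsed gap, and the summand tends to `0`. Where `γ_n = 0`, the factor `√(2 I_n)` tends to `0`.

**Boundedness.** An integration by parts gives `π I_k = ∫ arcosh |Δ / 2| dλ` over the `k`-th gap
(`action_eq_integral_arcosh`). On the gaps `log √(Δ² - 4) ≤ log 2 + arcosh |Δ / 2|`, and on the
bands between them `|Δ| ≤ 2`. Hence the integral of `log |Δ² - 4|` over `[λ_1, λ_{2N}]` is at most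
`2 L log 2 + 2π ∑ I_k` with the length `L = λ_{2N} - λ_1`. On the other hand
`Δ² - 4 = C₂^{-2N} ∏ (λ - λ_j)`, so the integral is at least `2N L (log (L / 2) - 1 - log C₂)`. This
bounds `L` by `C₂` and the actions (`spectral_length_le`). As `-C₁` is the mean of the `λ_j`, the spectrum of the
symmetric matrix `Q` is bounded, hence so are its entries, the `b_k` and `a_k`; and `∏ a_k = C₂^N`
then keeps each `a_k` away from `0`.
-/

noncomputable section

namespace Toda

/-! ### The difference equation -/

section Solutions

variable {N : ℕ} (b a : ZMod N → ℝ)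

theorem C_mul_solution_add_two (ha : ∀ k, 0 < a k) (c₀ c₁ : ℝ) (k : ℕ) :
    C (a (k + 1 : ℕ)) * solution N b a c₀ c₁ (k + 2) =
      (X - C (b (k + 1 : ℕ))) * solution N b a c₀ c₁ (k + 1)
        - C (a (k : ℕ)) * solution N b a c₀ c₁ k := by
  rw [solution, ← mul_assoc, ← C_mul, mul_inv_cancel₀ (ha _).ne', C_1, one_mul]

/-- The Wronskian of the two fundamental solutions. -/
theorem wronskian_y₁_y₂ (ha : ∀ k, 0 < a k) (k : ℕ) :
    C (a (k : ℕ)) * (y₁ N b a k * y₂ N b a (k + 1) - y₂ N b a k * y₁ N b a (k + 1)) =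
      C (a 0) := by
  induction k with
  | zero => simp [y₁, y₂, solution]
  | succ k ih =>
    have h₁ := C_mul_solution_add_two b a ha 1 0 k
    have h₂ := C_mul_solution_add_two b a ha 0 1 k
    simp only [y₁, y₂] at ih ⊢
    linear_combination ih + solution N b a 1 0 (k + 1) * h₂ - solution N b a 0 1 (k + 1) * h₁

/-- The confluent Christoffel–Darboux identity. -/
theorem christoffelDarboux_derivative (ha : ∀ k, 0 < a k) (c₀ c₁ : ℝ) (k : ℕ) :
    C (a (k : ℕ)) * (derivative (solution N b a c₀ c₁ (k + 1)) * solution N b a c₀ c₁ k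
        - derivative (solution N b a c₀ c₁ k) * solution N b a c₀ c₁ (k + 1)) =
      ∑ j ∈ Finset.range k, solution N b a c₀ c₁ (j + 1) ^ 2 := by
  induction k with
  | zero => simp [solution]
  | succ k ih =>
    have h := C_mul_solution_add_two b a ha c₀ c₁ k
    have h' := congrArg derivative h
    simp only [derivative_mul, derivative_sub, derivative_C, derivative_X, zero_mul, zero_add,
      sub_zero, one_mul] at h'
    rw [Finset.sum_range_succ, ← ih]
    linear_combination solution N b a c₀ c₁ (k + 1) * h'
      - derivative (solution N b a c₀ c₁ (k + 1)) * h

/-- The Christoffel–Darboux identity. -/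
theorem christoffelDarboux (ha : ∀ k, 0 < a k) (c₀ c₁ : ℝ) (z w : ℂ) (k : ℕ) :
    (a (k : ℕ) : ℂ) *
        (aeval z (solution N b a c₀ c₁ (k + 1)) * aeval w (solution N b a c₀ c₁ k)
        - aeval z (solution N b a c₀ c₁ k) * aeval w (solution N b a c₀ c₁ (k + 1))) =
      (z - w) * ∑ j ∈ Finset.range k,
        aeval z (solution N b a c₀ c₁ (j + 1)) * aeval w (solution N b a c₀ c₁ (j + 1)) := by
  induction k with
  | zero => simp [solution]; ring_nf; simp
  | succ k ih =>
    have h := C_mul_solution_add_two b a ha c₀ c₁ k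
    have hz := congrArg (aeval z) h
    have hw := congrArg (aeval w) h
    simp only [map_mul, map_sub, aeval_X, aeval_C, Complex.coe_algebraMap] at hz hw
    rw [Finset.sum_range_succ, mul_add, ← ih]
    linear_combination aeval w (solution N b a c₀ c₁ (k + 1)) * hz
      - aeval z (solution N b a c₀ c₁ (k + 1)) * hw

theorem natDegree_and_coeff_step {p q : ℝ[X]} {k : ℕ} (α β γ : ℝ) (hp : p.natDegree ≤ k)
    (hq : q.natDegree ≤ k) :
    (C α * ((X - C β) * q - C γ * p)).natDegree ≤ k + 1 ∧
      (C α * ((X - C β) * q - C γ * p)).coeff (k + 1) = α * q.coeff k := by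
  constructor
  · refine (natDegree_C_mul_le _ _).trans ((natDegree_sub_le _ _).trans (max_le ?_ ?_))
    · refine natDegree_mul_le.trans ?_
      rw [natDegree_X_sub_C]; omega
    · exact (natDegree_C_mul_le _ _).trans (by omega)
  · rw [coeff_C_mul, coeff_sub, coeff_C_mul, sub_mul, coeff_sub, coeff_C_mul, coeff_X_mul,
      coeff_eq_zero_of_natDegree_lt (Nat.lt_succ_of_le hp),
      coeff_eq_zero_of_natDegree_lt (Nat.lt_succ_of_le hq)]
    ring

theorem y₂_natDegree_coeff (k : ℕ) :
    (y₂ N b a (k + 1)).natDegree ≤ k ∧ (y₂ N b a k).natDegree ≤ k ∧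
      (y₂ N b a (k + 1)).coeff k = ∏ j ∈ Finset.range k, (a (j + 1 : ℕ))⁻¹ := by
  induction k with
  | zero => simp [y₂, solution]
  | succ k ih =>
    obtain ⟨h₁, h₂, h₃⟩ := ih
    have h := natDegree_and_coeff_step (a (k + 1 : ℕ))⁻¹ (b (k + 1 : ℕ)) (a (k : ℕ)) h₂ h₁
    refine ⟨h.1, h₁.trans (Nat.le_succ k), ?_⟩
    rw [Finset.prod_range_succ, ← h₃, mul_comm]
    exact h.2

theorem y₁_natDegree_coeff (k : ℕ) :
    (y₁ N b a (k + 2)).natDegree ≤ k ∧ (y₁ N b a (k + 1)).natDegree ≤ k ∧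
      (y₁ N b a (k + 2)).coeff k = -a 0 * ∏ j ∈ Finset.range (k + 1), (a (j + 1 : ℕ))⁻¹ := by
  induction k with
  | zero =>
    have h : y₁ N b a (0 + 2) = C (-a 0 * (a 1)⁻¹) := by simp [y₁, solution, mul_comm]
    refine ⟨by rw [h, natDegree_C], by simp [y₁, solution], by rw [h, coeff_C_zero]; simp⟩
  | succ k ih =>
    obtain ⟨h₁, h₂, h₃⟩ := ih
    have h := natDegree_and_coeff_step (a (k + 2 : ℕ))⁻¹ (b (k + 2 : ℕ)) (a (k + 1 : ℕ)) h₂ h₁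
    refine ⟨h.1, h₁.trans (Nat.le_succ k), ?_⟩
    rw [Finset.prod_range_succ, ← mul_assoc, ← h₃, mul_comm]
    exact h.2

theorem casimir₂_pow (hN : 2 ≤ N) (ha : ∀ k, 0 < a k) :
    casimir₂ N a ^ N = ∏ j ∈ Finset.range N, a (j + 1 : ℕ) := by
  have hp : (∏ n ∈ Finset.Icc 1 N, a (n : ℕ)) = ∏ j ∈ Finset.range N, a (j + 1 : ℕ) := by
    rw [Finset.range_eq_Ico, Finset.prod_Ico_add' (fun j : ℕ => a (j : ZMod N)) 0 N 1]
    rfl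
  rw [casimir₂, hp, one_div, Real.rpow_inv_natCast_pow (Finset.prod_nonneg fun j _ => (ha _).le)
    (by omega)]

theorem prod_inv_eq (hN : 2 ≤ N) (ha : ∀ k, 0 < a k) :
    ∏ j ∈ Finset.range N, (a (j + 1 : ℕ))⁻¹ = (casimir₂ N a ^ N)⁻¹ := by
  rw [casimir₂_pow a hN ha, Finset.prod_inv_distrib]

theorem discr_natDegree_le_and_coeff (hN : 2 ≤ N) (ha : ∀ k, 0 < a k) :
    (discr N b a).natDegree ≤ N ∧ (discr N b a).coeff N = (casimir₂ N a ^ N)⁻¹ := by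
  obtain ⟨m, rfl⟩ : ∃ m, N = m + 2 := ⟨N - 2, by omega⟩
  have h₁ := y₁_natDegree_coeff b a m
  have h₂ := y₂_natDegree_coeff b a (m + 2)
  refine ⟨natDegree_add_le_of_degree_le (h₁.1.trans (by omega)) h₂.1, ?_⟩
  rw [discr, coeff_add, h₂.2.2, coeff_eq_zero_of_natDegree_lt (by omega), zero_add,
    prod_inv_eq a hN ha]

theorem discr_natDegree (hN : 2 ≤ N) (ha : ∀ k, 0 < a k) : (discr N b a).natDegree = N := by
  obtain ⟨h₁, h₂⟩ := discr_natDegree_le_and_coeff b a hN ha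
  refine le_antisymm h₁ (le_natDegree_of_ne_zero ?_)
  rw [h₂]
  exact (inv_pos.2 (pow_pos (casimir₂_pos N a ha) N)).ne'

theorem discr_leadingCoeff (hN : 2 ≤ N) (ha : ∀ k, 0 < a k) :
    (discr N b a).leadingCoeff = (casimir₂ N a ^ N)⁻¹ := by
  rw [leadingCoeff, discr_natDegree b a hN ha, (discr_natDegree_le_and_coeff b a hN ha).2]

theorem y₁_coeff_neg (hN : 2 ≤ N) (ha : ∀ k, 0 < a k) : (y₁ N b a (N + 1)).coeff (N - 1) < 0 := by
  obtain ⟨m, rfl⟩ : ∃ m, N = m + 2 := ⟨N - 2, by omega⟩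
  rw [show m + 2 - 1 = m + 1 by omega, (y₁_natDegree_coeff b a (m + 1)).2.2]
  have : 0 < ∏ j ∈ Finset.range (m + 1 + 1), (a (j + 1 : ℕ))⁻¹ :=
    Finset.prod_pos fun j _ => inv_pos.2 (ha _)
  nlinarith [ha 0]

theorem y₁_natDegree (hN : 2 ≤ N) (ha : ∀ k, 0 < a k) :
    (y₁ N b a (N + 1)).natDegree = N - 1 := by
  refine le_antisymm ?_ (le_natDegree_of_ne_zero (y₁_coeff_neg b a hN ha).ne)
  obtain ⟨m, rfl⟩ : ∃ m, N = m + 2 := ⟨N - 2, by omega⟩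
  exact (y₁_natDegree_coeff b a (m + 1)).1

/-- The Wronskian over one period. -/
theorem wronskian_period (ha : ∀ k, 0 < a k) :
    y₁ N b a N * y₂ N b a (N + 1) - y₂ N b a N * y₁ N b a (N + 1) = 1 := by
  have h := wronskian_y₁_y₂ b a ha N
  rw [ZMod.natCast_self] at h
  refine mul_left_cancel₀ (C_ne_zero.2 (ha 0).ne') (h.trans (mul_one _).symm)

end Solutions

/-! ### The characteristic polynomial of the periodic Jacobi matrix -/

section Charpoly

variable {N : ℕ} (b a : ZMod N → ℝ)

/-- Translation by one period, expressed through the fundamental solutions. -/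
theorem solution_add_period (c₀ c₁ : ℝ) (k : ℕ) :
    solution N b a c₀ c₁ (N + k) =
      solution N b a c₀ c₁ N * y₁ N b a k + solution N b a c₀ c₁ (N + 1) * y₂ N b a k ∧
    solution N b a c₀ c₁ (N + (k + 1)) =
      solution N b a c₀ c₁ N * y₁ N b a (k + 1) +
        solution N b a c₀ c₁ (N + 1) * y₂ N b a (k + 1) := by
  induction k with
  | zero => simp [y₁, y₂, solution]
  | succ k ih =>
    refine ⟨ih.2, ?_⟩
    have e₁ : ((N + k + 1 : ℕ) : ZMod N) = (k + 1 : ℕ) := by simp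
    have e₂ : ((N + k : ℕ) : ZMod N) = (k : ℕ) := by simp
    have h : solution N b a c₀ c₁ (N + (k + 1 + 1)) = C (a (k + 1 : ℕ))⁻¹ *
        ((X - C (b (k + 1 : ℕ))) * solution N b a c₀ c₁ (N + (k + 1))
        - C (a (k : ℕ)) * solution N b a c₀ c₁ (N + k)) := by
      rw [← e₁, ← e₂]; rfl
    rw [h, ih.1, ih.2]
    simp only [y₁, y₂, solution]
    ring

/-- The trace of the monodromy over two periods. -/
theorem discr_two_periods (ha : ∀ k, 0 < a k) :
    y₁ N b a (2 * N) + y₂ N b a (2 * N + 1) = discr N b a ^ 2 - 2 := by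
  have h₁ := (solution_add_period b a 1 0 N).1
  have h₂ := (solution_add_period b a 0 1 N).2
  have hw := wronskian_period b a ha
  rw [two_mul, add_assoc, discr]
  simp only [y₁, y₂] at *
  linear_combination h₁ + h₂ - 2 * hw

theorem wronskian_two_periods (ha : ∀ k, 0 < a k) :
    y₁ N b a (2 * N) * y₂ N b a (2 * N + 1) - y₂ N b a (2 * N) * y₁ N b a (2 * N + 1) = 1 := by
  have h := wronskian_y₁_y₂ b a ha (2 * N)
  rw [Nat.cast_mul, ZMod.natCast_self, mul_zero] at h
  exact mul_left_cancel₀ (C_ne_zero.2 (ha 0).ne') (h.trans (mul_one _).symm)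

/-- A row of `Q(b, a)` acts as a three-term operator, cyclically in the index. -/
theorem sum_jacobiQ_mul (hN : 2 ≤ N) (v : Fin (2 * N) → ℝ) (i p s : Fin (2 * N))
    (hs : (i.val + 1) % (2 * N) = s.val) (hp : (p.val + 1) % (2 * N) = i.val) :
    ∑ j, jacobiQ N b a i j * v j =
      b (i.val + 1 : ℕ) * v i + a (i.val + 1 : ℕ) * v s + a (p.val + 1 : ℕ) * v p := by
  have hi := i.2
  have hps := p.2
  have his : i ≠ s := by
    rintro rfl
    rcases Nat.lt_or_ge (i.val + 1) (2 * N) with h | h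
    · rw [Nat.mod_eq_of_lt h] at hs; omega
    · rw [show i.val + 1 = 2 * N by omega, Nat.mod_self] at hs; omega
  have hip : i ≠ p := by
    rintro rfl
    rcases Nat.lt_or_ge (i.val + 1) (2 * N) with h | h
    · rw [Nat.mod_eq_of_lt h] at hp; omega
    · rw [show i.val + 1 = 2 * N by omega, Nat.mod_self] at hp; omega
  have hsp : s ≠ p := by
    rintro rfl
    rcases Nat.lt_or_ge (i.val + 1) (2 * N) with h | h <;>
    rcases Nat.lt_or_ge (s.val + 1) (2 * N) with h' | h' <;>
    first
    | rw [Nat.mod_eq_of_lt h] at hs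
    | rw [show i.val + 1 = 2 * N by omega, Nat.mod_self] at hs
    all_goals first
    | rw [Nat.mod_eq_of_lt h'] at hp
    | rw [show s.val + 1 = 2 * N by omega, Nat.mod_self] at hp
    all_goals omega
  have key : ∀ j, jacobiQ N b a i j * v j = (if j = i then b (i.val + 1 : ℕ) * v i else 0) +
      (if j = s then a (i.val + 1 : ℕ) * v s else 0) +
      (if j = p then a (p.val + 1 : ℕ) * v p else 0) := by
    intro j
    rw [jacobiQ, Matrix.of_apply]
    by_cases h₁ : j = i
    · subst h₁; simp [his, hip]
    by_cases h₂ : j = s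
    · subst h₂; simp [hs, his, his.symm, hsp]
    by_cases h₃ : j = p
    · subst h₃
      have : (i.val + 1) % (2 * N) ≠ j.val := fun h => h₂ (Fin.ext (h.symm.trans hs))
      simp [hp, hip, hip.symm, hsp.symm, this]
    have h₄ : (i.val + 1) % (2 * N) ≠ j.val := fun h => h₂ (Fin.ext (h.symm.trans hs))
    have h₅ : (j.val + 1) % (2 * N) ≠ i.val := by
      intro h
      refine h₃ (Fin.ext ?_)
      have hj := j.2
      rw [← hp] at h
      rcases Nat.lt_or_ge (j.val + 1) (2 * N) with h' | h' <;>
      rcases Nat.lt_or_ge (p.val + 1) (2 * N) with h'' | h''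
      · rw [Nat.mod_eq_of_lt h', Nat.mod_eq_of_lt h''] at h; omega
      · rw [Nat.mod_eq_of_lt h', show p.val + 1 = 2 * N by omega, Nat.mod_self] at h; omega
      · rw [Nat.mod_eq_of_lt h'', show j.val + 1 = 2 * N by omega, Nat.mod_self] at h; omega
      · omega
    simp [h₁, h₂, h₃, h₄, h₅, Ne.symm h₁]
  rw [Finset.sum_congr rfl fun j _ => key j, Finset.sum_add_distrib, Finset.sum_add_distrib]
  simp

theorem sum_charmatrix_mul (hN : 2 ≤ N) (t : ℝ) (v : Fin (2 * N) → ℝ) (i p s : Fin (2 * N))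
    (hs : (i.val + 1) % (2 * N) = s.val) (hp : (p.val + 1) % (2 * N) = i.val) :
    ∑ j, (Matrix.scalar (Fin (2 * N)) t - jacobiQ N b a) i j * v j =
      (t - b (i.val + 1 : ℕ)) * v i - a (i.val + 1 : ℕ) * v s - a (p.val + 1 : ℕ) * v p := by
  have h := sum_jacobiQ_mul b a hN v i p s hs hp
  simp only [Matrix.sub_apply, sub_mul, Finset.sum_sub_distrib, h, Matrix.scalar_apply,
    Matrix.diagonal_apply, ite_mul, zero_mul, Finset.sum_ite_eq, Finset.mem_univ, if_true]
  ring

theorem charmatrix_solution_interior (hN : 2 ≤ N) (ha : ∀ k, 0 < a k) (t c₀ c₁ : ℝ)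
    (i : Fin (2 * N)) (h₀ : 0 < i.val) (h₁ : i.val + 1 < 2 * N) :
    ∑ j, (Matrix.scalar (Fin (2 * N)) t - jacobiQ N b a) i j *
      (solution N b a c₀ c₁ (j.val + 1)).eval t = 0 := by
  rw [sum_charmatrix_mul b a hN t (fun j => (solution N b a c₀ c₁ (j.val + 1)).eval t) i
    ⟨i.val - 1, by omega⟩ ⟨i.val + 1, h₁⟩ (Nat.mod_eq_of_lt h₁)
    (by rw [Nat.mod_eq_of_lt] <;> simp <;> omega)]
  have h := congrArg (eval t) (C_mul_solution_add_two b a ha c₀ c₁ i.val)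
  simp only [eval_mul, eval_sub, eval_C, eval_X] at h
  simp only [Nat.sub_add_cancel h₀]
  linarith

theorem charmatrix_solution_first (hN : 2 ≤ N) (ha : ∀ k, 0 < a k) (t c₀ c₁ : ℝ)
    (i : Fin (2 * N)) (h₀ : i.val = 0) :
    ∑ j, (Matrix.scalar (Fin (2 * N)) t - jacobiQ N b a) i j *
      (solution N b a c₀ c₁ (j.val + 1)).eval t =
      a 0 * (c₀ - (solution N b a c₀ c₁ (2 * N)).eval t) := by
  rw [sum_charmatrix_mul b a hN t (fun j => (solution N b a c₀ c₁ (j.val + 1)).eval t) i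
    ⟨2 * N - 1, by omega⟩ ⟨1, by omega⟩ (by rw [h₀, Nat.mod_eq_of_lt]; omega)
    (by rw [show 2 * N - 1 + 1 = 2 * N by omega, Nat.mod_self, h₀])]
  have h := congrArg (eval t) (C_mul_solution_add_two b a ha c₀ c₁ 0)
  have h' : (solution N b a c₀ c₁ 0).eval t = c₀ := by simp [solution]
  have e : ((2 * N : ℕ) : ZMod N) = 0 := by simp
  simp only [eval_mul, eval_sub, eval_C, eval_X] at h
  simp only [show 2 * N - 1 + 1 = 2 * N by omega, h₀, e, Nat.cast_zero, h'] at h ⊢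
  simp only [zero_add, Nat.reduceAdd] at h ⊢
  linarith

theorem charmatrix_solution_last (hN : 2 ≤ N) (ha : ∀ k, 0 < a k) (t c₀ c₁ : ℝ)
    (i : Fin (2 * N)) (h₀ : i.val + 1 = 2 * N) :
    ∑ j, (Matrix.scalar (Fin (2 * N)) t - jacobiQ N b a) i j *
      (solution N b a c₀ c₁ (j.val + 1)).eval t =
      a 0 * ((solution N b a c₀ c₁ (2 * N + 1)).eval t - c₁) := by
  rw [sum_charmatrix_mul b a hN t (fun j => (solution N b a c₀ c₁ (j.val + 1)).eval t) i
    ⟨2 * N - 2, by omega⟩ ⟨0, by omega⟩ (by rw [h₀, Nat.mod_self])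
    (by rw [show 2 * N - 2 + 1 = i.val by omega, Nat.mod_eq_of_lt i.2])]
  have h := congrArg (eval t) (C_mul_solution_add_two b a ha c₀ c₁ i.val)
  have h' : (solution N b a c₀ c₁ 1).eval t = c₁ := by simp [solution]
  have e : ((2 * N : ℕ) : ZMod N) = 0 := by simp
  simp only [eval_mul, eval_sub, eval_C, eval_X] at h
  rw [show i.val + 2 = 2 * N + 1 by omega] at h
  simp only [show 2 * N - 2 + 1 = i.val by omega, h₀, e, zero_add, h'] at h ⊢
  linarith

/-- Up to a sign, `det (t - Q(b, a))` is `Δ(t)² - 4` times a nonzero constant. The first two columns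
of `t - Q` are replaced by its values on the two fundamental solutions, which vanish off the first
and the last row; a cyclic shift of the rows makes what is left block triangular. -/
theorem exists_abs_det_eq (hN : 2 ≤ N) (ha : ∀ k, 0 < a k) : ∃ κ : ℝ, ∀ t,
    |(Matrix.scalar (Fin (2 * N)) t - jacobiQ N b a).det| =
      |κ * ((discr N b a).eval t ^ 2 - 4)| := by
  obtain ⟨m, hm⟩ : ∃ m, 2 + m = 2 * N := ⟨2 * N - 2, by omega⟩
  set ec : Fin 2 ⊕ Fin m ≃ Fin (2 * N) := finSumFinEquiv.trans (finCongr hm) with hec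
  set er : Fin 2 ⊕ Fin m ≃ Fin (2 * N) := ec.trans (finRotate (2 * N)).symm with her
  have ec_inl : ∀ i : Fin 2, (ec (Sum.inl i)).val = i.val := fun i => by simp [hec]
  have ec_inr : ∀ i : Fin m, (ec (Sum.inr i)).val = 2 + i.val := fun i => by simp [hec]
  have er_succ : ∀ x, ((er x).val + 1) % (2 * N) = (ec x).val := by
    intro x
    have h : finRotate (2 * N) (er x) = ec x := by rw [her]; exact Equiv.apply_symm_apply _ _
    rw [← h]
    obtain ⟨n, hn⟩ : ∃ n, 2 * N = n + 1 := ⟨2 * N - 1, by omega⟩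
    generalize er x = y
    clear_value ec er
    revert y
    rw [hn]
    intro y
    rw [finRotate_apply]
    simp [Fin.val_add]
  have er_inr : ∀ i : Fin m, (er (Sum.inr i)).val = 1 + i.val := by
    intro i
    have h := er_succ (Sum.inr i)
    rw [ec_inr] at h
    have h₁ := (er (Sum.inr i)).2
    rcases Nat.lt_or_ge ((er (Sum.inr i)).val + 1) (2 * N) with h' | h'
    · rw [Nat.mod_eq_of_lt h'] at h; omega
    · rw [show (er (Sum.inr i)).val + 1 = 2 * N by omega, Nat.mod_self] at h; omega
  have er_0 : (er (Sum.inl 0)).val + 1 = 2 * N := by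
    have h := er_succ (Sum.inl 0)
    rw [ec_inl] at h
    have h₁ := (er (Sum.inl 0)).2
    rcases Nat.lt_or_ge ((er (Sum.inl 0)).val + 1) (2 * N) with h' | h'
    · rw [Nat.mod_eq_of_lt h'] at h; simp at h
    · omega
  have er_1 : (er (Sum.inl 1)).val = 0 := by
    have h := er_succ (Sum.inl 1)
    rw [ec_inl] at h
    have h₁ := (er (Sum.inl 1)).2
    rcases Nat.lt_or_ge ((er (Sum.inl 1)).val + 1) (2 * N) with h' | h'
    · rw [Nat.mod_eq_of_lt h'] at h; simpa using h
    · rw [show (er (Sum.inl 1)).val + 1 = 2 * N by omega, Nat.mod_self] at h; simp at h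
  -- the determinant of the lower right block
  set d : ℝ := ∏ i : Fin m, -a (i.val + 2 : ℕ) with hd
  refine ⟨a 0 * a 1 * d, fun t => ?_⟩
  set M := Matrix.scalar (Fin (2 * N)) t - jacobiQ N b a with hM
  let s : Fin 2 → ℕ → ℝ := fun j k => (solution N b a (1 - j.val) j.val k).eval t
  have hs0 : ∀ k, s 0 k = (y₁ N b a k).eval t := fun k => by simp [s, y₁]
  have hs1 : ∀ k, s 1 k = (y₂ N b a k).eval t := fun k => by simp [s, y₂]
  -- `W` puts the fundamental solutions, at the sites `1, …, 2N`, into the first two columns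
  set U : Matrix (Fin 2) (Fin 2) ℝ := Matrix.of fun i j => s j (i.val + 1) with hU
  set V : Matrix (Fin m) (Fin 2) ℝ := Matrix.of fun i j => s j (2 + i.val + 1) with hV
  set W : Matrix (Fin 2 ⊕ Fin m) (Fin 2 ⊕ Fin m) ℝ := Matrix.fromBlocks U 0 V 1 with hW
  -- the row order of `A` starts with the last and the first row, where the three-term recursion
  -- of the solutions misses the periodic boundary condition; `B` collects these defects
  set A := M.submatrix er ec with hA
  set B : Matrix (Fin 2) (Fin 2) ℝ := !![a 0 * ((y₁ N b a (2 * N + 1)).eval t - 0),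
    a 0 * ((y₂ N b a (2 * N + 1)).eval t - 1);
    a 0 * (1 - (y₁ N b a (2 * N)).eval t), a 0 * (0 - (y₂ N b a (2 * N)).eval t)] with hB
  have hcol : ∀ x j, (A * W) x (Sum.inl j) = ∑ c, M (er x) c * s j (c.val + 1) := by
    intro x j
    rw [Matrix.mul_apply, ← Equiv.sum_comp ec]
    refine Finset.sum_congr rfl fun y _ => ?_
    rcases y with y | y
    · simp [hA, hW, hU, ec_inl]
    · simp [hA, hW, hV, ec_inr]
  have hcol' : ∀ x j, (A * W) x (Sum.inr j) = A x (Sum.inr j) := by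
    intro x j
    rw [Matrix.mul_apply, Fintype.sum_sum_type]
    simp [hW, Matrix.one_apply]
  have hblock : A * W = Matrix.fromBlocks B A.toBlocks₁₂ 0 A.toBlocks₂₂ := by
    ext x y
    rcases y with j | j
    · rw [hcol]
      rcases x with i | i
      · fin_cases i
        · have h := fun c₀ c₁ => charmatrix_solution_last b a hN ha t c₀ c₁ _ er_0
          simp only [← hM] at h
          fin_cases j
          · simpa [s, hB, y₁] using h 1 0
          · simpa [s, hB, y₂] using h 0 1
        · have h := fun c₀ c₁ => charmatrix_solution_first b a hN ha t c₀ c₁ _ er_1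
          simp only [← hM] at h
          fin_cases j
          · simpa [s, hB, y₁] using h 1 0
          · simpa [s, hB, y₂] using h 0 1
      · have hi := i.2
        exact charmatrix_solution_interior b a hN ha t _ _ _ (by rw [er_inr]; omega)
          (by rw [er_inr]; omega)
    · rw [hcol']
      rcases x with i | i <;> simp [Matrix.toBlocks₁₂, Matrix.toBlocks₂₂]
  -- on and above the diagonal of the lower right block only the side diagonal of `Q` is left
  have hlow : A.toBlocks₂₂.det = d := by
    have hent : ∀ i j : Fin m, i ≤ j →
        A.toBlocks₂₂ i j = if i = j then -a (i.val + 2 : ℕ) else 0 := by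
      intro i j hij
      have hij' : i.val ≤ j.val := hij
      have hi := i.2
      have hj := j.2
      have e₀ : er (Sum.inr i) ≠ ec (Sum.inr j) := by
        intro h
        have := congrArg Fin.val h
        rw [er_inr, ec_inr] at this; omega
      have e₁ : ((er (Sum.inr i)).val + 1) % (2 * N) = (ec (Sum.inr j)).val ↔ i = j := by
        rw [er_inr, ec_inr, Nat.mod_eq_of_lt (by omega), Fin.ext_iff]; omega
      have e₂ : ((ec (Sum.inr j)).val + 1) % (2 * N) ≠ (er (Sum.inr i)).val := by
        rw [er_inr, ec_inr]
        rcases Nat.lt_or_ge (2 + j.val + 1) (2 * N) with h' | h'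
        · rw [Nat.mod_eq_of_lt h']; omega
        · rw [show 2 + j.val + 1 = 2 * N by omega, Nat.mod_self]; omega
      simp only [Matrix.toBlocks₂₂, Matrix.of_apply, hA, Matrix.submatrix_apply, hM,
        Matrix.sub_apply, jacobiQ, Matrix.scalar_apply, Matrix.diagonal_apply, if_neg e₀,
        if_neg e₂, e₁]
      split_ifs
      · rw [zero_sub, er_inr, show 1 + i.val + 1 = i.val + 2 by omega]
      · simp
    rw [Matrix.det_of_isLowerTriangular _ (fun i j hij => by
      have hij' : i < j := hij
      rw [hent i j hij'.le, if_neg hij'.ne]), hd]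
    exact Finset.prod_congr rfl fun i _ => by rw [hent i i le_rfl, if_pos rfl]
  have hdetW : a 1 * W.det = a 0 := by
    have h := congrArg (eval t) (wronskian_y₁_y₂ b a ha 1)
    simp only [eval_mul, eval_sub, eval_C] at h
    rw [hW, Matrix.det_fromBlocks_zero₁₂, Matrix.det_one, mul_one, hU, Matrix.det_fin_two]
    simp only [Matrix.of_apply, hs0, hs1, Fin.val_zero, Fin.val_one]
    simp only [Nat.cast_one, zero_add] at h ⊢
    linarith
  have hdetB : B.det = -(a 0 ^ 2 * ((discr N b a).eval t ^ 2 - 4)) := by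
    have h₁ := congrArg (eval t) (discr_two_periods b a ha)
    have h₂ := congrArg (eval t) (wronskian_two_periods b a ha)
    simp only [eval_mul, eval_sub, eval_add, eval_pow, eval_one, eval_ofNat] at h₁ h₂
    rw [hB, Matrix.det_fin_two_of]
    linear_combination (-a 0 ^ 2) * h₁ + a 0 ^ 2 * h₂
  have hdet := congrArg Matrix.det hblock
  rw [Matrix.det_mul, Matrix.det_fromBlocks_zero₂₁, hlow, hdetB] at hdet
  have hAM : |A.det| = |M.det| := Matrix.abs_det_submatrix_equiv_equiv _ _ _
  rw [← hAM, ← abs_neg]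
  congr 1
  have h0 := (ha 0).ne'
  apply mul_left_cancel₀ h0
  linear_combination (-a 1) * hdet + A.det * hdetW

/-- The identity `Δ² - 4 = C₂^{-2N} ∏ (λ - λ_j)`. -/
theorem charpoly_jacobiQ (hN : 2 ≤ N) (ha : ∀ k, 0 < a k) :
    discr N b a ^ 2 - 4 = C ((casimir₂ N a ^ N)⁻¹ ^ 2) * (jacobiQ N b a).charpoly := by
  obtain ⟨κ, hκ⟩ := exists_abs_det_eq b a hN ha
  have hc : 0 < (casimir₂ N a ^ N)⁻¹ := inv_pos.2 (pow_pos (casimir₂_pos N a ha) N)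
  -- the sign left open by `exists_abs_det_eq` does not depend on `t`, as `ℝ[X]` is a domain
  have hsq : (jacobiQ N b a).charpoly ^ 2 = (C κ * (discr N b a ^ 2 - 4)) ^ 2 := by
    refine Polynomial.funext fun t => ?_
    rw [eval_pow, eval_pow, Matrix.eval_charpoly, sq_eq_sq_iff_abs_eq_abs, hκ t]
    simp
  have hdeg := discr_natDegree b a hN ha
  have hlc : (discr N b a ^ 2 - 4).coeff (2 * N) = (casimir₂ N a ^ N)⁻¹ ^ 2 := by
    rw [coeff_sub, coeff_pow_of_natDegree_le hdeg.le, (discr_natDegree_le_and_coeff b a hN ha).2,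
      show (4 : ℝ[X]) = C 4 from rfl, coeff_C_of_ne_zero (by omega), sub_zero]
  have hmon := Matrix.charpoly_monic (jacobiQ N b a)
  have hcd : (jacobiQ N b a).charpoly.natDegree = 2 * N := by
    rw [Matrix.charpoly_natDegree_eq_dim, Fintype.card_fin]
  have hcc : (jacobiQ N b a).charpoly.coeff (2 * N) = 1 := by
    have h : (jacobiQ N b a).charpoly.coeff (jacobiQ N b a).charpoly.natDegree = 1 := hmon
    rwa [hcd] at h
  have key : ∃ κ' : ℝ, (jacobiQ N b a).charpoly = C κ' * (discr N b a ^ 2 - 4) := by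
    rcases sq_eq_sq_iff_eq_or_eq_neg.1 hsq with h | h
    · exact ⟨κ, h⟩
    · exact ⟨-κ, by rw [h, C_neg, neg_mul]⟩
  obtain ⟨κ', h⟩ := key
  have h1 : 1 = κ' * (casimir₂ N a ^ N)⁻¹ ^ 2 := by rw [← hcc, h, coeff_C_mul, hlc]
  rw [h, ← mul_assoc, ← C_mul, mul_comm _ κ', ← h1, C_1, one_mul]

end Charpoly

/-! ### Sorted roots of real polynomials -/

section SortedRoots

/-- The `i`-th root, counted from `0`, of a real polynomial, in increasing order and with
multiplicities (junk value `0` beyond the last root). -/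
def sortedRoot (p : ℝ[X]) (i : ℕ) : ℝ := (p.roots.sort (· ≤ ·)).getD i 0

theorem sortedRoot_eq_getElem (p : ℝ[X]) {i : ℕ} (hi : i < (p.roots.sort (· ≤ ·)).length) :
    sortedRoot p i = (p.roots.sort (· ≤ ·))[i] := by
  rw [sortedRoot, List.getD_eq_getElem _ _ hi]

theorem sortedRoot_mono (p : ℝ[X]) {i j : ℕ} (hij : i ≤ j) (hj : j < p.roots.card) :
    sortedRoot p i ≤ sortedRoot p j := by
  have hl : (p.roots.sort (· ≤ ·)).length = p.roots.card := Multiset.length_sort _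
  rw [sortedRoot_eq_getElem p (by omega), sortedRoot_eq_getElem p (by omega)]
  rcases hij.eq_or_lt with rfl | h
  · exact le_rfl
  · exact List.pairwise_iff_getElem.1 (Multiset.pairwise_sort p.roots (· ≤ ·)) i j _ _ h

theorem map_sortedRoot (p : ℝ[X]) :
    (Multiset.range p.roots.card).map (sortedRoot p) = p.roots := by
  have hl : (p.roots.sort (· ≤ ·)).length = p.roots.card := Multiset.length_sort _
  conv_rhs => rw [← Multiset.sort_eq p.roots (· ≤ ·)]
  rw [Multiset.range, Multiset.map_coe, Multiset.coe_eq_coe]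
  refine List.Perm.of_eq (List.ext_getElem (by simp) fun i h₁ h₂ => ?_)
  rw [List.getElem_map, List.getElem_range, sortedRoot_eq_getElem p h₂]

theorem sortedRoot_strictMono (p : ℝ[X]) (hp : p.roots.Nodup) {i j : ℕ} (hij : i < j)
    (hj : j < p.roots.card) : sortedRoot p i < sortedRoot p j := by
  refine lt_of_le_of_ne (sortedRoot_mono p hij.le hj) fun h => hij.ne ?_
  rw [← map_sortedRoot p] at hp
  exact Multiset.inj_on_of_nodup_map hp i (by simp; omega) j (by simpa) h

theorem sortedRoot_mem (p : ℝ[X]) {i : ℕ} (hi : i < p.roots.card) : sortedRoot p i ∈ p.roots := by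
  rw [← map_sortedRoot p]
  exact Multiset.mem_map_of_mem _ (by simpa)

theorem eq_C_mul_prod_sortedRoot {p : ℝ[X]} (hp : p.Splits) :
    p = C p.leadingCoeff * ∏ i ∈ Finset.range p.roots.card, (X - C (sortedRoot p i)) := by
  conv_lhs => rw [hp.eq_prod_roots, ← map_sortedRoot p, Multiset.map_map]
  rfl

/-- The sign of a product of differences, when the first `m` of the `n` factors are positive and
the others are negative. -/
theorem sign_prod_sub {v : ℕ → ℝ} {x : ℝ} {m n : ℕ} (hmn : m ≤ n) (h₁ : ∀ i < m, v i < x)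
    (h₂ : ∀ i, m ≤ i → i < n → x < v i) :
    0 < (-1) ^ (n - m) * ∏ i ∈ Finset.range n, (x - v i) := by
  have h : ∏ i ∈ Finset.Ico m n, (v i - x) = (-1) ^ (n - m) * ∏ i ∈ Finset.Ico m n, (x - v i) := by
    rw [← Nat.card_Ico m n, ← Finset.prod_const, ← Finset.prod_mul_distrib]
    exact Finset.prod_congr rfl fun i _ => by ring
  rw [← Finset.prod_range_mul_prod_Ico _ hmn, mul_left_comm, ← h]
  refine mul_pos (Finset.prod_pos fun i hi => ?_) (Finset.prod_pos fun i hi => ?_)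
  · exact sub_pos.2 (h₁ i (Finset.mem_range.1 hi))
  · exact sub_pos.2 (h₂ i (Finset.mem_Ico.1 hi).1 (Finset.mem_Ico.1 hi).2)

end SortedRoots

/-! ### Dirichlet eigenvalues -/

section Dirichlet

variable {N : ℕ} (b a : ZMod N → ℝ)

theorem exists_y₁_two_eq_C (ha : ∀ k, 0 < a k) : ∃ c : ℝ, c ≠ 0 ∧ y₁ N b a 2 = C c := by
  refine ⟨-a 0 * (a 1)⁻¹, mul_ne_zero (neg_ne_zero.2 (ha 0).ne') (inv_ne_zero (ha 1).ne'), ?_⟩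
  simp [y₁, solution, mul_comm]

/-- At a zero `x` of `y₁(N + 1, ·)`, the product `y₁'(N + 1, x) y₁(N, x)` is positive. -/
theorem y₁_derivative_mul_pos (hN : 2 ≤ N) (ha : ∀ k, 0 < a k) {x : ℝ}
    (hx : (y₁ N b a (N + 1)).eval x = 0) :
    0 < (derivative (y₁ N b a (N + 1))).eval x * (y₁ N b a N).eval x := by
  have h := congrArg (eval x) (christoffelDarboux_derivative b a ha 1 0 N)
  rw [y₁] at *
  simp only [eval_mul, eval_sub, eval_C, eval_finsetSum, eval_pow, hx, mul_zero, sub_zero] at h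
  have hpos : 0 < ∑ j ∈ Finset.range N, (solution N b a 1 0 (j + 1)).eval x ^ 2 := by
    refine Finset.sum_pos' (fun _ _ => sq_nonneg _) ⟨1, Finset.mem_range.2 (by omega), ?_⟩
    obtain ⟨c, hc, h₂⟩ := exists_y₁_two_eq_C b a ha
    rw [y₁] at h₂
    rw [h₂, eval_C]
    positivity
  rw [← h] at hpos
  exact (mul_pos_iff_of_pos_left (ha _)).1 hpos

theorem y₁_ne_zero (hN : 2 ≤ N) (ha : ∀ k, 0 < a k) : y₁ N b a (N + 1) ≠ 0 := by
  intro h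
  have := y₁_coeff_neg b a hN ha
  simp [h] at this

/-- The Dirichlet eigenvalues are real: for a zero `z`, the Christoffel–Darboux identity at `z` and
its conjugate reads `0 = (z - conj z) ∑ |y₁(j, z)|²`. -/
theorem y₁_splits (hN : 2 ≤ N) (ha : ∀ k, 0 < a k) : (y₁ N b a (N + 1)).Splits := by
  refine Splits.of_splits_map_of_injective (i := algebraMap ℝ ℂ) (algebraMap ℝ ℂ).injective
    (IsAlgClosed.splits _) fun z hz => ?_
  have hz' : aeval z (y₁ N b a (N + 1)) = 0 := by
    have h := isRoot_of_mem_roots hz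
    rwa [IsRoot, eval_map_algebraMap] at h
  have hconj : ∀ k, aeval (starRingEnd ℂ z) (y₁ N b a k) = starRingEnd ℂ (aeval z (y₁ N b a k)) :=
    fun k => Polynomial.aeval_conj _ _
  have h := christoffelDarboux b a ha 1 0 z (starRingEnd ℂ z) N
  rw [← y₁] at h
  simp only [hconj, hz', map_zero, mul_zero, zero_mul, sub_zero, Complex.mul_conj] at h
  have hs : (∑ j ∈ Finset.range N, (Complex.normSq (aeval z (y₁ N b a (j + 1))) : ℂ)) ≠ 0 := by
    rw [← Complex.ofReal_sum, Complex.ofReal_ne_zero]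
    refine (Finset.sum_pos' (fun _ _ => Complex.normSq_nonneg _)
      ⟨1, Finset.mem_range.2 (by omega), ?_⟩).ne'
    obtain ⟨c, hc, h₂⟩ := exists_y₁_two_eq_C b a ha
    rw [h₂, aeval_C, Complex.normSq_pos]
    simpa
  have hzz : z - starRingEnd ℂ z = 0 := (mul_eq_zero.1 h.symm).resolve_right hs
  obtain ⟨r, hr⟩ := Complex.conj_eq_iff_real.1 (sub_eq_zero.1 hzz).symm
  exact ⟨r, hr.symm⟩

theorem y₁_card_roots (hN : 2 ≤ N) (ha : ∀ k, 0 < a k) :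
    (y₁ N b a (N + 1)).roots.card = N - 1 := by
  rw [splits_iff_card_roots.1 (y₁_splits b a hN ha), y₁_natDegree b a hN ha]

theorem y₁_roots_nodup (hN : 2 ≤ N) (ha : ∀ k, 0 < a k) : (y₁ N b a (N + 1)).roots.Nodup := by
  rw [Multiset.nodup_iff_count_le_one]
  intro x
  by_contra! h
  rw [count_roots, one_lt_rootMultiplicity_iff_isRoot (y₁_ne_zero b a hN ha)] at h
  have := y₁_derivative_mul_pos b a hN ha h.1
  rw [h.2, zero_mul] at this
  exact lt_irrefl _ this

theorem mu_root (hN : 2 ≤ N) (ha : ∀ k, 0 < a k) {n : ℕ} (hn : n < N - 1) :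
    (y₁ N b a (N + 1)).eval (mu N b a (n + 1)) = 0 :=
  isRoot_of_mem_roots (sortedRoot_mem _ (by rwa [y₁_card_roots b a hN ha]))

theorem mu_strictMono (hN : 2 ≤ N) (ha : ∀ k, 0 < a k) {m n : ℕ} (hmn : m < n) (hn : n < N - 1) :
    mu N b a (m + 1) < mu N b a (n + 1) :=
  sortedRoot_strictMono _ (y₁_roots_nodup b a hN ha) hmn (by rwa [y₁_card_roots b a hN ha])

theorem y₁_eq_prod (hN : 2 ≤ N) (ha : ∀ k, 0 < a k) :
    y₁ N b a (N + 1) = C ((y₁ N b a (N + 1)).coeff (N - 1)) *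
      ∏ i ∈ Finset.range (N - 1), (X - C (mu N b a (i + 1))) := by
  have h := eq_C_mul_prod_sortedRoot (y₁_splits b a hN ha)
  rwa [leadingCoeff, y₁_natDegree b a hN ha, y₁_card_roots b a hN ha] at h

/-- At the zeros of `y₁(N + 1, ·)` the solution `y₁(N, ·)` alternates in sign. -/
theorem sign_y₁_mu (hN : 2 ≤ N) (ha : ∀ k, 0 < a k) {n : ℕ} (hn : n < N - 1) :
    0 < (-1) ^ (N - 1 - n) * (y₁ N b a N).eval (mu N b a (n + 1)) := by
  have hpos := y₁_derivative_mul_pos b a hN ha (mu_root b a hN ha hn)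
  have hc := y₁_coeff_neg b a hN ha
  set c := (y₁ N b a (N + 1)).coeff (N - 1)
  set x := mu N b a (n + 1) with hx
  have hder : (derivative (y₁ N b a (N + 1))).eval x = c * ((∏ i ∈ Finset.range n,
      (x - mu N b a (i + 1))) * ∏ i ∈ Finset.Ico (n + 1) (N - 1), (x - mu N b a (i + 1))) := by
    have h : y₁ N b a (N + 1) = (X - C x) * (C c * ((∏ i ∈ Finset.range n,
        (X - C (mu N b a (i + 1)))) * ∏ i ∈ Finset.Ico (n + 1) (N - 1),
          (X - C (mu N b a (i + 1))))) := by
      conv_lhs => rw [y₁_eq_prod b a hN ha, ← Finset.prod_range_mul_prod_Ico _ hn.le,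
        Finset.prod_eq_prod_Ico_succ_bot hn]
      ring
    rw [h, derivative_mul]
    simp [eval_prod]
  have h₁ : 0 < ∏ i ∈ Finset.range n, (x - mu N b a (i + 1)) := Finset.prod_pos fun i hi =>
    sub_pos.2 (mu_strictMono b a hN ha (Finset.mem_range.1 hi) hn)
  have h₂ : 0 < ∏ i ∈ Finset.Ico (n + 1) (N - 1), (mu N b a (i + 1) - x) :=
    Finset.prod_pos fun i hi => by
      obtain ⟨h, h'⟩ := Finset.mem_Ico.1 hi
      exact sub_pos.2 (mu_strictMono b a hN ha (by omega) h')
  have h₃ : ∏ i ∈ Finset.Ico (n + 1) (N - 1), (mu N b a (i + 1) - x) =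
      (-1) ^ (N - 1 - (n + 1)) * ∏ i ∈ Finset.Ico (n + 1) (N - 1), (x - mu N b a (i + 1)) := by
    rw [← Nat.card_Ico (n + 1) (N - 1), ← Finset.prod_const, ← Finset.prod_mul_distrib]
    exact Finset.prod_congr rfl fun i _ => by ring
  rw [show N - 1 - n = N - 1 - (n + 1) + 1 by omega, pow_succ]
  have h₄ : (-1 : ℝ) ^ (N - 1 - (n + 1)) * (-1) ^ (N - 1 - (n + 1)) = 1 := by
    rw [← mul_pow]; norm_num
  set s : ℝ := (-1) ^ (N - 1 - (n + 1))
  set p₂ := ∏ i ∈ Finset.Ico (n + 1) (N - 1), (x - mu N b a (i + 1))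
  set p₁ := ∏ i ∈ Finset.range n, (x - mu N b a (i + 1))
  rw [h₃] at h₂
  rw [hder] at hpos
  have h₅ : 0 < (-c) * p₁ * (s * p₂) := mul_pos (mul_pos (neg_pos.2 hc) h₁) h₂
  have h₆ : (s * -1 * (y₁ N b a N).eval x) * ((-c) * p₁ * (s * p₂)) =
      c * (p₁ * p₂) * (y₁ N b a N).eval x := by
    linear_combination (c * (p₁ * p₂) * (y₁ N b a N).eval x) * h₄
  rw [← h₆] at hpos
  exact (mul_pos_iff_of_pos_right h₅).1 hpos

theorem y₁_mul_y₂_mu (hN : 2 ≤ N) (ha : ∀ k, 0 < a k) {n : ℕ} (hn : n < N - 1) :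
    (y₁ N b a N).eval (mu N b a (n + 1)) * (y₂ N b a (N + 1)).eval (mu N b a (n + 1)) = 1 := by
  have h := congrArg (eval (mu N b a (n + 1))) (wronskian_period b a ha)
  simpa [mu_root b a hN ha hn] using h

/-- At the Dirichlet eigenvalues `Δ² - 4` is the square of the second coordinate of `μ_n^*`. -/
theorem discr_sq_sub_four_mu (hN : 2 ≤ N) (ha : ∀ k, 0 < a k) {n : ℕ} (hn : n < N - 1) :
    (discr N b a).eval (mu N b a (n + 1)) ^ 2 - 4 = ((y₁ N b a N).eval (mu N b a (n + 1))
      - (y₂ N b a (N + 1)).eval (mu N b a (n + 1))) ^ 2 := by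
  rw [discr, eval_add]
  linear_combination 4 * y₁_mul_y₂_mu b a hN ha hn

/-- At the Dirichlet eigenvalues `Δ` is the sum of `y₁(N)` and its inverse `y₂(N + 1)`, so that
`|Δ| ≥ 2`, with the sign of `y₁(N)`. -/
theorem sign_discr_mu (hN : 2 ≤ N) (ha : ∀ k, 0 < a k) {n : ℕ} (hn : n < N - 1) :
    2 ≤ (-1) ^ (N - 1 - n) * (discr N b a).eval (mu N b a (n + 1)) := by
  have h₁ := sign_y₁_mu b a hN ha hn
  have h₂ := y₁_mul_y₂_mu b a hN ha hn
  rw [discr, eval_add, mul_add]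
  set u := (y₁ N b a N).eval (mu N b a (n + 1))
  set w := (y₂ N b a (N + 1)).eval (mu N b a (n + 1))
  have h₄ : ((-1 : ℝ) ^ (N - 1 - n)) * (-1) ^ (N - 1 - n) = 1 := by
    rw [← mul_pow]; norm_num
  set s : ℝ := (-1) ^ (N - 1 - n)
  have h₅ : (s * u) * (s * w) = 1 := by linear_combination h₄ * (u * w) + h₂
  have h₆ : 0 < s * w := by
    by_contra! h
    nlinarith
  nlinarith [sq_nonneg (s * u - s * w)]

end Dirichlet

/-! ### Periodic eigenvalues -/

section Spectrum

variable {N : ℕ} (b a : ZMod N → ℝ)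

theorem jacobiQ_isHermitian (hN : 2 ≤ N) : (jacobiQ N b a).IsHermitian := by
  ext i j
  rw [Matrix.conjTranspose_apply, star_trivial, jacobiQ, Matrix.of_apply, Matrix.of_apply]
  have hi := i.2
  have hj := j.2
  by_cases h : i = j
  · rw [h]
  rw [if_neg h, if_neg (Ne.symm h)]
  by_cases h₁ : (i.val + 1) % (2 * N) = j.val <;> by_cases h₂ : (j.val + 1) % (2 * N) = i.val
  · exfalso
    rcases Nat.lt_or_ge (i.val + 1) (2 * N) with h' | h' <;>
    rcases Nat.lt_or_ge (j.val + 1) (2 * N) with h'' | h''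
    · rw [Nat.mod_eq_of_lt h'] at h₁; rw [Nat.mod_eq_of_lt h''] at h₂; omega
    · rw [Nat.mod_eq_of_lt h'] at h₁
      rw [show j.val + 1 = 2 * N by omega, Nat.mod_self] at h₂; omega
    · rw [Nat.mod_eq_of_lt h''] at h₂
      rw [show i.val + 1 = 2 * N by omega, Nat.mod_self] at h₁; omega
    · omega
  all_goals simp [h₁, h₂]

theorem charpoly_card_roots (hN : 2 ≤ N) : (jacobiQ N b a).charpoly.roots.card = 2 * N := by
  rw [splits_iff_card_roots.1 (jacobiQ_isHermitian b a hN).splits_charpoly,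
    Matrix.charpoly_natDegree_eq_dim, Fintype.card_fin]

theorem lam_mono (hN : 2 ≤ N) {i j : ℕ} (hij : i ≤ j) (hj : j < 2 * N) :
    lam N b a (i + 1) ≤ lam N b a (j + 1) :=
  sortedRoot_mono _ hij (by rwa [charpoly_card_roots b a hN])

theorem charpoly_eq_prod (hN : 2 ≤ N) :
    (jacobiQ N b a).charpoly = ∏ i ∈ Finset.range (2 * N), (X - C (lam N b a (i + 1))) := by
  have h := eq_C_mul_prod_sortedRoot (jacobiQ_isHermitian b a hN).splits_charpoly
  rwa [(Matrix.charpoly_monic _).leadingCoeff, C_1, one_mul, charpoly_card_roots b a hN] at h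

theorem discr_sq_sub_four_eq_prod (hN : 2 ≤ N) (ha : ∀ k, 0 < a k) (x : ℝ) :
    (discr N b a).eval x ^ 2 - 4 = (casimir₂ N a ^ N)⁻¹ ^ 2 *
      ∏ i ∈ Finset.range (2 * N), (x - lam N b a (i + 1)) := by
  have h := congrArg (eval x) (charpoly_jacobiQ b a hN ha)
  rw [charpoly_eq_prod b a hN] at h
  simpa [eval_prod] using h

theorem exists_gt_discr_pos (hN : 2 ≤ N) (ha : ∀ k, 0 < a k) (x : ℝ) :
    ∃ r, x < r ∧ 0 < (discr N b a).eval r := by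
  have hd := discr_natDegree b a hN ha
  have h := Polynomial.tendsto_atTop_of_leadingCoeff_nonneg (discr N b a)
    (natDegree_pos_iff_degree_pos.1 (by omega))
    (by rw [discr_leadingCoeff b a hN ha]
        exact (inv_pos.2 (pow_pos (casimir₂_pos N a ha) N)).le)
  obtain ⟨r, h₁, h₂⟩ := ((h.eventually_gt_atTop 0).and (Filter.eventually_gt_atTop x)).exists
  exact ⟨r, h₂, h₁⟩

theorem exists_lt_discr_pos (hN : 2 ≤ N) (ha : ∀ k, 0 < a k) (x : ℝ) :
    ∃ r, r < x ∧ 0 < (-1) ^ N * (discr N b a).eval r := by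
  have hd := discr_natDegree b a hN ha
  set q : ℝ[X] := C ((-1) ^ N) * (discr N b a).comp (-X) with hq
  have hs : ((-1 : ℝ)) ^ N ≠ 0 := pow_ne_zero _ (by norm_num)
  have hqd : q.natDegree = N := by
    rw [hq, natDegree_C_mul hs, natDegree_comp, natDegree_neg, natDegree_X, mul_one, hd]
  have hql : q.leadingCoeff = (casimir₂ N a ^ N)⁻¹ := by
    rw [hq, leadingCoeff_mul, leadingCoeff_C, leadingCoeff_comp (by simp), leadingCoeff_neg,
      leadingCoeff_X, hd, discr_leadingCoeff b a hN ha, mul_left_comm, ← mul_pow]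
    norm_num
  have h := Polynomial.tendsto_atTop_of_leadingCoeff_nonneg q
    (natDegree_pos_iff_degree_pos.1 (by omega))
    (by rw [hql]; exact (inv_pos.2 (pow_pos (casimir₂_pos N a ha) N)).le)
  obtain ⟨r, h₁, h₂⟩ := ((h.eventually_gt_atTop 0).and (Filter.eventually_gt_atTop (-x))).exists
  refine ⟨-r, by linarith, ?_⟩
  simpa [hq] using h₁

theorem exists_zero_of_sign_change (p : ℝ[X]) {x y s : ℝ} (hxy : x < y) (hx : 0 < s * p.eval x)
    (hy : s * p.eval y < 0) : ∃ z, x < z ∧ z < y ∧ p.eval z = 0 := by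
  have hc : ContinuousOn (fun t => s * p.eval t) (Set.Icc x y) :=
    (continuous_const.mul p.continuous).continuousOn
  obtain ⟨z, hz, h⟩ := intermediate_value_Ioo' hxy.le hc (show (0 : ℝ) ∈ Set.Ioo _ _ from ⟨hy, hx⟩)
  have hs : s ≠ 0 := by rintro rfl; simp at hx
  exact ⟨z, hz.1, hz.2, (mul_eq_zero.1 h).resolve_left hs⟩

/-- The zeros of `Δ` interlace with the Dirichlet eigenvalues. -/
theorem exists_zero_discr (hN : 2 ≤ N) (ha : ∀ k, 0 < a k) {j : ℕ} (hj : j < N) :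
    ∃ ρ, (discr N b a).eval ρ = 0 ∧ (∀ n, n < j → mu N b a (n + 1) < ρ) ∧
      ∀ n, j ≤ n → n < N - 1 → ρ < mu N b a (n + 1) := by
  have hmono : ∀ m n, m ≤ n → n < N - 1 → mu N b a (m + 1) ≤ mu N b a (n + 1) := by
    intro m n hmn hn
    rcases hmn.eq_or_lt with rfl | h
    · exact le_rfl
    · exact (mu_strictMono b a hN ha h hn).le
  have hneg : ∀ k : ℕ, ∀ x : ℝ, 0 < (-1) ^ k * x → (-1 : ℝ) ^ (k + 1) * x < 0 := by
    intro k x h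
    rw [pow_succ]; linarith
  have hl : ∀ x, (j < N - 1 → x = mu N b a (j + 1)) →
      ∃ l, (j < N - 1 → l < x) ∧ 0 < (-1) ^ (N - 1 - j + 1) * (discr N b a).eval l ∧
        ∀ n, n < j → mu N b a (n + 1) ≤ l := by
    intro x hx
    rcases Nat.eq_zero_or_pos j with rfl | hj'
    · obtain ⟨l, h₁, h₂⟩ := exists_lt_discr_pos b a hN ha x
      exact ⟨l, fun _ => h₁, by rwa [show N - 1 - 0 + 1 = N by omega], by simp⟩
    · obtain ⟨i, rfl⟩ : ∃ i, j = i + 1 := ⟨j - 1, by omega⟩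
      refine ⟨mu N b a (i + 1), fun h => ?_, ?_, fun n hn => hmono n i (by omega) (by omega)⟩
      · rw [hx h]; exact mu_strictMono b a hN ha (Nat.lt_succ_self i) h
      · have := sign_discr_mu b a hN ha (n := i) (by omega)
        rw [show N - 1 - (i + 1) + 1 = N - 1 - i by omega]
        linarith
  obtain ⟨l, h₁, h₂, h₃⟩ := hl (mu N b a (j + 1)) fun _ => rfl
  have hr : ∃ r, l < r ∧ 0 < (-1) ^ (N - 1 - j) * (discr N b a).eval r ∧
      ∀ n, j ≤ n → n < N - 1 → r ≤ mu N b a (n + 1) := by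
    by_cases hj' : j < N - 1
    · exact ⟨_, h₁ hj', by linarith [sign_discr_mu b a hN ha hj'], fun n hn hn' => hmono j n hn hn'⟩
    · obtain ⟨r, h₄, h₅⟩ := exists_gt_discr_pos b a hN ha l
      refine ⟨r, h₄, by rwa [show N - 1 - j = 0 by omega, pow_zero, one_mul], fun n hn hn' => ?_⟩
      omega
  obtain ⟨r, h₄, h₅, h₆⟩ := hr
  obtain ⟨ρ, h₇, h₈, h₉⟩ := exists_zero_of_sign_change _ h₄ h₂ (hneg _ _ h₅)
  exact ⟨ρ, h₉, fun n hn => (h₃ n hn).trans_lt h₇, fun n hn hn' => h₈.trans_le (h₆ n hn hn')⟩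

/-- A point which is not a periodic eigenvalue splits the increasing sequence `λ_1, …, λ_{2N}` into
the eigenvalues on its left and those on its right. -/
theorem exists_card_lam_lt (hN : 2 ≤ N) (x : ℝ) (hx : ∀ i < 2 * N, lam N b a (i + 1) ≠ x) :
    ∃ k ≤ 2 * N, (∀ i < k, lam N b a (i + 1) < x) ∧
      ∀ i, k ≤ i → i < 2 * N → x < lam N b a (i + 1) := by
  classical
  by_cases h : ∃ i, i < 2 * N ∧ x < lam N b a (i + 1)
  · refine ⟨Nat.find h, (Nat.find_spec h).1.le, fun i hi => ?_, fun i hi hi' => ?_⟩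
    · have h₁ := Nat.find_min h hi
      push Not at h₁
      have h₂ : i < 2 * N := hi.trans (Nat.find_spec h).1
      exact lt_of_le_of_ne (h₁ h₂) (hx i h₂)
    · exact (Nat.find_spec h).2.trans_le (lam_mono b a hN hi hi')
  · push Not at h
    exact ⟨2 * N, le_rfl, fun i hi => lt_of_le_of_ne (h i hi) (hx i hi), fun i hi hi' => by omega⟩

theorem sign_discr_sq_sub_four (hN : 2 ≤ N) (ha : ∀ k, 0 < a k) {x : ℝ} {k : ℕ} (hk : k ≤ 2 * N)
    (h₁ : ∀ i < k, lam N b a (i + 1) < x) (h₂ : ∀ i, k ≤ i → i < 2 * N → x < lam N b a (i + 1)) :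
    0 < (-1) ^ (2 * N - k) * ((discr N b a).eval x ^ 2 - 4) := by
  rw [discr_sq_sub_four_eq_prod b a hN ha, mul_left_comm]
  exact mul_pos (pow_pos (inv_pos.2 (pow_pos (casimir₂_pos N a ha) N)) 2) (sign_prod_sub hk h₁ h₂)

theorem odd_card_of_discr_lt (hN : 2 ≤ N) (ha : ∀ k, 0 < a k) {x : ℝ} {k : ℕ} (hk : k ≤ 2 * N)
    (h₁ : ∀ i < k, lam N b a (i + 1) < x) (h₂ : ∀ i, k ≤ i → i < 2 * N → x < lam N b a (i + 1))
    (hx : (discr N b a).eval x ^ 2 - 4 < 0) : k % 2 = 1 := by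
  have h := sign_discr_sq_sub_four b a hN ha hk h₁ h₂
  by_contra hk'
  have he : Even (2 * N - k) := Nat.even_iff.2 (by omega)
  rw [he.neg_one_pow] at h
  linarith

/-- Between the zeros `ρ_1 < ⋯ < ρ_N` of `Δ` there are exactly two periodic eigenvalues each. Their
number on either side of a zero is odd, as `Δ² - 4` is negative there, and two consecutive zeros
are separated by a Dirichlet eigenvalue, where `Δ² - 4 ≥ 0`. -/
theorem exists_zero_discr_lam (hN : 2 ≤ N) (ha : ∀ k, 0 < a k) : ∃ ρ : ℕ → ℝ, ∀ j < N,
    (discr N b a).eval (ρ j) = 0 ∧ (∀ n, n < j → mu N b a (n + 1) < ρ j) ∧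
      (∀ n, j ≤ n → n < N - 1 → ρ j < mu N b a (n + 1)) ∧
      lam N b a (2 * j + 1) < ρ j ∧ ρ j < lam N b a (2 * j + 2) := by
  have hex : ∀ j, ∃ ρ, j < N → (discr N b a).eval ρ = 0 ∧ (∀ n, n < j → mu N b a (n + 1) < ρ) ∧
      ∀ n, j ≤ n → n < N - 1 → ρ < mu N b a (n + 1) := fun j => by
    by_cases hj : j < N
    · obtain ⟨ρ, h⟩ := exists_zero_discr b a hN ha hj
      exact ⟨ρ, fun _ => h⟩
    · exact ⟨0, fun h => absurd h hj⟩
  choose ρ hρ using hex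
  have hP : ∀ j < N, (discr N b a).eval (ρ j) ^ 2 - 4 < 0 := fun j hj => by
    rw [(hρ j hj).1]; norm_num
  have hne : ∀ j < N, ∀ i < 2 * N, lam N b a (i + 1) ≠ ρ j := by
    intro j hj i hi h
    have := hP j hj
    rw [discr_sq_sub_four_eq_prod b a hN ha, ← h, Finset.prod_eq_zero (Finset.mem_range.2 hi)
      (sub_self _), mul_zero] at this
    exact lt_irrefl _ this
  have hex' : ∀ j, ∃ k, j < N → k ≤ 2 * N ∧ (∀ i < k, lam N b a (i + 1) < ρ j) ∧
      ∀ i, k ≤ i → i < 2 * N → ρ j < lam N b a (i + 1) := fun j => by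
    by_cases hj : j < N
    · obtain ⟨k, h⟩ := exists_card_lam_lt b a hN (ρ j) (hne j hj)
      exact ⟨k, fun _ => h⟩
    · exact ⟨0, fun h => absurd h hj⟩
  choose k hk using hex'
  have hodd : ∀ j < N, k j % 2 = 1 := fun j hj =>
    odd_card_of_discr_lt b a hN ha (hk j hj).1 (hk j hj).2.1 (hk j hj).2.2 (hP j hj)
  have hstep : ∀ j, j + 1 < N → k j + 2 ≤ k (j + 1) := by
    intro j hj
    have h₁ := hk j (by omega)
    have h₂ := hk (j + 1) hj
    have ho₁ := hodd j (by omega)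
    have ho₂ := hodd (j + 1) hj
    have hm₁ := (hρ j (by omega)).2.2 j le_rfl (by omega)
    have hm₂ := (hρ (j + 1) hj).2.1 j (Nat.lt_succ_self j)
    by_contra hlt
    have hle : k (j + 1) ≤ k j := by omega
    -- no eigenvalue separates `ρ j` and `ρ (j + 1)`, so `Δ² - 4 < 0` in between
    have h := sign_discr_sq_sub_four b a hN ha (x := mu N b a (j + 1)) h₁.1
      (fun i hi => (h₁.2.1 i hi).trans hm₁)
      (fun i hi hi' => hm₂.trans (h₂.2.2 i (hle.trans hi) hi'))
    have ho : Odd (2 * N - k j) := Nat.odd_iff.2 (by have := h₁.1; omega)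
    rw [ho.neg_one_pow] at h
    have hs := sign_discr_mu b a hN ha (n := j) (by omega)
    have h₄ : ((-1 : ℝ) ^ (N - 1 - j)) ^ 2 = 1 := by rw [← pow_mul, mul_comm, pow_mul]; norm_num
    nlinarith
  have hlow : ∀ j < N, 2 * j + 1 ≤ k j := by
    intro j
    induction j with
    | zero => intro h; have := hodd 0 h; omega
    | succ j ih => intro h; have := hstep j h; have := ih (by omega); omega
  have hup : ∀ i, i < N → k (N - 1 - i) + 2 * i + 1 ≤ 2 * N := by
    intro i
    induction i with
    | zero =>
      intro h
      have := hodd (N - 1) (by omega)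
      have := (hk (N - 1) (by omega)).1
      simp; omega
    | succ i ih =>
      intro h
      have h₁ := ih (by omega)
      have h₂ := hstep (N - 1 - (i + 1)) (by omega)
      rw [show N - 1 - (i + 1) + 1 = N - 1 - i by omega] at h₂
      omega
  refine ⟨ρ, fun j hj => ?_⟩
  have h₁ := hlow j hj
  have h₂ := hup (N - 1 - j) (by omega)
  rw [show N - 1 - (N - 1 - j) = j by omega] at h₂
  obtain ⟨h₃, h₄⟩ := (hk j hj).2
  exact ⟨(hρ j hj).1, (hρ j hj).2.1, (hρ j hj).2.2, h₃ (2 * j) (by omega),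
    h₄ (2 * j + 1) (by omega) (by omega)⟩

theorem lam_odd_lt_even (hN : 2 ≤ N) (ha : ∀ k, 0 < a k) {j : ℕ} (hj : j < N) :
    lam N b a (2 * j + 1) < lam N b a (2 * j + 2) := by
  obtain ⟨ρ, hρ⟩ := exists_zero_discr_lam b a hN ha
  exact (hρ j hj).2.2.2.1.trans (hρ j hj).2.2.2.2

/-- The `n`-th Dirichlet eigenvalue lies in the `n`-th gap: between two consecutive zeros of `Δ` the
gap is the only place where `Δ² - 4 ≥ 0`. -/
theorem mu_mem_gap (hN : 2 ≤ N) (ha : ∀ k, 0 < a k) {k : ℕ} (hk₁ : 1 ≤ k) (hk₂ : k ≤ N - 1) :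
    mu N b a k ∈ Set.Icc (lam N b a (2 * k)) (lam N b a (2 * k + 1)) := by
  obtain ⟨ρ, hρ⟩ := exists_zero_discr_lam b a hN ha
  obtain ⟨n, rfl⟩ : ∃ n, k = n + 1 := ⟨k - 1, by omega⟩
  obtain ⟨-, -, h₁, h₂, -⟩ := hρ n (by omega)
  obtain ⟨-, h₃, -, -, h₄⟩ := hρ (n + 1) (by omega)
  have h₁ := h₁ n le_rfl (by omega)
  have h₃ := h₃ n (Nat.lt_succ_self n)
  have hs := sign_discr_mu b a hN ha (n := n) (by omega)
  have hs2 : ((-1 : ℝ) ^ (N - 1 - n)) ^ 2 = 1 := by rw [← pow_mul, mul_comm, pow_mul]; norm_num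
  have hP : 0 ≤ (discr N b a).eval (mu N b a (n + 1)) ^ 2 - 4 := by nlinarith
  constructor
  · by_contra! h
    have ho := sign_discr_sq_sub_four b a hN ha (x := mu N b a (n + 1)) (k := 2 * n + 1) (by omega)
      (fun i hi => (lam_mono b a hN (show i ≤ 2 * n by omega) (by omega)).trans_lt (h₂.trans h₁))
      (fun i hi hi' => h.trans_le (lam_mono b a hN hi hi'))
    rw [(Nat.odd_iff.2 (by omega) : Odd (2 * N - (2 * n + 1))).neg_one_pow] at ho
    linarith
  · by_contra! h
    have ho := sign_discr_sq_sub_four b a hN ha (x := mu N b a (n + 1)) (k := 2 * n + 3) (by omega)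
      (fun i hi => (lam_mono b a hN (show i ≤ 2 * n + 2 by omega) (by omega)).trans_lt h)
      (fun i hi hi' => (h₃.trans h₄).trans_le (lam_mono b a hN hi hi'))
    rw [(Nat.odd_iff.2 (by omega) : Odd (2 * N - (2 * n + 3))).neg_one_pow] at ho
    linarith

theorem lam_le_lam (hN : 2 ≤ N) {i j : ℕ} (hi : 1 ≤ i) (hij : i ≤ j) (hj : j ≤ 2 * N) :
    lam N b a i ≤ lam N b a j := by
  obtain ⟨i, rfl⟩ : ∃ i', i = i' + 1 := ⟨i - 1, by omega⟩
  obtain ⟨j, rfl⟩ : ∃ j', j = j' + 1 := ⟨j - 1, by omega⟩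
  exact lam_mono b a hN (by omega) (by omega)

theorem lam_even_le_odd (hN : 2 ≤ N) {k : ℕ} (hk₁ : 1 ≤ k) (hk₂ : k ≤ N - 1) :
    lam N b a (2 * k) ≤ lam N b a (2 * k + 1) :=
  lam_le_lam b a hN (by omega) (by omega) (by omega)

theorem lam_gap_lt_gap (hN : 2 ≤ N) (ha : ∀ k, 0 < a k) {j k : ℕ} (hj : 1 ≤ j) (hjk : j < k)
    (hk : k ≤ N - 1) : lam N b a (2 * j + 1) < lam N b a (2 * k) :=
  (lam_odd_lt_even b a hN ha (show j < N by omega)).trans_le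
    (lam_le_lam b a hN (by omega) (by omega) (by omega))

theorem lam_one_lt_gap (hN : 2 ≤ N) (ha : ∀ k, 0 < a k) {k : ℕ} (hk₁ : 1 ≤ k) (hk₂ : k ≤ N - 1) :
    lam N b a 1 < lam N b a (2 * k) :=
  (lam_odd_lt_even b a hN ha (show 0 < N by omega)).trans_le
    (lam_le_lam b a hN (by omega) (by omega) (by omega))

theorem lam_gap_lt_last (hN : 2 ≤ N) (ha : ∀ k, 0 < a k) {k : ℕ} (hk₁ : 1 ≤ k) (hk₂ : k ≤ N - 1) :
    lam N b a (2 * k + 1) < lam N b a (2 * N) :=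
  (lam_odd_lt_even b a hN ha (show k < N by omega)).trans_le
    (lam_le_lam b a hN (by omega) (by omega) (by omega))

theorem prod_range_two_mul {M : Type*} [CommMonoid M] (f : ℕ → M) {n : ℕ} (hn : 1 ≤ n) :
    ∏ i ∈ Finset.range (2 * n), f (i + 1) =
      f 1 * f (2 * n) * ∏ k ∈ Finset.Icc 1 (n - 1), (f (2 * k) * f (2 * k + 1)) := by
  induction n, hn using Nat.le_induction with
  | base => simp [Finset.prod_range_succ]
  | succ n hn ih =>
    have h : Finset.Icc 1 (n + 1 - 1) = insert n (Finset.Icc 1 (n - 1)) := by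
      ext i; simp; omega
    rw [h, Finset.prod_insert (by simp; omega), show 2 * (n + 1) = 2 * n + 1 + 1 by ring,
      Finset.prod_range_succ, Finset.prod_range_succ, ih]
    simp only [mul_assoc, mul_left_comm, mul_comm]

/-- `Δ² - 4` as a product over the gaps. -/
theorem discr_sq_sub_four_eq (hN : 2 ≤ N) (ha : ∀ k, 0 < a k) (x : ℝ) :
    (discr N b a).eval x ^ 2 - 4 = (casimir₂ N a ^ N)⁻¹ ^ 2 *
      ((x - lam N b a 1) * (x - lam N b a (2 * N)) *
        ∏ k ∈ Finset.Icc 1 (N - 1), ((x - lam N b a (2 * k)) * (x - lam N b a (2 * k + 1)))) := by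
  rw [discr_sq_sub_four_eq_prod b a hN ha,
    prod_range_two_mul (fun i => x - lam N b a i) (by omega)]

/-- On the bands `|Δ| ≤ 2`. -/
theorem discr_sq_sub_four_neg (hN : 2 ≤ N) (ha : ∀ k, 0 < a k) {j : ℕ} (hj : j < N) {x : ℝ}
    (h₁ : lam N b a (2 * j + 1) < x) (h₂ : x < lam N b a (2 * j + 2)) :
    (discr N b a).eval x ^ 2 - 4 < 0 := by
  have ho := sign_discr_sq_sub_four b a hN ha (x := x) (k := 2 * j + 1) (by omega)
    (fun i hi => (lam_mono b a hN (show i ≤ 2 * j by omega) (by omega)).trans_lt h₁)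
    (fun i hi hi' => h₂.trans_le (lam_mono b a hN hi hi'))
  rw [(Nat.odd_iff.2 (by omega) : Odd (2 * N - (2 * j + 1))).neg_one_pow] at ho
  linarith

theorem discr_sq_sub_four_nonneg (hN : 2 ≤ N) (ha : ∀ k, 0 < a k) {k : ℕ} (hk₁ : 1 ≤ k)
    (hk₂ : k ≤ N - 1) {x : ℝ} (hx : x ∈ Set.Icc (lam N b a (2 * k)) (lam N b a (2 * k + 1))) :
    0 ≤ (discr N b a).eval x ^ 2 - 4 := by
  have hz : ∀ i < 2 * N, x = lam N b a (i + 1) → (discr N b a).eval x ^ 2 - 4 = 0 := by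
    intro i hi h
    rw [discr_sq_sub_four_eq_prod b a hN ha, Finset.prod_eq_zero (Finset.mem_range.2 hi)
      (sub_eq_zero.2 h), mul_zero]
  rcases hx.1.eq_or_lt with h | h₁
  · exact (hz (2 * k - 1) (by omega) (by rw [← h, Nat.sub_add_cancel (by omega)])).ge
  rcases hx.2.eq_or_lt with h | h₂
  · exact (hz (2 * k) (by omega) h).ge
  have ho := sign_discr_sq_sub_four b a hN ha (x := x) (k := 2 * k) (by omega)
    (fun i hi => (lam_le_lam b a hN (by omega) (show i + 1 ≤ 2 * k by omega) (by omega)).trans_lt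
      h₁)
    (fun i hi hi' => h₂.trans_le (lam_mono b a hN hi hi'))
  rw [(Nat.even_iff.2 (by omega) : Even (2 * N - 2 * k)).neg_one_pow] at ho
  linarith

/-- On the `k`-th gap the sign of `Δ` is `(-1) ^ (N - k)`: it is so at `μ_k`, and `Δ` has no zero in
the gap. -/
theorem two_le_sign_mul_discr (hN : 2 ≤ N) (ha : ∀ k, 0 < a k) {k : ℕ} (hk₁ : 1 ≤ k)
    (hk₂ : k ≤ N - 1) {x : ℝ} (hx : x ∈ Set.Icc (lam N b a (2 * k)) (lam N b a (2 * k + 1))) :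
    2 ≤ (-1) ^ (N - k) * (discr N b a).eval x := by
  have hm := mu_mem_gap b a hN ha hk₁ hk₂
  have hs := sign_discr_mu b a hN ha (n := k - 1) (by omega)
  rw [Nat.sub_add_cancel hk₁, show N - 1 - (k - 1) = N - k by omega] at hs
  have h2 : ((-1 : ℝ) ^ (N - k)) ^ 2 = 1 := by rw [← pow_mul, mul_comm, pow_mul]; norm_num
  have hx2 := discr_sq_sub_four_nonneg b a hN ha hk₁ hk₂ hx
  have hpos : 0 < (-1) ^ (N - k) * (discr N b a).eval x := by
    by_contra! h
    have hc : ContinuousOn (fun t => (-1) ^ (N - k) * (discr N b a).eval t)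
      (Set.Icc (lam N b a (2 * k)) (lam N b a (2 * k + 1))) :=
      (continuous_const.mul (discr N b a).continuous).continuousOn
    obtain ⟨z, hz, h0⟩ := isPreconnected_Icc.intermediate_value hx hm hc
      (show (0 : ℝ) ∈ Set.Icc _ _ from ⟨h, by linarith⟩)
    have hz2 := discr_sq_sub_four_nonneg b a hN ha hk₁ hk₂ hz
    have hs0 : ((-1 : ℝ) ^ (N - k)) ≠ 0 := pow_ne_zero _ (by norm_num)
    rw [(mul_eq_zero.1 h0).resolve_left hs0] at hz2
    norm_num at hz2
  have : 4 ≤ ((-1) ^ (N - k) * (discr N b a).eval x) ^ 2 := by rw [mul_pow, h2]; linarith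
  nlinarith

end Spectrum

/-! ### Continuity of sorted real roots -/

section ContinuityOfRoots

open Filter Topology

theorem eq_of_monotone_of_prod_eq {n : ℕ} {v w : Fin n → ℝ} (hv : Monotone v) (hw : Monotone w)
    (h : ∀ z : ℂ, ∏ i, (z - v i) = ∏ i, (z - w i)) : v = w := by
  have hp : ∏ i, (X - C (v i)) = ∏ i, (X - C (w i)) := by
    refine Polynomial.funext fun t => ?_
    have := h t
    rw [eval_prod, eval_prod]
    simp only [eval_sub, eval_X, eval_C]
    exact_mod_cast this
  have hm : ∀ u : Fin n → ℝ, (∏ i, (X - C (u i))).roots = (List.ofFn u : Multiset ℝ) := by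
    intro u
    rw [← roots_multiset_prod_X_sub_C (List.ofFn u : Multiset ℝ), Multiset.map_coe,
      Multiset.prod_coe, List.map_ofFn, List.prod_ofFn]
    rfl
  have hl : (List.ofFn v : Multiset ℝ) = (List.ofFn w : Multiset ℝ) := by rw [← hm, ← hm, hp]
  exact List.ofFn_injective (List.Perm.eq_of_pairwise (le := (· ≤ ·))
    (fun a b _ _ => le_antisymm)
    (List.pairwise_ofFn.2 fun i j hij => hv hij.le) (List.pairwise_ofFn.2 fun i j hij => hw hij.le)
    (Multiset.coe_eq_coe.1 hl))

/-- At the point `i` every factor has absolute value at least `1`, so that the value there bounds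
each root. -/
theorem abs_le_norm_prod_I_sub {n : ℕ} (v : Fin n → ℝ) (j : Fin n) :
    |v j| ≤ ‖∏ i, (Complex.I - v i)‖ := by
  have h₁ : ∀ i, 1 ≤ ‖Complex.I - v i‖ := fun i => by
    have := Complex.abs_im_le_norm (Complex.I - v i)
    simpa using this
  have h₂ : |v j| ≤ ‖Complex.I - v j‖ := by
    have := Complex.abs_re_le_norm (Complex.I - v j)
    simpa using this
  rw [norm_prod, ← Finset.mul_prod_erase _ _ (Finset.mem_univ j)]
  have h₃ : 1 ≤ ∏ i ∈ Finset.univ.erase j, ‖Complex.I - v i‖ :=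
    Finset.prod_induction _ (fun x : ℝ => 1 ≤ x)
      (fun x y hx hy => one_le_mul_of_one_le_of_one_le hx hy)
      le_rfl fun i _ => h₁ i
  nlinarith [h₁ j]

/-- The sorted vector of roots of a monic real-rooted polynomial depends continuously on a parameter
if the values of the polynomial do: the roots stay bounded, and by uniqueness of the sorted
factorization the only limit point of the root vectors is the right one. -/
theorem continuous_of_continuous_prod {T : Type*} [TopologicalSpace T] {n : ℕ} {v : T → Fin n → ℝ}
    (hv : ∀ x, Monotone (v x)) (hc : ∀ z : ℂ, Continuous fun x => ∏ i, (z - v x i)) :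
    Continuous v := by
  rw [continuous_iff_ultrafilter]
  intro x g hg
  set R := ‖∏ i, (Complex.I - v x i)‖ + 1 with hR
  have hb : ∀ᶠ y in (g : Filter T), v y ∈ Set.univ.pi fun _ : Fin n => Set.Icc (-R) R := by
    have h₁ : ∀ᶠ y in 𝓝 x, ‖∏ i, (Complex.I - v y i)‖ < R :=
      (hc Complex.I).norm.continuousAt.eventually_lt continuousAt_const (by simp [hR])
    filter_upwards [hg h₁] with y hy i _
    exact abs_le.1 ((abs_le_norm_prod_I_sub (v y) i).trans hy.le)
  obtain ⟨w, -, hw⟩ := (isCompact_univ_pi fun _ : Fin n => isCompact_Icc (a := -R) (b := R)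
    ).ultrafilter_le_nhds (g.map v) (le_principal_iff.2 hb)
  have hw' : Tendsto v g (𝓝 w) := hw
  have hwi : ∀ i, Tendsto (fun y => v y i) g (𝓝 (w i)) := tendsto_pi_nhds.1 hw'
  have hwm : Monotone w := fun i j hij =>
    le_of_tendsto_of_tendsto (hwi i) (hwi j) (Eventually.of_forall fun y => hv y hij)
  have hprod : ∀ z : ℂ, ∏ i, (z - w i) = ∏ i, (z - v x i) := by
    intro z
    refine tendsto_nhds_unique (f := fun y => ∏ i, (z - (v y i : ℂ))) (l := (g : Filter T)) ?_
      ((hc z).continuousAt.mono_left hg)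
    exact tendsto_finsetProd _ fun i _ => tendsto_const_nhds.sub
      ((Complex.continuous_ofReal.tendsto _).comp (hwi i))
  rw [← eq_of_monotone_of_prod_eq hwm (hv x) hprod]
  exact hw'

end ContinuityOfRoots

/-! ### Continuity of the spectral data on the phase space -/

section Continuity

variable {N : ℕ}

/-- The positive sequence `a` of a point `(b, a)` of the phase space, as a real sequence. -/
abbrev aSeq (p : PhaseSpace N) : ZMod N → ℝ := fun k => p.2 k

theorem aSeq_pos (p : PhaseSpace N) (k : ZMod N) : 0 < aSeq p k := (p.2 k).2

theorem continuous_aSeq (k : ZMod N) : Continuous fun p : PhaseSpace N => aSeq p k :=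
  continuous_subtype_val.comp ((continuous_apply k).comp continuous_snd)

theorem continuous_aeval_solution (A : Type*) [NormedField A] [NormedAlgebra ℝ A] (c₀ c₁ : ℝ)
    (k : ℕ) : (Continuous fun q : PhaseSpace N × A =>
      aeval q.2 (solution N q.1.1 (aSeq q.1) c₀ c₁ k)) ∧
    Continuous fun q : PhaseSpace N × A =>
      aeval q.2 (solution N q.1.1 (aSeq q.1) c₀ c₁ (k + 1)) := by
  induction k with
  | zero => simp only [solution, aeval_C]; exact ⟨continuous_const, continuous_const⟩
  | succ k ih =>
    refine ⟨ih.2, ?_⟩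
    have hb : Continuous fun q : PhaseSpace N × A => algebraMap ℝ A (q.1.1 (k + 1 : ℕ)) :=
      (continuous_algebraMap ℝ A).comp ((continuous_apply _).comp (continuous_fst.comp
        continuous_fst))
    have ha : ∀ j, Continuous fun q : PhaseSpace N × A => aSeq q.1 j :=
      fun j => (continuous_aSeq j).comp continuous_fst
    simp only [solution, map_mul, map_sub, aeval_C, aeval_X]
    exact ((continuous_algebraMap ℝ A).comp ((ha _).inv₀ fun q => (aSeq_pos q.1 _).ne')).mul
      (((continuous_snd.sub hb).mul ih.2).sub (((continuous_algebraMap ℝ A).comp (ha _)).mul ih.1))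

theorem continuous_eval_derivative_solution (c₀ c₁ : ℝ) (k : ℕ) :
    (Continuous fun q : PhaseSpace N × ℝ =>
      (derivative (solution N q.1.1 (aSeq q.1) c₀ c₁ k)).eval q.2) ∧
    Continuous fun q : PhaseSpace N × ℝ =>
      (derivative (solution N q.1.1 (aSeq q.1) c₀ c₁ (k + 1))).eval q.2 := by
  induction k with
  | zero =>
    simp only [solution, derivative_C, eval_zero]
    exact ⟨continuous_const, continuous_const⟩
  | succ k ih =>
    refine ⟨ih.2, ?_⟩
    have hb : Continuous fun q : PhaseSpace N × ℝ => q.1.1 (k + 1 : ℕ) :=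
      (continuous_apply _).comp (continuous_fst.comp continuous_fst)
    have ha : ∀ j, Continuous fun q : PhaseSpace N × ℝ => aSeq q.1 j :=
      fun j => (continuous_aSeq j).comp continuous_fst
    have hs := (continuous_aeval_solution (N := N) ℝ c₀ c₁ k).2
    simp only [coe_aeval_eq_eval] at hs
    simp only [solution, derivative_mul, derivative_sub, derivative_C, derivative_X, eval_mul,
      eval_sub, eval_add, eval_C, eval_X, zero_mul, zero_add, sub_zero, one_mul]
    exact ((ha _).inv₀ fun q => (aSeq_pos q.1 _).ne').mul
      ((hs.add ((continuous_snd.sub hb).mul ih.2)).sub ((ha _).mul ih.1))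

theorem continuous_aeval_discr (A : Type*) [NormedField A] [NormedAlgebra ℝ A] :
    Continuous fun q : PhaseSpace N × A => aeval q.2 (discr N q.1.1 (aSeq q.1)) := by
  simp only [discr, map_add, y₁, y₂]
  exact (continuous_aeval_solution A 1 0 N).1.add (continuous_aeval_solution A 0 1 N).2

theorem continuous_eval_derivative_discr :
    Continuous fun q : PhaseSpace N × ℝ => (derivative (discr N q.1.1 (aSeq q.1))).eval q.2 := by
  simp only [discr, derivative_add, eval_add, y₁, y₂]
  exact (continuous_eval_derivative_solution 1 0 N).1.add
    (continuous_eval_derivative_solution 0 1 N).2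

theorem continuous_casimir₁ : Continuous fun p : PhaseSpace N => casimir₁ N p.1 := by
  unfold casimir₁
  exact continuous_const.mul (continuous_finsetSum _ fun i _ =>
    (continuous_apply _).comp continuous_fst)

theorem continuous_casimir₂ : Continuous fun p : PhaseSpace N => casimir₂ N (aSeq p) := by
  unfold casimir₂
  exact (continuous_finsetProd _ fun i _ => continuous_aSeq _).rpow_const
    fun p => Or.inl (Finset.prod_pos fun i _ => aSeq_pos p _).ne'

theorem continuous_lam (hN : 2 ≤ N) {j : ℕ} (hj₁ : 1 ≤ j) (hj₂ : j ≤ 2 * N) :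
    Continuous fun p : PhaseSpace N => lam N p.1 (aSeq p) j := by
  have h : Continuous fun (p : PhaseSpace N) (i : Fin (2 * N)) =>
      lam N p.1 (aSeq p) (i.val + 1) := by
    refine continuous_of_continuous_prod (fun p i j hij => lam_mono _ _ hN hij j.2) fun z => ?_
    have he : ∀ p : PhaseSpace N, ∏ i : Fin (2 * N), (z - (lam N p.1 (aSeq p) (i.val + 1) : ℂ)) =
        ((casimir₂ N (aSeq p) ^ N) ^ 2 : ℝ) * (aeval z (discr N p.1 (aSeq p)) ^ 2 - 4) := by
      intro p
      have hc := (pow_pos (casimir₂_pos N _ (aSeq_pos p)) N).ne'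
      have h := congrArg (aeval z) (charpoly_jacobiQ p.1 (aSeq p) hN (aSeq_pos p))
      rw [charpoly_eq_prod p.1 (aSeq p) hN, map_mul, aeval_C, map_prod, map_sub, map_pow] at h
      simp only [map_sub, aeval_X, aeval_C, Complex.coe_algebraMap] at h
      rw [show aeval z (4 : ℝ[X]) = 4 from map_ofNat _ 4] at h
      rw [h, ← mul_assoc, ← Complex.ofReal_mul, ← mul_pow, mul_inv_cancel₀ hc, one_pow,
        Complex.ofReal_one, one_mul,
        ← Fin.prod_univ_eq_prod_range (fun i => z - (lam N p.1 (aSeq p) (i + 1) : ℂ))]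
    simp only [he]
    exact (Complex.continuous_ofReal.comp ((continuous_casimir₂.pow N).pow 2)).mul
      ((((continuous_aeval_discr ℂ).comp (Continuous.prodMk_left z)).pow 2).sub continuous_const)
  have := (continuous_apply (⟨j - 1, by omega⟩ : Fin (2 * N))).comp h
  simpa [Function.comp_def, Nat.sub_add_cancel hj₁] using this

theorem continuous_mu (hN : 2 ≤ N) {n : ℕ} (hn₁ : 1 ≤ n) (hn₂ : n ≤ N - 1) :
    Continuous fun p : PhaseSpace N => mu N p.1 (aSeq p) n := by
  have h : Continuous fun (p : PhaseSpace N) (i : Fin (N - 1)) =>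
      mu N p.1 (aSeq p) (i.val + 1) := by
    refine continuous_of_continuous_prod (fun p i j hij => ?_) fun z => ?_
    · rcases hij.eq_or_lt with rfl | h
      · exact le_rfl
      · exact (mu_strictMono _ _ hN (aSeq_pos p) h j.2).le
    have he : ∀ p : PhaseSpace N, ∏ i : Fin (N - 1), (z - (mu N p.1 (aSeq p) (i.val + 1) : ℂ)) =
        ((-aSeq p 0 * (casimir₂ N (aSeq p) ^ N)⁻¹ : ℝ) : ℂ)⁻¹ *
          aeval z (y₁ N p.1 (aSeq p) (N + 1)) := by
      intro p
      have hlc : (y₁ N p.1 (aSeq p) (N + 1)).coeff (N - 1) =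
          -aSeq p 0 * (casimir₂ N (aSeq p) ^ N)⁻¹ := by
        have h := (y₁_natDegree_coeff p.1 (aSeq p) (N - 1)).2.2
        rwa [show N - 1 + 2 = N + 1 by omega, show N - 1 + 1 = N by omega,
          prod_inv_eq _ hN (aSeq_pos p)] at h
      have hne := (y₁_coeff_neg p.1 (aSeq p) hN (aSeq_pos p)).ne
      have h := congrArg (aeval z) (y₁_eq_prod p.1 (aSeq p) hN (aSeq_pos p))
      rw [map_mul, aeval_C, map_prod] at h
      simp only [map_sub, aeval_X, aeval_C, Complex.coe_algebraMap] at h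
      rw [h, ← hlc, inv_mul_cancel_left₀ (Complex.ofReal_ne_zero.2 hne),
        ← Fin.prod_univ_eq_prod_range (fun i => z - (mu N p.1 (aSeq p) (i + 1) : ℂ))]
    simp only [he]
    have hne : ∀ p : PhaseSpace N, (-aSeq p 0 * (casimir₂ N (aSeq p) ^ N)⁻¹ : ℝ) ≠ 0 := fun p =>
      mul_ne_zero (neg_ne_zero.2 (aSeq_pos p 0).ne')
        (inv_ne_zero (pow_pos (casimir₂_pos N _ (aSeq_pos p)) N).ne')
    refine Continuous.mul (Continuous.inv₀ (Complex.continuous_ofReal.comp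
      ((continuous_aSeq 0).neg.mul ((continuous_casimir₂.pow N).inv₀ fun p => ?_)))
      fun p => Complex.ofReal_ne_zero.2 (hne p)) ?_
    · exact (pow_pos (casimir₂_pos N _ (aSeq_pos p)) N).ne'
    · exact (continuous_aeval_solution ℂ 1 0 N).2.comp (Continuous.prodMk_left z)
  have := (continuous_apply (⟨n - 1, by omega⟩ : Fin (N - 1))).comp h
  simpa [Function.comp_def, Nat.sub_add_cancel hn₁] using this

end Continuity

/-! ### The differential `dλ / √(Δ² - 4)` on the gaps -/

section Weights

variable {N : ℕ} (b a : ZMod N → ℝ)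

/-- The restriction of `gapRoot` to the real axis outside the gap. -/
def realGapRoot (N : ℕ) (b a : ZMod N → ℝ) (n : ℕ) (x : ℝ) : ℝ :=
  (x - mid N b a n) * √(1 - (gap N b a n / 2 / (x - mid N b a n)) ^ 2)

/-- The density of `dλ / √(Δ² - 4)` on the `k`-th gap with respect to the parameter `t` of
`gapPoint`, with the sign that belongs to the canonical root. It has no singularity at the ends of
the gap, also if the gap is collapsed. -/
def gapWeight (N : ℕ) (b a : ZMod N → ℝ) (k : ℕ) (x : ℝ) : ℝ :=
  casimir₂ N a ^ N / (√((x - lam N b a 1) * (lam N b a (2 * N) - x)) *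
    ∏ j ∈ (Finset.Icc 1 (N - 1)).erase k, realGapRoot N b a j x)

/-- The parametrization of the `k`-th gap by `t ∈ [0, π]`, from left to right. -/
def gapPoint (N : ℕ) (b a : ZMod N → ℝ) (k : ℕ) (t : ℝ) : ℝ :=
  mid N b a k - gap N b a k / 2 * Real.cos t

theorem gap_nonneg (hN : 2 ≤ N) {k : ℕ} (hk₁ : 1 ≤ k) (hk₂ : k ≤ N - 1) : 0 ≤ gap N b a k :=
  sub_nonneg.2 (lam_even_le_odd b a hN hk₁ hk₂)

theorem mid_sub_gap (k : ℕ) : mid N b a k - gap N b a k / 2 = lam N b a (2 * k) := by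
  rw [mid, gap]; ring

theorem mid_add_gap (k : ℕ) : mid N b a k + gap N b a k / 2 = lam N b a (2 * k + 1) := by
  rw [mid, gap]; ring

theorem gapPoint_mem (hN : 2 ≤ N) {k : ℕ} (hk₁ : 1 ≤ k) (hk₂ : k ≤ N - 1) (t : ℝ) :
    gapPoint N b a k t ∈ Set.Icc (lam N b a (2 * k)) (lam N b a (2 * k + 1)) := by
  rw [← mid_sub_gap, ← mid_add_gap, gapPoint]
  have h := gap_nonneg b a hN hk₁ hk₂
  constructor <;> nlinarith [Real.cos_le_one t, Real.neg_one_le_cos t]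

theorem realGapRoot_sq (hN : 2 ≤ N) {j : ℕ} (hj₁ : 1 ≤ j) (hj₂ : j ≤ N - 1) {x : ℝ}
    (hx : x < lam N b a (2 * j) ∨ lam N b a (2 * j + 1) < x) :
    realGapRoot N b a j x ^ 2 = (x - lam N b a (2 * j)) * (x - lam N b a (2 * j + 1)) ∧
      0 < 1 - (gap N b a j / 2 / (x - mid N b a j)) ^ 2 ∧ x - mid N b a j ≠ 0 := by
  rw [← mid_sub_gap, ← mid_add_gap] at *
  have h := gap_nonneg b a hN hj₁ hj₂
  have h₁ : (gap N b a j / 2) ^ 2 < (x - mid N b a j) ^ 2 := by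
    rcases hx with hx | hx
    · nlinarith
    · nlinarith
  have h₀ : x - mid N b a j ≠ 0 := by
    intro h₀
    rw [h₀] at h₁
    nlinarith [sq_nonneg (gap N b a j / 2)]
  have h₂ : 0 < (x - mid N b a j) ^ 2 := by positivity
  have h₃ : 0 < 1 - (gap N b a j / 2 / (x - mid N b a j)) ^ 2 := by
    rw [div_pow, sub_pos, div_lt_one h₂]; exact h₁
  refine ⟨?_, h₃, h₀⟩
  rw [realGapRoot, mul_pow, Real.sq_sqrt h₃.le]
  field_simp
  ring

theorem realGapRoot_pos (hN : 2 ≤ N) {j : ℕ} (hj₁ : 1 ≤ j) (hj₂ : j ≤ N - 1) {x : ℝ}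
    (hx : lam N b a (2 * j + 1) < x) : 0 < realGapRoot N b a j x := by
  obtain ⟨-, h, -⟩ := realGapRoot_sq b a hN hj₁ hj₂ (Or.inr hx)
  rw [← mid_add_gap] at hx
  have := gap_nonneg b a hN hj₁ hj₂
  exact mul_pos (by linarith) (Real.sqrt_pos.2 h)

theorem realGapRoot_neg (hN : 2 ≤ N) {j : ℕ} (hj₁ : 1 ≤ j) (hj₂ : j ≤ N - 1) {x : ℝ}
    (hx : x < lam N b a (2 * j)) : realGapRoot N b a j x < 0 := by
  obtain ⟨-, h, -⟩ := realGapRoot_sq b a hN hj₁ hj₂ (Or.inl hx)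
  rw [← mid_sub_gap] at hx
  have := gap_nonneg b a hN hj₁ hj₂
  exact mul_neg_of_neg_of_pos (by linarith) (Real.sqrt_pos.2 h)

theorem notMem_gap_of_mem_gap (hN : 2 ≤ N) (ha : ∀ k, 0 < a k) {j k : ℕ} (hj₁ : 1 ≤ j)
    (hj₂ : j ≤ N - 1) (hk₁ : 1 ≤ k) (hk₂ : k ≤ N - 1) (hjk : j ≠ k) {x : ℝ}
    (hx : x ∈ Set.Icc (lam N b a (2 * k)) (lam N b a (2 * k + 1))) :
    x < lam N b a (2 * j) ∨ lam N b a (2 * j + 1) < x := by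
  rcases hjk.lt_or_gt with h | h
  · exact Or.inr ((lam_gap_lt_gap b a hN ha hj₁ h hk₂).trans_le hx.1)
  · exact Or.inl (hx.2.trans_lt (lam_gap_lt_gap b a hN ha hk₁ h hj₂))

/-- The factors of the gaps to the right of the `k`-th are negative on it. -/
theorem sign_prod_realGapRoot (hN : 2 ≤ N) (ha : ∀ k, 0 < a k) {k : ℕ} (hk₁ : 1 ≤ k)
    (hk₂ : k ≤ N - 1) {x : ℝ} (hx : x ∈ Set.Icc (lam N b a (2 * k)) (lam N b a (2 * k + 1))) :
    0 < (-1) ^ (N - 1 - k) * ∏ j ∈ (Finset.Icc 1 (N - 1)).erase k, realGapRoot N b a j x := by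
  have hu : (Finset.Icc 1 (N - 1)).erase k = Finset.Ico 1 k ∪ Finset.Ioc k (N - 1) := by
    ext j; simp; omega
  have hd : Disjoint (Finset.Ico 1 k) (Finset.Ioc k (N - 1)) := by
    rw [Finset.disjoint_left]; intro j; simp; omega
  have hs : ∏ j ∈ Finset.Ioc k (N - 1), -realGapRoot N b a j x =
      (-1) ^ (N - 1 - k) * ∏ j ∈ Finset.Ioc k (N - 1), realGapRoot N b a j x := by
    rw [← Nat.card_Ioc k (N - 1), ← Finset.prod_const, ← Finset.prod_mul_distrib]
    exact Finset.prod_congr rfl fun i _ => by ring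
  rw [hu, Finset.prod_union hd, mul_left_comm, ← hs]
  refine mul_pos (Finset.prod_pos fun j hj => ?_) (Finset.prod_pos fun j hj => ?_)
  · obtain ⟨h₁, h₂⟩ := Finset.mem_Ico.1 hj
    exact realGapRoot_pos b a hN h₁ (by omega)
      ((lam_gap_lt_gap b a hN ha h₁ h₂ hk₂).trans_le hx.1)
  · obtain ⟨h₁, h₂⟩ := Finset.mem_Ioc.1 hj
    exact neg_pos.2 (realGapRoot_neg b a hN (by omega) h₂
      (hx.2.trans_lt (lam_gap_lt_gap b a hN ha hk₁ h₁ h₂)))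

theorem outer_factor_pos (hN : 2 ≤ N) (ha : ∀ k, 0 < a k) {k : ℕ} (hk₁ : 1 ≤ k)
    (hk₂ : k ≤ N - 1) {x : ℝ} (hx : x ∈ Set.Icc (lam N b a (2 * k)) (lam N b a (2 * k + 1))) :
    0 < (x - lam N b a 1) * (lam N b a (2 * N) - x) :=
  mul_pos (sub_pos.2 ((lam_one_lt_gap b a hN ha hk₁ hk₂).trans_le hx.1))
    (sub_pos.2 (hx.2.trans_lt (lam_gap_lt_last b a hN ha hk₁ hk₂)))

theorem sign_gapWeight (hN : 2 ≤ N) (ha : ∀ k, 0 < a k) {k : ℕ} (hk₁ : 1 ≤ k)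
    (hk₂ : k ≤ N - 1) {x : ℝ} (hx : x ∈ Set.Icc (lam N b a (2 * k)) (lam N b a (2 * k + 1))) :
    0 < (-1) ^ (N - 1 - k) * gapWeight N b a k x := by
  have h₁ := sign_prod_realGapRoot b a hN ha hk₁ hk₂ hx
  have h₂ := Real.sqrt_pos.2 (outer_factor_pos b a hN ha hk₁ hk₂ hx)
  have h₃ := pow_pos (casimir₂_pos N a ha) N
  have h₄ : ((-1 : ℝ) ^ (N - 1 - k)) * (-1) ^ (N - 1 - k) = 1 := by rw [← mul_pow]; norm_num
  rw [gapWeight]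
  set s : ℝ := (-1) ^ (N - 1 - k)
  set p := ∏ j ∈ (Finset.Icc 1 (N - 1)).erase k, realGapRoot N b a j x
  set q := √((x - lam N b a 1) * (lam N b a (2 * N) - x))
  have hp : p ≠ 0 := right_ne_zero_of_mul h₁.ne'
  have hs : s ≠ 0 := left_ne_zero_of_mul h₁.ne'
  have h : s * (casimir₂ N a ^ N / (q * p)) = casimir₂ N a ^ N / (q * (s * p)) := by
    field_simp
    linear_combination h₄
  rw [h]
  positivity

/-- The weight of the `k`-th gap is up to its sign the quotient of `√((x - λ_{2k}) (λ_{2k+1} - x))`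
and `√(Δ² - 4)`. -/
theorem gapWeight_sq_mul (hN : 2 ≤ N) (ha : ∀ k, 0 < a k) {k : ℕ} (hk₁ : 1 ≤ k)
    (hk₂ : k ≤ N - 1) {x : ℝ} (hx : x ∈ Set.Icc (lam N b a (2 * k)) (lam N b a (2 * k + 1))) :
    gapWeight N b a k x ^ 2 * ((discr N b a).eval x ^ 2 - 4) =
      (x - lam N b a (2 * k)) * (lam N b a (2 * k + 1) - x) := by
  have h₁ := sign_prod_realGapRoot b a hN ha hk₁ hk₂ hx
  have h₂ := outer_factor_pos b a hN ha hk₁ hk₂ hx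
  have h₃ := pow_pos (casimir₂_pos N a ha) N
  have h₄ : (∏ j ∈ (Finset.Icc 1 (N - 1)).erase k, realGapRoot N b a j x) ^ 2 =
      ∏ j ∈ (Finset.Icc 1 (N - 1)).erase k,
        ((x - lam N b a (2 * j)) * (x - lam N b a (2 * j + 1))) := by
    rw [← Finset.prod_pow]
    refine Finset.prod_congr rfl fun j hj => ?_
    obtain ⟨hjk, hj⟩ := Finset.mem_erase.1 hj
    obtain ⟨hj₁, hj₂⟩ := Finset.mem_Icc.1 hj
    exact (realGapRoot_sq b a hN hj₁ hj₂
      (notMem_gap_of_mem_gap b a hN ha hj₁ hj₂ hk₁ hk₂ hjk hx)).1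
  rw [discr_sq_sub_four_eq b a hN ha, ← Finset.mul_prod_erase _ _ (Finset.mem_Icc.2 ⟨hk₁, hk₂⟩),
    ← h₄, gapWeight, div_pow, mul_pow, Real.sq_sqrt h₂.le]
  have hp := right_ne_zero_of_mul h₁.ne'
  set p := ∏ j ∈ (Finset.Icc 1 (N - 1)).erase k, realGapRoot N b a j x
  have hu := (left_ne_zero_of_mul h₂.ne')
  have hw := (right_ne_zero_of_mul h₂.ne')
  field_simp
  ring

theorem gapWeight_sq_mul_gapPoint (hN : 2 ≤ N) (ha : ∀ k, 0 < a k) {k : ℕ} (hk₁ : 1 ≤ k)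
    (hk₂ : k ≤ N - 1) (t : ℝ) :
    gapWeight N b a k (gapPoint N b a k t) ^ 2 * ((discr N b a).eval (gapPoint N b a k t) ^ 2 - 4) =
      (gap N b a k / 2 * Real.sin t) ^ 2 := by
  rw [gapWeight_sq_mul b a hN ha hk₁ hk₂ (gapPoint_mem b a hN hk₁ hk₂ t), ← mid_sub_gap,
    ← mid_add_gap, gapPoint, mul_pow, Real.sin_sq]
  ring

/-- On the `k`-th gap `dλ = |W| √(Δ² - 4) dt` with the weight `W`. -/
theorem abs_gapWeight_mul_sqrt (hN : 2 ≤ N) (ha : ∀ k, 0 < a k) {k : ℕ} (hk₁ : 1 ≤ k)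
    (hk₂ : k ≤ N - 1) {t : ℝ} (ht : 0 ≤ Real.sin t) :
    |gapWeight N b a k (gapPoint N b a k t)| * √((discr N b a).eval (gapPoint N b a k t) ^ 2 - 4) =
      gap N b a k / 2 * Real.sin t := by
  have h := gapWeight_sq_mul_gapPoint b a hN ha hk₁ hk₂ t
  rw [← Real.sqrt_sq_eq_abs, ← Real.sqrt_mul (sq_nonneg _), h, Real.sqrt_sq]
  have := gap_nonneg b a hN hk₁ hk₂
  positivity

end Weights

section WeightContinuity

variable {N : ℕ}

theorem continuous_gap (hN : 2 ≤ N) {k : ℕ} (hk₁ : 1 ≤ k) (hk₂ : k ≤ N - 1) :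
    Continuous fun p : PhaseSpace N => gap N p.1 (aSeq p) k :=
  (continuous_lam hN (by omega) (by omega)).sub (continuous_lam hN (by omega) (by omega))

theorem continuous_mid (hN : 2 ≤ N) {k : ℕ} (hk₁ : 1 ≤ k) (hk₂ : k ≤ N - 1) :
    Continuous fun p : PhaseSpace N => mid N p.1 (aSeq p) k :=
  ((continuous_lam hN (by omega) (by omega)).add
    (continuous_lam hN (by omega) (by omega))).div_const 2

theorem continuous_gapPoint (hN : 2 ≤ N) {k : ℕ} (hk₁ : 1 ≤ k) (hk₂ : k ≤ N - 1) :
    Continuous fun q : PhaseSpace N × ℝ => gapPoint N q.1.1 (aSeq q.1) k q.2 :=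
  ((continuous_mid hN hk₁ hk₂).comp continuous_fst).sub
    ((((continuous_gap hN hk₁ hk₂).comp continuous_fst).div_const 2).mul
      (Real.continuous_cos.comp continuous_snd))

theorem continuous_gapWeight (hN : 2 ≤ N) {k : ℕ} (hk₁ : 1 ≤ k) (hk₂ : k ≤ N - 1) :
    Continuous fun q : PhaseSpace N × ℝ =>
      gapWeight N q.1.1 (aSeq q.1) k (gapPoint N q.1.1 (aSeq q.1) k q.2) := by
  have hx := continuous_gapPoint hN hk₁ hk₂
  have hmem := fun q : PhaseSpace N × ℝ => gapPoint_mem q.1.1 (aSeq q.1) hN hk₁ hk₂ q.2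
  have hl : ∀ {j : ℕ}, 1 ≤ j → j ≤ 2 * N →
      Continuous fun q : PhaseSpace N × ℝ => lam N q.1.1 (aSeq q.1) j :=
    fun h₁ h₂ => (continuous_lam hN h₁ h₂).comp continuous_fst
  unfold gapWeight
  refine ((continuous_casimir₂.comp continuous_fst).pow N).div
    ((Real.continuous_sqrt.comp ((hx.sub (hl le_rfl (by omega))).mul
      ((hl (by omega) le_rfl).sub hx))).mul (continuous_finsetProd _ fun j hj => ?_)) fun q => ?_
  · obtain ⟨hjk, hj⟩ := Finset.mem_erase.1 hj
    obtain ⟨hj₁, hj₂⟩ := Finset.mem_Icc.1 hj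
    have hm := hx.sub ((continuous_mid hN hj₁ hj₂).comp continuous_fst)
    unfold realGapRoot
    refine hm.mul (Real.continuous_sqrt.comp (continuous_const.sub
      (((((continuous_gap hN hj₁ hj₂).comp continuous_fst).div_const 2).div hm fun q => ?_).pow 2)))
    exact (realGapRoot_sq _ _ hN hj₁ hj₂ (notMem_gap_of_mem_gap _ _ hN (aSeq_pos q.1) hj₁ hj₂
      hk₁ hk₂ hjk (hmem q))).2.2
  · exact mul_ne_zero
      (Real.sqrt_pos.2 (outer_factor_pos _ _ hN (aSeq_pos q.1) hk₁ hk₂ (hmem q))).ne'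
      (right_ne_zero_of_mul (sign_prod_realGapRoot _ _ hN (aSeq_pos q.1) hk₁ hk₂ (hmem q)).ne')

end WeightContinuity

/-! ### Collapsing a contour onto a gap -/

section Contour

open MeasureTheory

theorem complexSqrt_sq (z : ℂ) : Complex.sqrt z ^ 2 = z := by
  simp [Complex.sqrt]

theorem complexSqrt_re_nonneg (z : ℂ) : 0 ≤ (Complex.sqrt z).re := by
  rw [Complex.sqrt, Complex.cpow_inv_two_re]
  exact Real.sqrt_nonneg _

theorem complexSqrt_ne_zero {z : ℂ} (hz : z ≠ 0) : Complex.sqrt z ≠ 0 := by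
  intro h
  rw [← complexSqrt_sq z, h] at hz
  simp at hz

theorem differentiableAt_complexSqrt {z : ℂ} (hz : 0 < z.re) :
    DifferentiableAt ℂ Complex.sqrt z := by
  unfold Complex.sqrt
  exact differentiableAt_id.cpow_const (Or.inl hz)

theorem differentiableAt_complexSqrt_comp {f : ℂ → ℂ} {z : ℂ} (hf : DifferentiableAt ℂ f z)
    (hz : 0 < (f z).re) : DifferentiableAt ℂ (fun w => Complex.sqrt (f w)) z :=
  DifferentiableAt.comp z (differentiableAt_complexSqrt hz) hf

theorem complexSqrt_ofReal {x : ℝ} (hx : 0 ≤ x) : Complex.sqrt (x : ℂ) = (√x : ℝ) := by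
  rw [Complex.sqrt_of_nonneg (by exact_mod_cast hx), Complex.ofReal_re]

theorem intervalIntegral_cos_symm {f : ℝ → ℂ} (hf : Continuous fun t => f (Real.cos t)) :
    ∫ t in (0)..(2 * Real.pi), f (Real.cos t) = 2 * ∫ t in (0)..Real.pi, f (Real.cos t) := by
  have h : ∫ t in Real.pi..(2 * Real.pi), f (Real.cos t) = ∫ t in (0)..Real.pi, f (Real.cos t) := by
    have := intervalIntegral.integral_comp_sub_left (a := 0) (b := Real.pi)
      (fun t => f (Real.cos t)) (2 * Real.pi)
    simp only [Real.cos_two_pi_sub] at this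
    rw [this]
    congr 1 <;> ring
  rw [← intervalIntegral.integral_add_adjacent_intervals (hf.intervalIntegrable 0 Real.pi)
    (hf.intervalIntegrable Real.pi _), h, two_mul]

/-- The Poisson integral: Cauchy's formula on the unit circle for `z ↦ (1 - s z)⁻¹` at `s`. -/
theorem integral_inv_poisson {s : ℂ} (hs : ‖s‖ < 1) :
    ∫ t in (0)..(2 * Real.pi), ((1 + s ^ 2 - 2 * s * (Real.cos t : ℂ))⁻¹ : ℂ) =
      2 * (Real.pi : ℂ) * (1 - s ^ 2)⁻¹ := by
  have hne : ∀ z : ℂ, ‖z‖ ≤ 1 → 1 - s * z ≠ 0 := by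
    intro z hz h
    have h₁ : s * z = 1 := (sub_eq_zero.1 h).symm
    have h₂ : ‖s‖ * ‖z‖ = 1 := by rw [← norm_mul, h₁, norm_one]
    nlinarith [norm_nonneg s, norm_nonneg z]
  have hd : DifferentiableOn ℂ (fun z => (1 - s * z)⁻¹) (Metric.closedBall 0 1) := by
    intro z hz
    have hz' : ‖z‖ ≤ 1 := by simpa using hz
    have h : DifferentiableAt ℂ (fun z => 1 - s * z) z := by fun_prop
    exact (h.inv (hne z hz')).differentiableWithinAt
  have h := hd.circleIntegral_sub_inv_smul (w := s) (by simpa using hs)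
  rw [circleIntegral] at h
  have hint : ∀ t : ℝ, deriv (circleMap 0 1) t •
      ((circleMap 0 1 t - s)⁻¹ • (1 - s * circleMap 0 1 t)⁻¹) =
        Complex.I * (1 + s ^ 2 - 2 * s * (Real.cos t : ℂ))⁻¹ := by
    intro t
    have h₁ : circleMap 0 1 t ≠ 0 := by
      have : ‖circleMap 0 1 t‖ = 1 := by simp
      intro h; rw [h] at this; simp at this
    have h₂ : circleMap 0 1 t ^ 2 + 1 = 2 * (Real.cos t : ℂ) * circleMap 0 1 t := by
      simp only [circleMap, Complex.ofReal_one, one_mul, zero_add, Complex.ofReal_cos,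
        Complex.cos, neg_mul, Complex.exp_neg]
      have := Complex.exp_ne_zero ((t : ℂ) * Complex.I)
      field_simp
    have h₃ : (circleMap 0 1 t - s) * (1 - s * circleMap 0 1 t) =
        circleMap 0 1 t * (1 + s ^ 2 - 2 * s * (Real.cos t : ℂ)) := by
      linear_combination (-s) * h₂
    rw [deriv_circleMap, smul_eq_mul, smul_eq_mul, ← mul_inv, h₃, mul_inv]
    simp only [circleMap_zero] at *
    field_simp
  simp only [hint] at h
  rw [intervalIntegral.integral_const_mul, smul_eq_mul, mul_comm (2 * (Real.pi : ℂ)) Complex.I,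
    mul_assoc] at h
  rw [mul_left_cancel₀ Complex.I_ne_zero h, sq]

/-- The substitution `ρ = 2 s / (1 + s²)` turns this into the Poisson integral. -/
theorem integral_inv_one_sub_mul_cos {ρ : ℂ} (hρ : ‖ρ‖ < 1) :
    ∫ t in (0)..Real.pi, ((1 - ρ * (Real.cos t : ℂ))⁻¹ : ℂ) =
      (Real.pi : ℂ) * (Complex.sqrt (1 - ρ ^ 2))⁻¹ := by
  set q := Complex.sqrt (1 - ρ ^ 2) with hq
  have hq2 : q ^ 2 = 1 - ρ ^ 2 := complexSqrt_sq _
  have hqr : 0 ≤ q.re := complexSqrt_re_nonneg _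
  have hq1 : 1 ≤ ‖1 + q‖ := by
    have := Complex.re_le_norm (1 + q)
    simp only [Complex.add_re, Complex.one_re] at this
    linarith
  have hq1' : 1 + q ≠ 0 := by
    intro h; rw [h, norm_zero] at hq1; linarith
  have hq0 : q ≠ 0 := by
    refine complexSqrt_ne_zero fun h => ?_
    have h₁ : ρ ^ 2 = 1 := (sub_eq_zero.1 h).symm
    have h₂ : ‖ρ‖ ^ 2 = 1 := by rw [← norm_pow, h₁, norm_one]
    nlinarith [norm_nonneg ρ]
  -- the root in the unit disc of `2 s = ρ (1 + s ^ 2)`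
  set s := ρ / (1 + q) with hs
  have hs1 : ‖s‖ < 1 := by
    rw [hs, norm_div, div_lt_one (by linarith)]; linarith
  have h1 : 1 + s ^ 2 = 2 / (1 + q) := by
    rw [hs]; field_simp; linear_combination hq2
  have h2 : 1 - s ^ 2 = 2 * q / (1 + q) := by
    rw [hs]; field_simp; linear_combination -hq2
  have h3 : ∀ t : ℝ, (1 + s ^ 2 - 2 * s * (Real.cos t : ℂ))⁻¹ =
      (1 + q) / 2 * (1 - ρ * (Real.cos t : ℂ))⁻¹ := by
    intro t
    rw [h1, hs, show 2 / (1 + q) - 2 * (ρ / (1 + q)) * (Real.cos t : ℂ) =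
      2 / (1 + q) * (1 - ρ * (Real.cos t : ℂ)) by ring, mul_inv, inv_div]
  have hc : Continuous fun t : ℝ => (1 - ρ * (Real.cos t : ℂ))⁻¹ := by
    refine Continuous.inv₀ (by fun_prop) fun t h => ?_
    have h₁ : ρ * (Real.cos t : ℂ) = 1 := (sub_eq_zero.1 h).symm
    have h₂ : ‖ρ‖ * |Real.cos t| = 1 := by
      rw [← Real.norm_eq_abs, ← Complex.norm_real, ← norm_mul, h₁, norm_one]
    nlinarith [norm_nonneg ρ, abs_nonneg (Real.cos t), Real.abs_cos_le_one t]
  have h := integral_inv_poisson hs1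
  simp only [h3] at h
  rw [intervalIntegral.integral_const_mul,
    intervalIntegral_cos_symm (f := fun x => (1 - ρ * (x : ℂ))⁻¹) hc, h2] at h
  have h5 : (1 + q) * ∫ t in (0)..Real.pi, (1 - ρ * (Real.cos t : ℂ))⁻¹ =
      (1 + q) * (Real.pi * q⁻¹) := by
    rw [inv_div] at h
    field_simp at h ⊢
    linear_combination h
  exact mul_left_cancel₀ hq1' h5

theorem intervalIntegral_swap {f : ℝ → ℝ → ℂ} (hf : Continuous (Function.uncurry f)) {a b c d : ℝ}
    (hab : a ≤ b) (hcd : c ≤ d) :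
    ∫ x in a..b, ∫ y in c..d, f x y = ∫ y in c..d, ∫ x in a..b, f x y := by
  simp only [intervalIntegral.integral_of_le hab, intervalIntegral.integral_of_le hcd]
  refine integral_integral_swap ?_
  rw [Measure.prod_restrict]
  exact (hf.continuousOn.integrableOn_compact (isCompact_Icc.prod isCompact_Icc)).mono_set
    (Set.prod_mono Set.Ioc_subset_Icc_self Set.Ioc_subset_Icc_self)

/-- The integral of a function with the singularity of `((z - τ)² - r²)^(-1/2)` along a circle
around the cut `[τ - r, τ + r]` is an integral over the cut. By Cauchy's formula this reduces to the
case of `z ↦ (z - x)⁻¹` with `x` in the cut. For `r = 0` it is the residue theorem. -/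
theorem circleIntegral_div_gapRoot {τ r R : ℝ} (hr : 0 ≤ r) (hrR : r < R) {g : ℂ → ℂ}
    (hg : DifferentiableOn ℂ g (Metric.closedBall (τ : ℂ) R)) :
    ∮ z in C((τ : ℂ), R), g z / ((z - τ) * Complex.sqrt (1 - ((r : ℂ) / (z - τ)) ^ 2)) =
      2 * Complex.I * ∫ t in (0)..Real.pi, g ((τ - r * Real.cos t : ℝ) : ℂ) := by
  have hR : 0 < R := hr.trans_lt hrR
  have hx : ∀ t : ℝ, ((τ - r * Real.cos t : ℝ) : ℂ) ∈ Metric.ball (τ : ℂ) R := by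
    intro t
    rw [Metric.mem_ball, Complex.dist_of_im_eq (by simp), Complex.ofReal_re, Complex.ofReal_re,
      Real.dist_eq, show τ - r * Real.cos t - τ = -(r * Real.cos t) by ring, abs_neg, abs_mul,
      abs_of_nonneg hr]
    nlinarith [Real.abs_cos_le_one t, abs_nonneg (Real.cos t)]
  have hne : ∀ θ t : ℝ, circleMap (τ : ℂ) R θ - ((τ - r * Real.cos t : ℝ) : ℂ) ≠ 0 := by
    intro θ t h
    have h₁ := hx t
    rw [← sub_eq_zero.1 h, Metric.mem_ball, dist_eq_norm, circleMap_sub_center, norm_circleMap_zero,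
      abs_of_pos hR] at h₁
    exact lt_irrefl _ h₁
  have hgc : Continuous fun θ : ℝ => g (circleMap (τ : ℂ) R θ) :=
    hg.continuousOn.comp_continuous (continuous_circleMap _ _)
      fun θ => circleMap_mem_closedBall _ hR.le θ
  have hker : ∀ θ : ℝ, (circleMap (τ : ℂ) R θ - τ)⁻¹ *
      (Complex.sqrt (1 - ((r : ℂ) / (circleMap (τ : ℂ) R θ - τ)) ^ 2))⁻¹ = (Real.pi : ℂ)⁻¹ *
        ∫ t in (0)..Real.pi, (circleMap (τ : ℂ) R θ - ((τ - r * Real.cos t : ℝ) : ℂ))⁻¹ := by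
    intro θ
    set w := circleMap (τ : ℂ) R θ - τ with hw
    have hwn : ‖w‖ = R := by rw [hw, circleMap_sub_center, norm_circleMap_zero, abs_of_pos hR]
    have hw0 : w ≠ 0 := by intro h; rw [h, norm_zero] at hwn; linarith
    have hρ : ‖-((r : ℂ) / w)‖ < 1 := by
      rw [norm_neg, norm_div, hwn, div_lt_one hR, Complex.norm_real, Real.norm_eq_abs,
        abs_of_nonneg hr]
      exact hrR
    have h := integral_inv_one_sub_mul_cos hρ
    have hi : ∀ t : ℝ, (circleMap (τ : ℂ) R θ - ((τ - r * Real.cos t : ℝ) : ℂ))⁻¹ =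
        w⁻¹ * (1 - -((r : ℂ) / w) * (Real.cos t : ℂ))⁻¹ := by
      intro t
      rw [← mul_inv]
      congr 1
      rw [hw] at hw0 ⊢
      push_cast
      field_simp
      ring
    simp only [hi]
    rw [intervalIntegral.integral_const_mul, h, neg_sq]
    have hpi : (Real.pi : ℂ) ≠ 0 := by exact_mod_cast Real.pi_ne_zero
    field_simp
  have hcont : Continuous (Function.uncurry fun θ t : ℝ => deriv (circleMap (τ : ℂ) R) θ *
      ((circleMap (τ : ℂ) R θ - ((τ - r * Real.cos t : ℝ) : ℂ))⁻¹ *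
        g (circleMap (τ : ℂ) R θ))) := by
    refine Continuous.mul ?_ (Continuous.mul (Continuous.inv₀ ?_ fun q => hne q.1 q.2)
      (hgc.comp continuous_fst))
    · simp only [deriv_circleMap]
      fun_prop
    · fun_prop
  have hcauchy : ∀ t : ℝ, ∫ θ in (0)..(2 * Real.pi), deriv (circleMap (τ : ℂ) R) θ *
      ((circleMap (τ : ℂ) R θ - ((τ - r * Real.cos t : ℝ) : ℂ))⁻¹ * g (circleMap (τ : ℂ) R θ)) =
        2 * Real.pi * Complex.I * g ((τ - r * Real.cos t : ℝ) : ℂ) :=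
    fun t => hg.circleIntegral_sub_inv_smul (hx t)
  rw [circleIntegral]
  have hpi : (Real.pi : ℂ) ≠ 0 := by exact_mod_cast Real.pi_ne_zero
  calc ∫ θ in (0)..(2 * Real.pi), deriv (circleMap (τ : ℂ) R) θ • (g (circleMap (τ : ℂ) R θ) /
        ((circleMap (τ : ℂ) R θ - τ) *
          Complex.sqrt (1 - ((r : ℂ) / (circleMap (τ : ℂ) R θ - τ)) ^ 2)))
      = ∫ θ in (0)..(2 * Real.pi), (Real.pi : ℂ)⁻¹ * ∫ t in (0)..Real.pi,
          deriv (circleMap (τ : ℂ) R) θ * ((circleMap (τ : ℂ) R θ -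
            ((τ - r * Real.cos t : ℝ) : ℂ))⁻¹ * g (circleMap (τ : ℂ) R θ)) := by
        refine intervalIntegral.integral_congr fun θ _ => ?_
        rw [intervalIntegral.integral_const_mul, intervalIntegral.integral_mul_const, smul_eq_mul,
          div_eq_mul_inv, mul_inv, hker θ]
        ring
    _ = (Real.pi : ℂ)⁻¹ * ∫ t in (0)..Real.pi,
          2 * Real.pi * Complex.I * g ((τ - r * Real.cos t : ℝ) : ℂ) := by
        rw [intervalIntegral.integral_const_mul,
          intervalIntegral_swap hcont (by positivity) Real.pi_pos.le]
        congr 1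
        exact intervalIntegral.integral_congr fun t _ => hcauchy t
    _ = _ := by
        rw [intervalIntegral.integral_const_mul]
        field_simp

end Contour

section Collapse

variable {N : ℕ} (b a : ZMod N → ℝ)

/-- The canonical root without the factor of the `k`-th gap. -/
def reducedRoot (N : ℕ) (b a : ZMod N → ℝ) (k : ℕ) (z : ℂ) : ℂ :=
  Complex.I * ((casimir₂ N a ^ N)⁻¹ : ℝ) *
    Complex.sqrt ((z - lam N b a 1) * (lam N b a (2 * N) - z)) *
    ∏ n ∈ (Finset.Icc 1 (N - 1)).erase k, gapRoot N b a n z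

theorem canonicalRoot_eq {k : ℕ} (hk₁ : 1 ≤ k) (hk₂ : k ≤ N - 1) (z : ℂ) :
    canonicalRoot N b a z = reducedRoot N b a k z * gapRoot N b a k z := by
  rw [canonicalRoot, reducedRoot, ← Finset.prod_erase_mul _ _ (Finset.mem_Icc.2 ⟨hk₁, hk₂⟩)]
  ring

theorem gapRoot_regular (hN : 2 ≤ N) {j : ℕ} (hj₁ : 1 ≤ j) (hj₂ : j ≤ N - 1) {z : ℂ}
    (hz : z.re < lam N b a (2 * j) ∨ lam N b a (2 * j + 1) < z.re) :
    DifferentiableAt ℂ (gapRoot N b a j) z ∧ gapRoot N b a j z ≠ 0 := by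
  have hg := gap_nonneg b a hN hj₁ hj₂
  rw [← mid_sub_gap, ← mid_add_gap] at hz
  have h₁ : gap N b a j / 2 < ‖z - mid N b a j‖ := by
    refine lt_of_lt_of_le ?_ (Complex.abs_re_le_norm _)
    simp only [Complex.sub_re, Complex.ofReal_re]
    rcases hz with hz | hz
    · exact lt_abs.2 (Or.inr (by linarith))
    · exact lt_abs.2 (Or.inl (by linarith))
  have h₂ : z - mid N b a j ≠ 0 := by
    intro h; rw [h, norm_zero] at h₁; linarith
  have h₃ : 0 < (1 - ((gap N b a j / 2 : ℝ) / (z - mid N b a j)) ^ 2).re := by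
    have h₄ : ‖(((gap N b a j / 2 : ℝ) : ℂ) / (z - mid N b a j)) ^ 2‖ < 1 := by
      rw [norm_pow, norm_div, Complex.norm_real, Real.norm_eq_abs, abs_of_nonneg (by linarith)]
      have : gap N b a j / 2 / ‖z - mid N b a j‖ < 1 := by
        rw [div_lt_one (by linarith)]; exact h₁
      have h0 : 0 ≤ gap N b a j / 2 / ‖z - mid N b a j‖ := by positivity
      nlinarith
    have := Complex.re_le_norm ((((gap N b a j / 2 : ℝ) : ℂ) / (z - mid N b a j)) ^ 2)
    simp only [Complex.sub_re, Complex.one_re]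
    linarith
  constructor
  · unfold gapRoot
    have hm : DifferentiableAt ℂ (fun z : ℂ => z - mid N b a j) z := by fun_prop
    exact hm.mul (differentiableAt_complexSqrt_comp
      ((((differentiableAt_const _).div hm h₂).pow 2).const_sub 1) h₃)
  · refine mul_ne_zero h₂ (complexSqrt_ne_zero fun h => ?_)
    rw [h] at h₃
    simp at h₃

theorem re_mem_of_mem_disc (hN : 2 ≤ N) (ha : ∀ k, 0 < a k) {k : ℕ} (hk₁ : 1 ≤ k)
    (hk₂ : k ≤ N - 1) {z : ℂ} (hz : z ∈ Metric.closedBall (mid N b a k : ℂ) (gap N b a k / 2 +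
      min (lam N b a (2 * k) - lam N b a (2 * k - 1))
        (lam N b a (2 * k + 2) - lam N b a (2 * k + 1)) / 3)) :
    lam N b a (2 * k - 1) < z.re ∧ z.re < lam N b a (2 * k + 2) := by
  have h₁ := lam_odd_lt_even b a hN ha (show k - 1 < N by omega)
  rw [show 2 * (k - 1) + 1 = 2 * k - 1 by omega, show 2 * (k - 1) + 2 = 2 * k by omega] at h₁
  have h₂ := lam_odd_lt_even b a hN ha (show k < N by omega)
  rw [Metric.mem_closedBall, dist_eq_norm] at hz
  have h₃ := abs_le.1 ((Complex.abs_re_le_norm _).trans hz)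
  simp only [Complex.sub_re, Complex.ofReal_re] at h₃
  have h₄ := min_le_left (lam N b a (2 * k) - lam N b a (2 * k - 1))
    (lam N b a (2 * k + 2) - lam N b a (2 * k + 1))
  have h₅ := min_le_right (lam N b a (2 * k) - lam N b a (2 * k - 1))
    (lam N b a (2 * k + 2) - lam N b a (2 * k + 1))
  have h₆ := mid_sub_gap b a k
  have h₇ := mid_add_gap b a k
  constructor <;> linarith [h₃.1, h₃.2]

/-- Over the strip between the neighbouring gaps the reduced root is analytic without zeros. -/
theorem reducedRoot_regular (hN : 2 ≤ N) {k : ℕ} (hk₁ : 1 ≤ k) (hk₂ : k ≤ N - 1)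
    (ha : ∀ k, 0 < a k) {z : ℂ} (hz : lam N b a (2 * k - 1) < z.re ∧ z.re < lam N b a (2 * k + 2)) :
    DifferentiableAt ℂ (reducedRoot N b a k) z ∧ reducedRoot N b a k z ≠ 0 := by
  have hj : ∀ j ∈ (Finset.Icc 1 (N - 1)).erase k,
      DifferentiableAt ℂ (gapRoot N b a j) z ∧ gapRoot N b a j z ≠ 0 := by
    intro j hj
    obtain ⟨hjk, hj⟩ := Finset.mem_erase.1 hj
    obtain ⟨hj₁, hj₂⟩ := Finset.mem_Icc.1 hj
    refine gapRoot_regular b a hN hj₁ hj₂ ?_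
    rcases hjk.lt_or_gt with h | h
    · exact Or.inr (lt_of_le_of_lt (lam_le_lam b a hN (by omega) (by omega) (by omega)) hz.1)
    · exact Or.inl (lt_of_lt_of_le hz.2 (lam_le_lam b a hN (by omega) (by omega) (by omega)))
  have hl := lam_le_lam b a hN le_rfl (show 1 ≤ 2 * k - 1 by omega) (by omega)
  have hr := lam_le_lam b a hN (show 1 ≤ 2 * k + 2 by omega)
    (show 2 * k + 2 ≤ 2 * N by omega) le_rfl
  have hre : 0 < ((z - lam N b a 1) * (lam N b a (2 * N) - z)).re := by
    simp only [Complex.mul_re, Complex.sub_re, Complex.ofReal_re, Complex.sub_im, Complex.ofReal_im]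
    nlinarith [mul_pos (sub_pos.2 (hl.trans_lt hz.1)) (sub_pos.2 (hz.2.trans_le hr)),
      sq_nonneg z.im]
  constructor
  · unfold reducedRoot
    have ho : DifferentiableAt ℂ (fun z : ℂ => (z - lam N b a 1) * (lam N b a (2 * N) - z)) z := by
      fun_prop
    refine ((differentiableAt_complexSqrt_comp ho hre).const_mul _).mul ?_
    exact DifferentiableAt.fun_finsetProd fun j hj' => (hj j hj').1
  · refine mul_ne_zero (mul_ne_zero (mul_ne_zero Complex.I_ne_zero (Complex.ofReal_ne_zero.2
      (inv_ne_zero (pow_pos (casimir₂_pos N a ha) N).ne'))) (complexSqrt_ne_zero fun h => ?_))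
      (Finset.prod_ne_zero_iff.2 fun j hj' => (hj j hj').2)
    rw [h] at hre
    simp at hre

theorem gapRoot_ofReal (hN : 2 ≤ N) {j : ℕ} (hj₁ : 1 ≤ j) (hj₂ : j ≤ N - 1) {x : ℝ}
    (hx : x < lam N b a (2 * j) ∨ lam N b a (2 * j + 1) < x) :
    gapRoot N b a j (x : ℂ) = realGapRoot N b a j x := by
  have h := (realGapRoot_sq b a hN hj₁ hj₂ hx).2.1
  rw [gapRoot, realGapRoot, Complex.ofReal_mul, ← complexSqrt_ofReal h.le]
  push_cast
  rfl

theorem inv_reducedRoot_ofReal (hN : 2 ≤ N) (ha : ∀ k, 0 < a k) {k : ℕ} (hk₁ : 1 ≤ k)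
    (hk₂ : k ≤ N - 1) {x : ℝ} (hx : x ∈ Set.Icc (lam N b a (2 * k)) (lam N b a (2 * k + 1))) :
    (reducedRoot N b a k (x : ℂ))⁻¹ = -Complex.I * gapWeight N b a k x := by
  have h₁ : ∏ j ∈ (Finset.Icc 1 (N - 1)).erase k, gapRoot N b a j (x : ℂ) =
      ((∏ j ∈ (Finset.Icc 1 (N - 1)).erase k, realGapRoot N b a j x : ℝ) : ℂ) := by
    rw [Complex.ofReal_prod]
    refine Finset.prod_congr rfl fun j hj => ?_
    obtain ⟨hjk, hj⟩ := Finset.mem_erase.1 hj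
    obtain ⟨hj₁, hj₂⟩ := Finset.mem_Icc.1 hj
    exact gapRoot_ofReal b a hN hj₁ hj₂ (notMem_gap_of_mem_gap b a hN ha hj₁ hj₂ hk₁ hk₂ hjk hx)
  have h₂ : Complex.sqrt (((x : ℂ) - lam N b a 1) * (lam N b a (2 * N) - x)) =
      (√((x - lam N b a 1) * (lam N b a (2 * N) - x)) : ℝ) := by
    rw [← complexSqrt_ofReal (outer_factor_pos b a hN ha hk₁ hk₂ hx).le]
    push_cast
    rfl
  rw [reducedRoot, h₁, h₂, gapWeight]
  push_cast
  rw [mul_inv, mul_inv, mul_inv, inv_inv, Complex.inv_I]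
  ring

/-- A period of a differential `p dλ / √(Δ² - 4)` as an integral over the gap. It also holds where
the gap is collapsed. -/
theorem gapContourIntegral_div_canonicalRoot (hN : 2 ≤ N) (ha : ∀ k, 0 < a k) {k : ℕ} (hk₁ : 1 ≤ k)
    (hk₂ : k ≤ N - 1) (p : ℝ[X]) :
    1 / (2 * Real.pi : ℂ) *
        gapContourIntegral N b a k (fun z => aeval z p / canonicalRoot N b a z) =
      ((1 / Real.pi * ∫ t in (0)..Real.pi, p.eval (gapPoint N b a k t) *
        gapWeight N b a k (gapPoint N b a k t) : ℝ) : ℂ) := by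
  have h₁ := lam_odd_lt_even b a hN ha (show k - 1 < N by omega)
  rw [show 2 * (k - 1) + 1 = 2 * k - 1 by omega, show 2 * (k - 1) + 2 = 2 * k by omega] at h₁
  have h₂ := lam_odd_lt_even b a hN ha (show k < N by omega)
  have hR : gap N b a k / 2 < gap N b a k / 2 +
      min (lam N b a (2 * k) - lam N b a (2 * k - 1))
        (lam N b a (2 * k + 2) - lam N b a (2 * k + 1)) / 3 := by
    have := lt_min (sub_pos.2 h₁) (sub_pos.2 h₂)
    linarith
  have hg : DifferentiableOn ℂ (fun z => aeval z p * (reducedRoot N b a k z)⁻¹)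
      (Metric.closedBall (mid N b a k : ℂ) (gap N b a k / 2 +
        min (lam N b a (2 * k) - lam N b a (2 * k - 1))
          (lam N b a (2 * k + 2) - lam N b a (2 * k + 1)) / 3)) := by
    intro z hz
    obtain ⟨h, h'⟩ := reducedRoot_regular b a hN hk₁ hk₂ ha
      (re_mem_of_mem_disc b a hN ha hk₁ hk₂ hz)
    exact (p.differentiable_aeval.differentiableAt.mul (h.inv h')).differentiableWithinAt
  have h := circleIntegral_div_gapRoot (by linarith [gap_nonneg b a hN hk₁ hk₂]) hR hg
  have he : (fun z : ℂ => aeval z p / canonicalRoot N b a z) = fun z : ℂ =>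
      aeval z p * (reducedRoot N b a k z)⁻¹ / ((z - mid N b a k) *
        Complex.sqrt (1 - (((gap N b a k / 2 : ℝ) : ℂ) / (z - mid N b a k)) ^ 2)) := by
    funext z
    rw [canonicalRoot_eq b a hk₁ hk₂, gapRoot, ← div_div, div_eq_mul_inv (aeval z p)]
  have hi : ∀ t : ℝ, aeval ((mid N b a k - gap N b a k / 2 * Real.cos t : ℝ) : ℂ) p *
      (reducedRoot N b a k ((mid N b a k - gap N b a k / 2 * Real.cos t : ℝ) : ℂ))⁻¹ =
        -Complex.I *
          ((p.eval (gapPoint N b a k t) * gapWeight N b a k (gapPoint N b a k t) : ℝ) : ℂ) := by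
    intro t
    have hx := gapPoint_mem b a hN hk₁ hk₂ t
    rw [← gapPoint, inv_reducedRoot_ofReal b a hN ha hk₁ hk₂ hx, Complex.ofReal_mul,
      ← Complex.coe_algebraMap, aeval_algebraMap_apply, coe_aeval_eq_eval]
    ring
  simp only [hi] at h
  rw [gapContourIntegral, he, h, intervalIntegral.integral_const_mul,
    intervalIntegral.integral_ofReal]
  set J := ∫ t in (0)..Real.pi, p.eval (gapPoint N b a k t) *
    gapWeight N b a k (gapPoint N b a k t)
  have hpi : (Real.pi : ℂ) ≠ 0 := by exact_mod_cast Real.pi_ne_zero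
  rw [Complex.ofReal_mul, Complex.ofReal_div, Complex.ofReal_one]
  field_simp
  linear_combination (-J : ℂ) * Complex.I_sq

end Collapse

/-! ### Actions -/

section Actions

variable {N : ℕ} (b a : ZMod N → ℝ)

/-- The period `(1/2π) ∫_{Γ_k} p dλ / √(Δ² - 4)`, as an integral over the gap. -/
def period (N : ℕ) (b a : ZMod N → ℝ) (k : ℕ) (p : ℝ[X]) : ℝ :=
  1 / Real.pi * ∫ t in (0)..Real.pi,
    p.eval (gapPoint N b a k t) * gapWeight N b a k (gapPoint N b a k t)

theorem continuous_gapPoint_right (k : ℕ) : Continuous (gapPoint N b a k) := by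
  unfold gapPoint; fun_prop

theorem continuous_gapWeight_right (hN : 2 ≤ N) (ha : ∀ k, 0 < a k) {k : ℕ} (hk₁ : 1 ≤ k)
    (hk₂ : k ≤ N - 1) : Continuous fun t => gapWeight N b a k (gapPoint N b a k t) :=
  (continuous_gapWeight hN hk₁ hk₂).comp
    (Continuous.prodMk_right ((b, fun k => ⟨a k, ha k⟩) : PhaseSpace N))

theorem action_eq_period (hN : 2 ≤ N) (ha : ∀ k, 0 < a k) {k : ℕ} (hk₁ : 1 ≤ k)
    (hk₂ : k ≤ N - 1) : action N b a k = period N b a k (X * derivative (discr N b a)) := by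
  have h := gapContourIntegral_div_canonicalRoot b a hN ha hk₁ hk₂ (X * derivative (discr N b a))
  simp only [map_mul, aeval_X] at h
  rw [action, h, Complex.ofReal_re, period]

theorem continuous_action (hN : 2 ≤ N) {k : ℕ} (hk₁ : 1 ≤ k) (hk₂ : k ≤ N - 1) :
    Continuous fun p : PhaseSpace N => action N p.1 (aSeq p) k := by
  have h : (fun p : PhaseSpace N => action N p.1 (aSeq p) k) = fun p => 1 / Real.pi *
      ∫ t in (0)..Real.pi, gapPoint N p.1 (aSeq p) k t *
        (derivative (discr N p.1 (aSeq p))).eval (gapPoint N p.1 (aSeq p) k t) *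
          gapWeight N p.1 (aSeq p) k (gapPoint N p.1 (aSeq p) k t) := by
    funext p
    simp only [action_eq_period _ _ hN (aSeq_pos p) hk₁ hk₂, period, eval_mul, eval_X]
  rw [h]
  have hx := continuous_gapPoint hN hk₁ hk₂
  refine continuous_const.mul
    (intervalIntegral.continuous_parametric_intervalIntegral_of_continuous' ?_ _ _)
  exact (hx.mul (continuous_eval_derivative_discr.comp (continuous_fst.prodMk hx))).mul
    (continuous_gapWeight hN hk₁ hk₂)

/-- A collapsed gap is a double zero of `Δ² - 4`, hence a zero of `Δ'`. -/
theorem eval_derivative_discr_of_gap_eq_zero (hN : 2 ≤ N) (ha : ∀ k, 0 < a k) {k : ℕ} (hk₁ : 1 ≤ k)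
    (hk₂ : k ≤ N - 1) (hg : gap N b a k = 0) :
    (derivative (discr N b a)).eval (mid N b a k) = 0 := by
  have h₁ := mid_sub_gap b a k
  have h₂ := mid_add_gap b a k
  rw [hg, zero_div, sub_zero] at h₁
  rw [hg, zero_div, add_zero] at h₂
  set τ := mid N b a k with hτ
  have hp : discr N b a ^ 2 - 4 = (X - C τ) ^ 2 * (C ((casimir₂ N a ^ N)⁻¹ ^ 2) *
      ((X - C (lam N b a 1)) * (X - C (lam N b a (2 * N))) * ∏ j ∈ (Finset.Icc 1 (N - 1)).erase k,
        ((X - C (lam N b a (2 * j))) * (X - C (lam N b a (2 * j + 1)))))) := by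
    refine Polynomial.funext fun x => ?_
    have h := discr_sq_sub_four_eq b a hN ha x
    rw [← Finset.mul_prod_erase _ _ (Finset.mem_Icc.2 ⟨hk₁, hk₂⟩), ← h₁, ← h₂] at h
    simp only [eval_sub, eval_pow, eval_ofNat, eval_mul, eval_X, eval_C, eval_prod]
    rw [h]
    ring
  have hd := congrArg (fun q => (derivative q).eval τ) hp
  have h4 : derivative (4 : ℝ[X]) = 0 := derivative_C
  simp only [derivative_sub, derivative_pow, h4, derivative_mul, eval_sub, eval_mul, eval_add,
    eval_pow, eval_X, eval_C, sub_self, derivative_X, derivative_C, eval_zero] at hd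
  have hs := two_le_sign_mul_discr b a hN ha hk₁ hk₂ (x := τ) ⟨h₁.ge, h₂.le⟩
  have hne : (discr N b a).eval τ ≠ 0 := by
    intro h; rw [h, mul_zero] at hs; linarith
  norm_num at hd
  exact hd.resolve_left hne

theorem action_eq_zero (hN : 2 ≤ N) (ha : ∀ k, 0 < a k) {k : ℕ} (hk₁ : 1 ≤ k)
    (hk₂ : k ≤ N - 1) (hg : gap N b a k = 0) : action N b a k = 0 := by
  have h : ∀ t, gapPoint N b a k t = mid N b a k := fun t => by rw [gapPoint, hg]; ring
  rw [action_eq_period b a hN ha hk₁ hk₂, period]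
  simp [h, eval_derivative_discr_of_gap_eq_zero b a hN ha hk₁ hk₂ hg]

theorem hasDerivAt_gapPoint (k : ℕ) (t : ℝ) :
    HasDerivAt (gapPoint N b a k) (gap N b a k / 2 * Real.sin t) t := by
  have h := ((Real.hasDerivAt_cos t).const_mul (gap N b a k / 2)).const_sub (mid N b a k)
  rw [mul_neg, neg_neg] at h
  exact h

theorem gapPoint_zero (k : ℕ) : gapPoint N b a k 0 = lam N b a (2 * k) := by
  rw [gapPoint, Real.cos_zero, mul_one, mid_sub_gap]

theorem gapPoint_pi (k : ℕ) : gapPoint N b a k Real.pi = lam N b a (2 * k + 1) := by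
  rw [gapPoint, Real.cos_pi, mul_neg_one, sub_neg_eq_add, mid_add_gap]

theorem neg_one_pow_gap {k : ℕ} (hk : k ≤ N - 1) (hN : 2 ≤ N) :
    ((-1 : ℝ)) ^ (N - k) = -(-1) ^ (N - 1 - k) := by
  rw [show N - k = N - 1 - k + 1 by omega, pow_succ, mul_neg_one]

theorem abs_gapWeight (hN : 2 ≤ N) (ha : ∀ k, 0 < a k) {k : ℕ} (hk₁ : 1 ≤ k)
    (hk₂ : k ≤ N - 1) {x : ℝ} (hx : x ∈ Set.Icc (lam N b a (2 * k)) (lam N b a (2 * k + 1))) :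
    |gapWeight N b a k x| = (-1) ^ (N - 1 - k) * gapWeight N b a k x := by
  have h := sign_gapWeight b a hN ha hk₁ hk₂ hx
  rw [← abs_of_pos h, abs_mul, abs_pow, abs_neg, abs_one, one_pow, one_mul]

/-- Integration by parts turns the action into the integral of `arcosh |Δ / 2|` over the gap, as
`arcosh |Δ / 2|` is a primitive of `± Δ' / √(Δ² - 4)` vanishing at both ends of the gap. -/
theorem action_eq_integral_arcosh (hN : 2 ≤ N) (ha : ∀ k, 0 < a k) {k : ℕ} (hk₁ : 1 ≤ k)
    (hk₂ : k ≤ N - 1) : Real.pi * action N b a k =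
      ∫ x in (lam N b a (2 * k))..(lam N b a (2 * k + 1)),
        Real.arcosh ((-1) ^ (N - k) * (discr N b a).eval x / 2) := by
  rcases (gap_nonneg b a hN hk₁ hk₂).eq_or_lt with hg | hg
  · rw [action_eq_zero b a hN ha hk₁ hk₂ hg.symm, mul_zero, ← mid_sub_gap, ← mid_add_gap, ← hg]
    simp
  set s : ℝ := (-1) ^ (N - k) with hs
  set v : ℝ → ℝ := fun x => s * (discr N b a).eval x / 2 with hv
  have hx := fun t => gapPoint_mem b a hN hk₁ hk₂ t
  have hs2 : s ^ 2 = 1 := by rw [hs, ← pow_mul, mul_comm, pow_mul]; norm_num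
  have hv1 : ∀ x ∈ Set.Icc (lam N b a (2 * k)) (lam N b a (2 * k + 1)), 1 ≤ v x := fun x hx => by
    have := two_le_sign_mul_discr b a hN ha hk₁ hk₂ hx
    simp only [hv]; linarith
  have hvsq : ∀ x, v x ^ 2 - 1 = ((discr N b a).eval x ^ 2 - 4) / 4 := fun x => by
    simp only [hv, div_pow, mul_pow, hs2]; ring
  have hvc : Continuous v := (continuous_const.mul (discr N b a).continuous).div_const 2
  have hGc : ContinuousOn (fun x => Real.arcosh (v x))
      (Set.Icc (lam N b a (2 * k)) (lam N b a (2 * k + 1))) :=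
    Real.continuousOn_arcosh.comp hvc.continuousOn hv1
  have hGt : Continuous fun t => Real.arcosh (v (gapPoint N b a k t)) :=
    hGc.comp_continuous (continuous_gapPoint_right b a k) hx
  have hGd : ∀ t ∈ Set.Ioo 0 Real.pi, HasDerivAt (fun t => Real.arcosh (v (gapPoint N b a k t)))
      (-((derivative (discr N b a)).eval (gapPoint N b a k t) *
        gapWeight N b a k (gapPoint N b a k t))) t := by
    intro t ht
    have hsin := Real.sin_pos_of_pos_of_lt_pi ht.1 ht.2
    have hP := gapWeight_sq_mul_gapPoint b a hN ha hk₁ hk₂ t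
    have hsq := abs_gapWeight_mul_sqrt b a hN ha hk₁ hk₂ hsin.le
    set x := gapPoint N b a k t with hxt
    have hPpos : 0 < (discr N b a).eval x ^ 2 - 4 := by
      have h₁ : 0 < (gap N b a k / 2 * Real.sin t) ^ 2 := by positivity
      rw [← hP] at h₁
      exact (pos_iff_pos_of_mul_pos h₁).1 (by
        have := sign_gapWeight b a hN ha hk₁ hk₂ (hx t)
        have := right_ne_zero_of_mul this.ne'
        positivity)
    have hv1' : v x ∈ Set.Ioi 1 := by
      have h₁ := hv1 x (hx t)
      have h₂ := hvsq x
      simp only [Set.mem_Ioi]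
      nlinarith
    have hvd : HasDerivAt v (s * (derivative (discr N b a)).eval x / 2) x :=
      (((discr N b a).hasDerivAt x).const_mul s).div_const 2
    have h := (Real.hasDerivAt_arcosh hv1').comp t (hvd.comp t (hasDerivAt_gapPoint b a k t))
    refine h.congr_deriv ?_
    have hr : √(v x ^ 2 - 1) = √((discr N b a).eval x ^ 2 - 4) / 2 := by
      rw [hvsq, Real.sqrt_div hPpos.le, show (4 : ℝ) = 2 ^ 2 by norm_num,
        Real.sqrt_sq (by norm_num)]
    rw [hr, ← hsq, abs_gapWeight b a hN ha hk₁ hk₂ (hx t), hs, neg_one_pow_gap hk₂ hN]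
    have h₁ := (Real.sqrt_pos.2 hPpos).ne'
    have h4 : ((-1 : ℝ) ^ (N - 1 - k)) ^ 2 = 1 := by
      rw [← pow_mul, mul_comm, pow_mul]; norm_num
    field_simp
    rw [h4]; ring
  have hend : ∀ x ∈ Set.Icc (lam N b a (2 * k)) (lam N b a (2 * k + 1)),
      (discr N b a).eval x ^ 2 - 4 = 0 → Real.arcosh (v x) = 0 := fun x hx h => by
    have h₁ := hvsq x
    rw [h, zero_div] at h₁
    rw [Real.arcosh_eq_zero_iff (hv1 x hx)]
    nlinarith [hv1 x hx]
  have hend' : ∀ t, Real.sin t = 0 → Real.arcosh (v (gapPoint N b a k t)) = 0 := fun t ht => by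
    refine hend _ (hx t) ?_
    have hP := gapWeight_sq_mul_gapPoint b a hN ha hk₁ hk₂ t
    rw [ht, mul_zero, sq (0 : ℝ), mul_zero] at hP
    have := right_ne_zero_of_mul (sign_gapWeight b a hN ha hk₁ hk₂ (hx t)).ne'
    exact (mul_eq_zero.1 hP).resolve_left (pow_ne_zero 2 this)
  have hWc := continuous_gapWeight_right b a hN ha hk₁ hk₂
  have hparts := intervalIntegral.integral_mul_deriv_eq_deriv_mul_of_hasDeriv_right
    (a := 0) (b := Real.pi) (u := gapPoint N b a k)
    (v := fun t => Real.arcosh (v (gapPoint N b a k t)))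
    (u' := fun t => gap N b a k / 2 * Real.sin t)
    (v' := fun t => -((derivative (discr N b a)).eval (gapPoint N b a k t) *
        gapWeight N b a k (gapPoint N b a k t)))
    (continuous_gapPoint_right b a k).continuousOn hGt.continuousOn
    (fun t _ => (hasDerivAt_gapPoint b a k t).hasDerivWithinAt)
    (fun t ht => (hGd t (by simpa [Real.pi_pos.le] using ht)).hasDerivWithinAt)
    (Continuous.intervalIntegrable (by fun_prop) _ _)
    (Continuous.intervalIntegrable (((derivative (discr N b a)).continuous.comp
      (continuous_gapPoint_right b a k)).mul hWc).neg _ _)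
  rw [hend' _ Real.sin_pi, hend' _ Real.sin_zero, mul_zero, mul_zero, sub_zero, zero_sub] at hparts
  have hsubst := intervalIntegral.integral_comp_mul_deriv'' (a := 0) (b := Real.pi)
    (f := gapPoint N b a k) (f' := fun t => gap N b a k / 2 * Real.sin t)
    (g := fun x => Real.arcosh (v x)) (continuous_gapPoint_right b a k).continuousOn
    (fun t _ => (hasDerivAt_gapPoint b a k t).hasDerivWithinAt)
    (Continuous.continuousOn (by fun_prop))
    (hGc.mono (by rintro _ ⟨t, -, rfl⟩; exact hx t))
  rw [gapPoint_zero, gapPoint_pi] at hsubst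
  rw [← hsubst, action_eq_period b a hN ha hk₁ hk₂, period, ← mul_assoc,
    mul_one_div_cancel Real.pi_ne_zero, one_mul]
  have h₁ : ∀ t, (X * derivative (discr N b a)).eval (gapPoint N b a k t) *
      gapWeight N b a k (gapPoint N b a k t) = -(gapPoint N b a k t *
        -((derivative (discr N b a)).eval (gapPoint N b a k t) *
          gapWeight N b a k (gapPoint N b a k t))) := fun t => by
    rw [eval_mul, eval_X]; ring
  simp only [h₁, intervalIntegral.integral_neg, hparts, neg_neg]
  exact intervalIntegral.integral_congr fun t _ => mul_comm _ _

theorem action_nonneg (hN : 2 ≤ N) (ha : ∀ k, 0 < a k) {k : ℕ} (hk₁ : 1 ≤ k)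
    (hk₂ : k ≤ N - 1) : 0 ≤ action N b a k := by
  have h := action_eq_integral_arcosh b a hN ha hk₁ hk₂
  have h₁ : 0 ≤ Real.pi * action N b a k := by
    rw [h]
    refine intervalIntegral.integral_nonneg (lam_even_le_odd b a hN hk₁ hk₂) fun x hx => ?_
    have := two_le_sign_mul_discr b a hN ha hk₁ hk₂ hx
    exact Real.arcosh_nonneg (by linarith)
  exact nonneg_of_mul_nonneg_right h₁ Real.pi_pos

end Actions

/-! ### The normalized differentials -/

section Psi

variable {N : ℕ} (b a : ZMod N → ℝ)

theorem isPsi_iff (hN : 2 ≤ N) (ha : ∀ k, 0 < a k) (n : ℕ) (p : ℝ[X]) :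
    IsPsi N b a n p ↔ p.natDegree ≤ N - 2 ∧ ∀ k ∈ Finset.Icc 1 (N - 1),
      period N b a k p = if k = n then 1 else 0 := by
  unfold IsPsi
  refine and_congr_right fun _ => forall₂_congr fun k hk => ?_
  obtain ⟨hk₁, hk₂⟩ := Finset.mem_Icc.1 hk
  rw [gapContourIntegral_div_canonicalRoot b a hN ha hk₁ hk₂ p, ← period]
  split_ifs
  · exact_mod_cast Iff.rfl
  · exact_mod_cast Iff.rfl

theorem period_sum (hN : 2 ≤ N) (ha : ∀ k, 0 < a k) {k : ℕ} (hk₁ : 1 ≤ k) (hk₂ : k ≤ N - 1)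
    {ι : Type*} (s : Finset ι) (c : ι → ℝ) (p : ι → ℝ[X]) :
    period N b a k (∑ i ∈ s, C (c i) * p i) = ∑ i ∈ s, c i * period N b a k (p i) := by
  have hW := continuous_gapWeight_right b a hN ha hk₁ hk₂
  have hx := continuous_gapPoint_right b a k
  have h : ∀ t, (∑ i ∈ s, C (c i) * p i).eval (gapPoint N b a k t) *
      gapWeight N b a k (gapPoint N b a k t) = ∑ i ∈ s, c i * ((p i).eval (gapPoint N b a k t) *
        gapWeight N b a k (gapPoint N b a k t)) := fun t => by
    simp only [eval_finsetSum, eval_mul, eval_C, Finset.sum_mul, mul_assoc]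
  unfold period
  simp only [h]
  have hc : ∀ i ∈ s, IntervalIntegrable (fun t => c i * ((p i).eval (gapPoint N b a k t) *
      gapWeight N b a k (gapPoint N b a k t))) MeasureTheory.volume 0 Real.pi := fun i _ =>
    Continuous.intervalIntegrable (continuous_const.mul (((p i).continuous.comp hx).mul hW)) _ _
  rw [intervalIntegral.integral_finsetSum hc, Finset.mul_sum]
  refine Finset.sum_congr rfl fun i _ => ?_
  rw [intervalIntegral.integral_const_mul]
  ring

/-- A polynomial with vanishing `k`-th period has a zero in the `k`-th gap. -/
theorem exists_zero_of_period_eq_zero (hN : 2 ≤ N) (ha : ∀ k, 0 < a k) {k : ℕ} (hk₁ : 1 ≤ k)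
    (hk₂ : k ≤ N - 1) {p : ℝ[X]} (hp : period N b a k p = 0) :
    ∃ x ∈ Set.Icc (lam N b a (2 * k)) (lam N b a (2 * k + 1)), p.eval x = 0 := by
  have hW := continuous_gapWeight_right b a hN ha hk₁ hk₂
  have hx := continuous_gapPoint_right b a k
  have hmem := fun t => gapPoint_mem b a hN hk₁ hk₂ t
  set f : ℝ → ℝ := fun t => p.eval (gapPoint N b a k t) * gapWeight N b a k (gapPoint N b a k t)
  have hf : Continuous f := (p.continuous.comp hx).mul hW
  have hint : ∫ t in (0)..Real.pi, f t = 0 :=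
    (mul_eq_zero.1 hp).resolve_left (one_div_ne_zero Real.pi_ne_zero)
  obtain ⟨t, -, ht⟩ : ∃ t ∈ Set.Icc 0 Real.pi, f t = 0 := by
    by_contra! h
    have hc : ∀ t ∈ Set.Icc 0 Real.pi, 0 < f 0 * f t := by
      intro t ht
      have h0 : (0 : ℝ) ∈ Set.Icc 0 Real.pi := ⟨le_rfl, Real.pi_pos.le⟩
      by_contra! hle
      rcases (h 0 h0).lt_or_gt with h₁ | h₁
      · obtain ⟨z, hz, hz0⟩ := isPreconnected_Icc.intermediate_value h0 ht hf.continuousOn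
          (show (0 : ℝ) ∈ Set.Icc _ _ from ⟨h₁.le, by by_contra! h₂; nlinarith⟩)
        exact h z hz hz0
      · obtain ⟨z, hz, hz0⟩ := isPreconnected_Icc.intermediate_value ht h0 hf.continuousOn
          (show (0 : ℝ) ∈ Set.Icc _ _ from ⟨by by_contra! h₂; nlinarith, h₁.le⟩)
        exact h z hz hz0
    have hi : IntervalIntegrable (fun t => f 0 * f t) MeasureTheory.volume 0 Real.pi :=
      (continuous_const.mul hf).intervalIntegrable _ _
    have hpos := intervalIntegral.intervalIntegral_pos_of_pos_on hi
      (fun t ht => hc t (Set.Ioo_subset_Icc_self ht)) Real.pi_pos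
    rw [intervalIntegral.integral_const_mul, hint, mul_zero] at hpos
    exact lt_irrefl _ hpos
  exact ⟨_, hmem t, (mul_eq_zero.1 ht).resolve_right
    (right_ne_zero_of_mul (sign_gapWeight b a hN ha hk₁ hk₂ (hmem t)).ne')⟩

/-- A polynomial of degree at most `N - 2` is determined by its `N - 1` periods: if they all vanish,
it has a zero in each of the disjoint gaps. -/
theorem eq_zero_of_period_eq_zero (hN : 2 ≤ N) (ha : ∀ k, 0 < a k) {p : ℝ[X]}
    (hd : p.natDegree ≤ N - 2) (hp : ∀ k ∈ Finset.Icc 1 (N - 1), period N b a k p = 0) : p = 0 := by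
  have h : ∀ k : Fin (N - 1), ∃ x ∈ Set.Icc (lam N b a (2 * (k.val + 1)))
      (lam N b a (2 * (k.val + 1) + 1)), p.eval x = 0 := fun k =>
    exists_zero_of_period_eq_zero b a hN ha (by omega) (by omega)
      (hp _ (Finset.mem_Icc.2 ⟨by omega, by omega⟩))
  choose x hx hx0 using h
  have hmono : StrictMono x := fun i j hij =>
    (hx i).2.trans_lt ((lam_gap_lt_gap b a hN ha (by omega)
      (Nat.succ_lt_succ (show i.val < j.val from hij)) (by omega)).trans_le (hx j).1)
  exact eq_zero_of_natDegree_lt_card_of_eval_eq_zero p hmono.injective hx0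
    (by rw [Fintype.card_fin]; omega)

/-- The matrix of periods of the monomials. -/
def periodMatrix (N : ℕ) (b a : ZMod N → ℝ) : Matrix (Fin (N - 1)) (Fin (N - 1)) ℝ :=
  Matrix.of fun k j => period N b a (k.val + 1) (X ^ j.val)

/-- The polynomial of degree at most `N - 2` with given coefficients. -/
def ofCoeffs (N : ℕ) (c : Fin (N - 1) → ℝ) : ℝ[X] := ∑ j : Fin (N - 1), C (c j) * X ^ j.val

theorem natDegree_ofCoeffs_le (hN : 2 ≤ N) (c : Fin (N - 1) → ℝ) :
    (ofCoeffs N c).natDegree ≤ N - 2 :=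
  natDegree_sum_le_of_forall_le _ _ fun j _ => (natDegree_C_mul_X_pow_le _ _).trans (by omega)

theorem coeff_ofCoeffs (c : Fin (N - 1) → ℝ) (j : Fin (N - 1)) :
    (ofCoeffs N c).coeff j.val = c j := by
  simp only [ofCoeffs, finsetSum_coeff, coeff_C_mul_X_pow, ← Fin.ext_iff]
  simp

theorem period_ofCoeffs (hN : 2 ≤ N) (ha : ∀ k, 0 < a k) (c : Fin (N - 1) → ℝ) (k : Fin (N - 1)) :
    period N b a (k.val + 1) (ofCoeffs N c) = (periodMatrix N b a).mulVec c k := by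
  rw [ofCoeffs, period_sum b a hN ha (by omega) (by omega), Matrix.mulVec, dotProduct]
  exact Finset.sum_congr rfl fun j _ => mul_comm _ _

theorem periodMatrix_det_ne_zero (hN : 2 ≤ N) (ha : ∀ k, 0 < a k) :
    (periodMatrix N b a).det ≠ 0 := by
  intro h
  obtain ⟨c, hc, h0⟩ := Matrix.exists_mulVec_eq_zero_iff.2 h
  refine hc (funext fun j => ?_)
  have hz : ofCoeffs N c = 0 := by
    refine eq_zero_of_period_eq_zero b a hN ha (natDegree_ofCoeffs_le hN c) fun k hk => ?_
    obtain ⟨hk₁, hk₂⟩ := Finset.mem_Icc.1 hk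
    have := period_ofCoeffs b a hN ha c ⟨k - 1, by omega⟩
    rw [h0] at this
    simpa [Nat.sub_add_cancel hk₁] using this
  rw [← coeff_ofCoeffs c j, hz, coeff_zero, Pi.zero_apply]

/-- `ψ_n` through the inverse of the period matrix. -/
theorem psi_eq (hN : 2 ≤ N) (ha : ∀ k, 0 < a k) (n : Fin (N - 1)) :
    IsPsi N b a (n.val + 1) (psi N b a (n.val + 1)) ∧
      psi N b a (n.val + 1) = ofCoeffs N fun j => (periodMatrix N b a)⁻¹ j n := by
  have hdet := periodMatrix_det_ne_zero b a hN ha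
  have hex : IsPsi N b a (n.val + 1) (ofCoeffs N fun j => (periodMatrix N b a)⁻¹ j n) := by
    rw [isPsi_iff b a hN ha]
    refine ⟨natDegree_ofCoeffs_le hN _, fun k hk => ?_⟩
    obtain ⟨hk₁, hk₂⟩ := Finset.mem_Icc.1 hk
    have h := period_ofCoeffs b a hN ha (fun j => (periodMatrix N b a)⁻¹ j n) ⟨k - 1, by omega⟩
    have hmul := congrFun (congrFun (Matrix.mul_nonsing_inv (periodMatrix N b a)
      (isUnit_iff_ne_zero.2 hdet)) ⟨k - 1, by omega⟩) n
    simp only [Nat.sub_add_cancel hk₁] at h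
    rw [h, Matrix.mulVec, dotProduct]
    rw [Matrix.mul_apply] at hmul
    rw [hmul, Matrix.one_apply]
    refine if_congr ?_ rfl rfl
    rw [Fin.ext_iff]
    simp only
    omega
  have hpsi : IsPsi N b a (n.val + 1) (psi N b a (n.val + 1)) := Classical.epsilon_spec ⟨_, hex⟩
  refine ⟨hpsi, sub_eq_zero.1 (eq_zero_of_period_eq_zero b a hN ha ?_ fun k hk => ?_)⟩
  · exact (natDegree_sub_le _ _).trans (max_le hpsi.1 hex.1)
  · obtain ⟨hk₁, hk₂⟩ := Finset.mem_Icc.1 hk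
    have h₁ := ((isPsi_iff b a hN ha _ _).1 hpsi).2 k hk
    have h₂ := ((isPsi_iff b a hN ha _ _).1 hex).2 k hk
    have h := period_sum b a hN ha hk₁ hk₂ Finset.univ ![1, -1]
      ![psi N b a (n.val + 1), ofCoeffs N fun j => (periodMatrix N b a)⁻¹ j n]
    simp only [Fin.sum_univ_two, Matrix.cons_val_zero, Matrix.cons_val_one] at h
    rw [h₁, h₂] at h
    rw [sub_eq_add_neg]
    convert h using 1
    · simp
    · ring

theorem period_psi (hN : 2 ≤ N) (ha : ∀ k, 0 < a k) {n k : ℕ} (hn₁ : 1 ≤ n) (hn₂ : n ≤ N - 1)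
    (hk₁ : 1 ≤ k) (hk₂ : k ≤ N - 1) :
    period N b a k (psi N b a n) = if k = n then 1 else 0 := by
  have h := ((isPsi_iff b a hN ha _ _).1 (psi_eq b a hN ha ⟨n - 1, by omega⟩).1).2 k
    (Finset.mem_Icc.2 ⟨hk₁, hk₂⟩)
  simpa only [Nat.sub_add_cancel hn₁] using h

end Psi

section PsiContinuity

variable {N : ℕ}

theorem continuous_periodMatrix (hN : 2 ≤ N) :
    Continuous fun p : PhaseSpace N => periodMatrix N p.1 (aSeq p) := by
  refine continuous_matrix fun k j => ?_
  simp only [periodMatrix, Matrix.of_apply, period, eval_pow, eval_X]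
  have hx := continuous_gapPoint (N := N) hN (k := k.val + 1) (by omega) (by omega)
  exact continuous_const.mul
    (intervalIntegral.continuous_parametric_intervalIntegral_of_continuous'
      ((hx.pow j.val).mul (continuous_gapWeight hN (by omega) (by omega))) _ _)

theorem continuous_eval_psi (hN : 2 ≤ N) {n : ℕ} (hn₁ : 1 ≤ n) (hn₂ : n ≤ N - 1) :
    Continuous fun q : PhaseSpace N × ℝ => (psi N q.1.1 (aSeq q.1) n).eval q.2 := by
  have h : ∀ q : PhaseSpace N × ℝ, (psi N q.1.1 (aSeq q.1) n).eval q.2 =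
      ∑ j : Fin (N - 1), (periodMatrix N q.1.1 (aSeq q.1))⁻¹ j ⟨n - 1, by omega⟩ * q.2 ^ j.val := by
    intro q
    have h := (psi_eq q.1.1 (aSeq q.1) hN (aSeq_pos q.1) ⟨n - 1, by omega⟩).2
    simp only [Nat.sub_add_cancel hn₁] at h
    rw [h, ofCoeffs]
    simp [eval_finsetSum]
  simp only [h, Matrix.inv_def, Ring.inverse_eq_inv', Matrix.smul_apply, smul_eq_mul]
  have hA := (continuous_periodMatrix (N := N) hN).comp (continuous_fst (Y := ℝ))
  refine continuous_finsetSum _ fun j _ => Continuous.mul (Continuous.mul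
    (hA.matrix_det.inv₀ fun q => periodMatrix_det_ne_zero _ _ hN (aSeq_pos q.1)) ?_)
    (continuous_snd.pow _)
  exact hA.matrix_adjugate.matrix_elem _ _

end PsiContinuity

/-! ### Angles -/

section Angles

variable {N : ℕ} (b a : ZMod N → ℝ)

/-- The density of `ψ_n dλ / √(Δ² - 4)`, with the positive root, in the parametrization `gapPoint`
of the `k`-th gap. -/
def gapDensity (N : ℕ) (b a : ZMod N → ℝ) (n k : ℕ) (s : ℝ) : ℝ :=
  (psi N b a n).eval (gapPoint N b a k s) * |gapWeight N b a k (gapPoint N b a k s)|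

/-- The integral of `ψ_n dλ / √(Δ² - 4)`, with the positive root, over the part `[0, t]` of the
`k`-th gap in the parametrization `gapPoint`. -/
def partialPeriod (N : ℕ) (b a : ZMod N → ℝ) (n k : ℕ) (t : ℝ) : ℝ :=
  ∫ s in (0)..t, gapDensity N b a n k s

/-- The parameter of the Dirichlet eigenvalue `μ_k` in its gap, if that gap is open. (If it is
collapsed, the quotient is `0` and the value is `π / 2`.) -/
def muParam (N : ℕ) (b a : ZMod N → ℝ) (k : ℕ) : ℝ :=
  Real.arccos ((mid N b a k - mu N b a k) / (gap N b a k / 2))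

theorem gapPoint_muParam (hN : 2 ≤ N) (ha : ∀ k, 0 < a k) {k : ℕ} (hk₁ : 1 ≤ k) (hk₂ : k ≤ N - 1)
    (hg : 0 < gap N b a k) : gapPoint N b a k (muParam N b a k) = mu N b a k := by
  have hm := mu_mem_gap b a hN ha hk₁ hk₂
  rw [← mid_sub_gap, ← mid_add_gap] at hm
  rw [gapPoint, muParam, Real.cos_arccos, mul_div_cancel₀ _ (by positivity), sub_sub_cancel]
  · rw [le_div_iff₀ (by positivity)]; linarith [hm.2]
  · rw [div_le_iff₀ (by positivity)]; linarith [hm.1]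

theorem sheetSign_eq_one_or (k : ℕ) : sheetSign N b a k = 1 ∨ sheetSign N b a k = -1 := by
  unfold sheetSign; split_ifs <;> simp

theorem gapPoint_strictMonoOn {k : ℕ} (hg : 0 < gap N b a k) :
    StrictMonoOn (gapPoint N b a k) (Set.Icc 0 Real.pi) := by
  intro s hs t ht hst
  have := Real.strictAntiOn_cos hs ht hst
  simp only [gapPoint]
  nlinarith

theorem abelianIntegral_eq (hN : 2 ≤ N) (ha : ∀ k, 0 < a k) (n : ℕ) {k : ℕ} (hk₁ : 1 ≤ k)
    (hk₂ : k ≤ N - 1) (hg : 0 < gap N b a k) :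
    abelianIntegral N b a n k =
      sheetSign N b a k * partialPeriod N b a n k (muParam N b a k) := by
  have hm := mu_mem_gap b a hN ha hk₁ hk₂
  have ht0 : 0 ≤ muParam N b a k := Real.arccos_nonneg _
  have ht1 : muParam N b a k ≤ Real.pi := Real.arccos_le_pi _
  have hmu := gapPoint_muParam b a hN ha hk₁ hk₂ hg
  have hmono := gapPoint_strictMonoOn b a hg
  set τ := muParam N b a k
  have himage : gapPoint N b a k '' Set.Ioo 0 τ = Set.Ioo (lam N b a (2 * k)) (mu N b a k) := by
    refine Set.Subset.antisymm ?_ ?_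
    · rintro _ ⟨t, ht, rfl⟩
      rw [← gapPoint_zero, ← hmu]
      exact ⟨hmono ⟨le_rfl, Real.pi_pos.le⟩ ⟨ht.1.le, ht.2.le.trans ht1⟩ ht.1,
        hmono ⟨ht.1.le, ht.2.le.trans ht1⟩ ⟨ht0, ht1⟩ ht.2⟩
    · rw [← gapPoint_zero, ← hmu]
      exact intermediate_value_Ioo ht0 (continuous_gapPoint_right b a k).continuousOn
  have hinj : Set.InjOn (gapPoint N b a k) (Set.Ioo 0 τ) :=
    hmono.injOn.mono (Set.Ioo_subset_Icc_self.trans (Set.Icc_subset_Icc_right ht1))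
  rw [abelianIntegral, partialPeriod, intervalIntegral.integral_of_le hm.1,
    intervalIntegral.integral_of_le ht0, MeasureTheory.integral_Ioc_eq_integral_Ioo,
    MeasureTheory.integral_Ioc_eq_integral_Ioo, ← himage,
    MeasureTheory.integral_image_eq_integral_abs_deriv_smul measurableSet_Ioo
      (fun t _ => (hasDerivAt_gapPoint b a k t).hasDerivWithinAt) hinj,
    ← MeasureTheory.integral_const_mul]
  refine MeasureTheory.setIntegral_congr_fun measurableSet_Ioo fun t ht => ?_
  have hsin := Real.sin_pos_of_pos_of_lt_pi ht.1 (ht.2.trans_le ht1)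
  have hsq := abs_gapWeight_mul_sqrt b a hN ha hk₁ hk₂ hsin.le
  have hpos : 0 < gap N b a k / 2 * Real.sin t := by positivity
  simp only [smul_eq_mul, gapDensity]
  rw [abs_of_pos hpos, ← hsq]
  rw [← hsq] at hpos
  have hne := right_ne_zero_of_mul hpos.ne'
  rcases sheetSign_eq_one_or b a k with h | h <;> rw [h] <;> field_simp

theorem abelianIntegral_eq_zero (hN : 2 ≤ N) (ha : ∀ k, 0 < a k) (n : ℕ) {k : ℕ} (hk₁ : 1 ≤ k)
    (hk₂ : k ≤ N - 1) (hg : gap N b a k = 0) : abelianIntegral N b a n k = 0 := by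
  have hm := mu_mem_gap b a hN ha hk₁ hk₂
  have h : mu N b a k = lam N b a (2 * k) := by
    rw [gap] at hg
    exact le_antisymm (by linarith [hm.2]) hm.1
  rw [abelianIntegral, h, intervalIntegral.integral_same]

/-- The integral of `ψ_n dλ / √(Δ² - 4)` over a whole gap is `0` or `± π`, by the normalization of
`ψ_n`. -/
theorem sin_partialPeriod_pi (hN : 2 ≤ N) (ha : ∀ k, 0 < a k) {n k : ℕ} (hn₁ : 1 ≤ n)
    (hn₂ : n ≤ N - 1) (hk₁ : 1 ≤ k) (hk₂ : k ≤ N - 1) :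
    Real.sin (partialPeriod N b a n k Real.pi) = 0 := by
  have h := period_psi b a hN ha hn₁ hn₂ hk₁ hk₂
  have he : partialPeriod N b a n k Real.pi =
      (-1) ^ (N - 1 - k) * (Real.pi * period N b a k (psi N b a n)) := by
    rw [period, ← mul_assoc Real.pi, mul_one_div_cancel Real.pi_ne_zero, one_mul, partialPeriod,
      ← intervalIntegral.integral_const_mul]
    refine intervalIntegral.integral_congr fun t _ => ?_
    rw [gapDensity, abs_gapWeight b a hN ha hk₁ hk₂ (gapPoint_mem b a hN hk₁ hk₂ t)]
    ring
  rw [he, h]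
  rcases neg_one_pow_eq_or ℝ (N - 1 - k) with hs | hs <;> rw [hs] <;> split_ifs <;> simp

/-- If `μ_k^*` is a branch point, then `μ_k` is an end of the gap, and a half period is reached. -/
theorem sin_partialPeriod_eq_zero (hN : 2 ≤ N) (ha : ∀ k, 0 < a k) {n k : ℕ} (hn₁ : 1 ≤ n)
    (hn₂ : n ≤ N - 1) (hk₁ : 1 ≤ k) (hk₂ : k ≤ N - 1) (hg : 0 < gap N b a k)
    (hd : (y₁ N b a N).eval (mu N b a k) - (y₂ N b a (N + 1)).eval (mu N b a k) = 0) :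
    Real.sin (partialPeriod N b a n k (muParam N b a k)) = 0 := by
  have h := discr_sq_sub_four_mu b a hN ha (n := k - 1) (by omega)
  rw [Nat.sub_add_cancel hk₁, hd] at h
  have hP := gapWeight_sq_mul b a hN ha hk₁ hk₂ (mu_mem_gap b a hN ha hk₁ hk₂)
  rw [h, sq (0 : ℝ), mul_zero, mul_zero, ← mid_sub_gap, ← mid_add_gap] at hP
  rcases mul_eq_zero.1 hP.symm with h | h
  · have : muParam N b a k = 0 := by
      rw [muParam, show mid N b a k - mu N b a k = gap N b a k / 2 by linarith,
        div_self (by positivity), Real.arccos_one]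
    rw [this, partialPeriod, intervalIntegral.integral_same, Real.sin_zero]
  · have : muParam N b a k = Real.pi := by
      rw [muParam, show mid N b a k - mu N b a k = -(gap N b a k / 2) by linarith,
        neg_div, div_self (by positivity), Real.arccos_neg_one]
    rw [this, sin_partialPeriod_pi b a hN ha hn₁ hn₂ hk₁ hk₂]

end Angles

section AngleContinuity

open Filter Topology

variable {N : ℕ}

theorem continuous_gapDensity (hN : 2 ≤ N) {n k : ℕ} (hn₁ : 1 ≤ n) (hn₂ : n ≤ N - 1)
    (hk₁ : 1 ≤ k) (hk₂ : k ≤ N - 1) : Continuous fun q : PhaseSpace N × ℝ =>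
      gapDensity N q.1.1 (aSeq q.1) n k q.2 := by
  unfold gapDensity
  exact ((continuous_eval_psi hN hn₁ hn₂).comp
    (continuous_fst.prodMk (continuous_gapPoint hN hk₁ hk₂))).mul
      (continuous_gapWeight hN hk₁ hk₂).abs

theorem continuous_partialPeriod (hN : 2 ≤ N) {n k : ℕ} (hn₁ : 1 ≤ n) (hn₂ : n ≤ N - 1)
    (hk₁ : 1 ≤ k) (hk₂ : k ≤ N - 1) : Continuous fun q : PhaseSpace N × ℝ =>
      partialPeriod N q.1.1 (aSeq q.1) n k q.2 := by
  unfold partialPeriod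
  exact intervalIntegral.continuous_parametric_intervalIntegral_of_continuous
    (f := fun (q : PhaseSpace N × ℝ) s => gapDensity N q.1.1 (aSeq q.1) n k s)
    ((continuous_gapDensity hN hn₁ hn₂ hk₁ hk₂).comp
      ((continuous_fst.comp continuous_fst).prodMk continuous_snd)) continuous_snd

theorem continuousAt_muParam (hN : 2 ≤ N) {k : ℕ} (hk₁ : 1 ≤ k) (hk₂ : k ≤ N - 1)
    {p₀ : PhaseSpace N} (hg : 0 < gap N p₀.1 (aSeq p₀) k) :
    ContinuousAt (fun p : PhaseSpace N => muParam N p.1 (aSeq p) k) p₀ := by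
  unfold muParam
  refine Real.continuous_arccos.continuousAt.comp
    (((continuous_mid hN hk₁ hk₂).sub (continuous_mu hN hk₁ hk₂)).continuousAt.div
      ((continuous_gap hN hk₁ hk₂).div_const 2).continuousAt ?_)
  positivity

theorem continuous_sheet (hN : 2 ≤ N) {k : ℕ} (hk₁ : 1 ≤ k) (hk₂ : k ≤ N - 1) :
    Continuous fun p : PhaseSpace N => (y₁ N p.1 (aSeq p) N).eval (mu N p.1 (aSeq p) k) -
      (y₂ N p.1 (aSeq p) (N + 1)).eval (mu N p.1 (aSeq p) k) := by
  have h₁ := (continuous_aeval_solution (N := N) ℝ 1 0 N).1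
  have h₂ := (continuous_aeval_solution (N := N) ℝ 0 1 N).2
  simp only [coe_aeval_eq_eval] at h₁ h₂
  have hm := continuous_id.prodMk (continuous_mu (N := N) hN hk₁ hk₂)
  exact (h₁.comp hm).sub (h₂.comp hm)

theorem continuous_gapDensity_right (b a : ZMod N → ℝ) (hN : 2 ≤ N) (ha : ∀ k, 0 < a k) (n : ℕ)
    {k : ℕ} (hk₁ : 1 ≤ k) (hk₂ : k ≤ N - 1) : Continuous (gapDensity N b a n k) :=
  ((psi N b a n).continuous.comp (continuous_gapPoint_right b a k)).mul
    (continuous_gapWeight_right b a hN ha hk₁ hk₂).abs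

theorem abs_abelianIntegral_le (b a : ZMod N → ℝ) (hN : 2 ≤ N) (ha : ∀ k, 0 < a k) (n : ℕ)
    {k : ℕ} (hk₁ : 1 ≤ k) (hk₂ : k ≤ N - 1) :
    |abelianIntegral N b a n k| ≤ ∫ s in (0)..Real.pi, |gapDensity N b a n k s| := by
  rcases (gap_nonneg b a hN hk₁ hk₂).eq_or_lt with h | h
  · rw [abelianIntegral_eq_zero _ _ hN ha n hk₁ hk₂ h.symm, abs_zero]
    exact intervalIntegral.integral_nonneg Real.pi_pos.le fun _ _ => abs_nonneg _
  · have ht0 : 0 ≤ muParam N b a k := Real.arccos_nonneg _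
    have ht1 : muParam N b a k ≤ Real.pi := Real.arccos_le_pi _
    have hs : |sheetSign N b a k| = 1 := by
      rcases sheetSign_eq_one_or b a k with h | h <;> rw [h] <;> simp
    rw [abelianIntegral_eq _ _ hN ha n hk₁ hk₂ h, abs_mul, hs, one_mul, partialPeriod]
    refine (intervalIntegral.abs_integral_le_integral_abs ht0).trans ?_
    exact intervalIntegral.integral_mono_interval le_rfl ht0 ht1
      (Eventually.of_forall fun _ => abs_nonneg _)
      ((continuous_gapDensity_right b a hN ha n hk₁ hk₂).abs.intervalIntegrable _ _)

/-- For `k ≠ n` the `k`-th period of `ψ_n` vanishes, so that `ψ_n` has a zero in the `k`-th gap; if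
the gap is collapsed, this is its only point. -/
theorem gapDensity_eq_zero (b a : ZMod N → ℝ) (hN : 2 ≤ N) (ha : ∀ k, 0 < a k) {n k : ℕ}
    (hn₁ : 1 ≤ n) (hn₂ : n ≤ N - 1) (hk₁ : 1 ≤ k) (hk₂ : k ≤ N - 1) (hkn : k ≠ n)
    (hg : gap N b a k = 0) (s : ℝ) : gapDensity N b a n k s = 0 := by
  have hper := period_psi b a hN ha hn₁ hn₂ hk₁ hk₂
  rw [if_neg hkn] at hper
  obtain ⟨x, hx, hx0⟩ := exists_zero_of_period_eq_zero b a hN ha hk₁ hk₂ hper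
  have hs := gapPoint_mem b a hN hk₁ hk₂ s
  rw [gap] at hg
  have : gapPoint N b a k s = x := by
    refine le_antisymm ?_ ?_ <;> linarith [hx.1, hx.2, hs.1, hs.2]
  rw [gapDensity, this, hx0, zero_mul]

theorem continuousAt_abelianIntegral_of_gap_eq_zero (hN : 2 ≤ N) {n k : ℕ} (hn₁ : 1 ≤ n)
    (hn₂ : n ≤ N - 1) (hk₁ : 1 ≤ k) (hk₂ : k ≤ N - 1) (hkn : k ≠ n) {p₀ : PhaseSpace N}
    (hg : gap N p₀.1 (aSeq p₀) k = 0) :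
    ContinuousAt (fun p : PhaseSpace N => abelianIntegral N p.1 (aSeq p) n k) p₀ := by
  have hM : Continuous fun p : PhaseSpace N =>
      ∫ s in (0)..Real.pi, |gapDensity N p.1 (aSeq p) n k s| :=
    intervalIntegral.continuous_parametric_intervalIntegral_of_continuous'
      (f := fun (p : PhaseSpace N) s => |gapDensity N p.1 (aSeq p) n k s|)
      (continuous_gapDensity hN hn₁ hn₂ hk₁ hk₂).abs _ _
  have h0 : ∀ s, gapDensity N p₀.1 (aSeq p₀) n k s = 0 :=
    gapDensity_eq_zero p₀.1 (aSeq p₀) hN (aSeq_pos p₀) hn₁ hn₂ hk₁ hk₂ hkn hg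
  have hM0 := hM.tendsto p₀
  simp only [h0, abs_zero, intervalIntegral.integral_zero] at hM0
  rw [ContinuousAt, abelianIntegral_eq_zero _ _ hN (aSeq_pos p₀) n hk₁ hk₂ hg]
  exact squeeze_zero_norm
    (fun p => abs_abelianIntegral_le p.1 (aSeq p) hN (aSeq_pos p) n hk₁ hk₂) hM0

/-- Every summand of the angle `θ_n` is continuous modulo `2π`, except where the `n`-th gap is
collapsed. When `μ_k^*` passes through a branch point, the sign of the sheet changes, but there the
integral is a multiple of `π`. -/
theorem continuousAt_abelianIntegral (hN : 2 ≤ N) {n k : ℕ} (hn₁ : 1 ≤ n) (hn₂ : n ≤ N - 1)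
    (hk₁ : 1 ≤ k) (hk₂ : k ≤ N - 1) {p₀ : PhaseSpace N} (hg : gap N p₀.1 (aSeq p₀) n ≠ 0) :
    ContinuousAt (fun p : PhaseSpace N => Real.cos (abelianIntegral N p.1 (aSeq p) n k)) p₀ ∧
    ContinuousAt (fun p : PhaseSpace N => Real.sin (abelianIntegral N p.1 (aSeq p) n k)) p₀ := by
  rcases (gap_nonneg p₀.1 (aSeq p₀) hN hk₁ hk₂).eq_or_lt with h | h
  · have hkn : k ≠ n := by rintro rfl; exact hg h.symm
    have hc := continuousAt_abelianIntegral_of_gap_eq_zero hN hn₁ hn₂ hk₁ hk₂ hkn h.symm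
    exact ⟨Real.continuous_cos.continuousAt.comp hc, Real.continuous_sin.continuousAt.comp hc⟩
  have hev : ∀ᶠ p : PhaseSpace N in 𝓝 p₀, abelianIntegral N p.1 (aSeq p) n k =
      sheetSign N p.1 (aSeq p) k *
        partialPeriod N p.1 (aSeq p) n k (muParam N p.1 (aSeq p) k) := by
    filter_upwards [continuousAt_const.eventually_lt (continuous_gap hN hk₁ hk₂).continuousAt h]
      with p hp
    exact abelianIntegral_eq _ _ hN (aSeq_pos p) n hk₁ hk₂ hp
  have hΦ : ContinuousAt (fun p : PhaseSpace N =>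
      partialPeriod N p.1 (aSeq p) n k (muParam N p.1 (aSeq p) k)) p₀ :=
    ContinuousAt.comp (f := fun p : PhaseSpace N => (p, muParam N p.1 (aSeq p) k))
      (continuous_partialPeriod hN hn₁ hn₂ hk₁ hk₂).continuousAt
      (continuousAt_id.prodMk (continuousAt_muParam hN hk₁ hk₂ h))
  have hcos : ∀ p : PhaseSpace N, Real.cos (sheetSign N p.1 (aSeq p) k *
      partialPeriod N p.1 (aSeq p) n k (muParam N p.1 (aSeq p) k)) =
        Real.cos (partialPeriod N p.1 (aSeq p) n k (muParam N p.1 (aSeq p) k)) := fun p => by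
    rcases sheetSign_eq_one_or p.1 (aSeq p) k with h | h <;> rw [h] <;> simp
  have hsin : ∀ p : PhaseSpace N, Real.sin (sheetSign N p.1 (aSeq p) k *
      partialPeriod N p.1 (aSeq p) n k (muParam N p.1 (aSeq p) k)) = sheetSign N p.1 (aSeq p) k *
        Real.sin (partialPeriod N p.1 (aSeq p) n k (muParam N p.1 (aSeq p) k)) := fun p => by
    rcases sheetSign_eq_one_or p.1 (aSeq p) k with h | h <;> rw [h] <;> simp
  constructor
  · refine (Real.continuous_cos.continuousAt.comp hΦ).congr ?_
    filter_upwards [hev] with p hp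
    rw [hp, hcos]
    rfl
  · have hsΦ := Real.continuous_sin.continuousAt.comp hΦ
    suffices hs : ContinuousAt (fun p : PhaseSpace N => sheetSign N p.1 (aSeq p) k *
        Real.sin (partialPeriod N p.1 (aSeq p) n k (muParam N p.1 (aSeq p) k))) p₀ by
      refine hs.congr ?_
      filter_upwards [hev] with p hp
      rw [hp, hsin]
    have hd := continuous_sheet (N := N) hN hk₁ hk₂
    rcases lt_trichotomy ((y₁ N p₀.1 (aSeq p₀) N).eval (mu N p₀.1 (aSeq p₀) k) -
      (y₂ N p₀.1 (aSeq p₀) (N + 1)).eval (mu N p₀.1 (aSeq p₀) k)) 0 with h₀ | h₀ | h₀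
    · refine (continuousAt_const.mul hsΦ (x := p₀) (f := fun _ => (-1 : ℝ))).congr ?_
      filter_upwards [hd.continuousAt.eventually_lt continuousAt_const h₀] with p hp
      rw [sheetSign, if_pos hp]
      rfl
    · have h0 := sin_partialPeriod_eq_zero p₀.1 (aSeq p₀) hN (aSeq_pos p₀) hn₁ hn₂ hk₁ hk₂ h h₀
      rw [ContinuousAt, h0, mul_zero]
      refine squeeze_zero_norm (a := fun p : PhaseSpace N =>
        ‖Real.sin (partialPeriod N p.1 (aSeq p) n k (muParam N p.1 (aSeq p) k))‖) (fun p => ?_) ?_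
      · rcases sheetSign_eq_one_or p.1 (aSeq p) k with h | h <;> rw [h] <;> simp
      · have := hsΦ.norm
        rw [ContinuousAt] at this
        simpa only [Function.comp, h0, norm_zero] using this
    · refine (continuousAt_const.mul hsΦ (x := p₀) (f := fun _ => (1 : ℝ))).congr ?_
      filter_upwards [continuousAt_const.eventually_lt hd.continuousAt h₀] with p hp
      rw [sheetSign, if_neg hp.not_gt]
      rfl

theorem continuousAt_cos_sin_sum {T ι : Type*} [TopologicalSpace T] {x₀ : T} (s : Finset ι)
    {f : ι → T → ℝ} (h : ∀ i ∈ s, ContinuousAt (fun x => Real.cos (f i x)) x₀ ∧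
      ContinuousAt (fun x => Real.sin (f i x)) x₀) :
    ContinuousAt (fun x => Real.cos (∑ i ∈ s, f i x)) x₀ ∧
      ContinuousAt (fun x => Real.sin (∑ i ∈ s, f i x)) x₀ := by
  classical
  induction s using Finset.induction_on with
  | empty => simp only [Finset.sum_empty]; exact ⟨continuousAt_const, continuousAt_const⟩
  | insert i s hi ih =>
    obtain ⟨h₁, h₂⟩ := ih fun j hj => h j (Finset.mem_insert_of_mem hj)
    obtain ⟨h₃, h₄⟩ := h i (Finset.mem_insert_self i s)
    simp only [Finset.sum_insert hi, Real.cos_add, Real.sin_add]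
    exact ⟨(h₃.mul h₁).sub (h₄.mul h₂), (h₄.mul h₁).add (h₃.mul h₂)⟩

theorem continuousAt_angle (hN : 2 ≤ N) {n : ℕ} (hn₁ : 1 ≤ n) (hn₂ : n ≤ N - 1)
    {p₀ : PhaseSpace N} (hg : gap N p₀.1 (aSeq p₀) n ≠ 0) :
    ContinuousAt (fun p : PhaseSpace N => Real.cos (angle N p.1 (aSeq p) n)) p₀ ∧
    ContinuousAt (fun p : PhaseSpace N => Real.sin (angle N p.1 (aSeq p) n)) p₀ := by
  have h : ∀ p : PhaseSpace N, angle N p.1 (aSeq p) n =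
      ∑ k ∈ Finset.Icc 1 (N - 1), abelianIntegral N p.1 (aSeq p) n k := fun p => by
    rw [angle, Finset.add_sum_erase _ _ (Finset.mem_Icc.2 ⟨hn₁, hn₂⟩)]
  simp only [h]
  refine continuousAt_cos_sin_sum _ fun k hk => ?_
  obtain ⟨hk₁, hk₂⟩ := Finset.mem_Icc.1 hk
  exact continuousAt_abelianIntegral hN hn₁ hn₂ hk₁ hk₂ hg

theorem continuous_birkhoffCoord (hN : 2 ≤ N) {n : ℕ} (hn₁ : 1 ≤ n) (hn₂ : n ≤ N - 1) :
    Continuous fun p : PhaseSpace N => birkhoffCoord N p.1 (aSeq p) n := by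
  rw [continuous_iff_continuousAt]
  intro p₀
  have hI : Continuous fun p : PhaseSpace N => √(2 * action N p.1 (aSeq p) n) :=
    Real.continuous_sqrt.comp (continuous_const.mul (continuous_action hN hn₁ hn₂))
  by_cases hg : gap N p₀.1 (aSeq p₀) n = 0
  · have h0 : birkhoffCoord N p₀.1 (aSeq p₀) n = 0 := by rw [birkhoffCoord, if_pos hg]; rfl
    rw [ContinuousAt, h0]
    refine squeeze_zero_norm (a := fun p : PhaseSpace N => √(2 * action N p.1 (aSeq p) n))
      (fun p => ?_) ?_
    · have hs := Real.sqrt_nonneg (2 * action N p.1 (aSeq p) n)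
      rw [birkhoffCoord]
      split_ifs
      · simp
      · rw [Prod.norm_def]
        refine max_le ?_ ?_ <;>
        · rw [norm_mul, Real.norm_of_nonneg hs]
          exact mul_le_of_le_one_right hs (by
            rw [Real.norm_eq_abs]
            first
            | exact Real.abs_cos_le_one _
            | exact Real.abs_sin_le_one _)
    · have := hI.tendsto p₀
      rwa [action_eq_zero _ _ hN (aSeq_pos p₀) hn₁ hn₂ hg, mul_zero, Real.sqrt_zero] at this
  · obtain ⟨hc, hs⟩ := continuousAt_angle hN hn₁ hn₂ hg
    refine ((hI.continuousAt.mul hc).prodMk (hI.continuousAt.mul hs)).congr ?_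
    filter_upwards [(continuous_gap hN hn₁ hn₂).continuousAt.eventually_ne hg] with p hp
    rw [birkhoffCoord, if_neg hp]
    rfl

/-- The Birkhoff map is continuous, also where gaps collapse. -/
theorem continuous_birkhoffMap (hN : 2 ≤ N) : Continuous (birkhoffMap N) :=
  (continuous_pi fun i => continuous_birkhoffCoord hN (by omega) (by omega)).prodMk
    (continuous_casimir₁.prodMk (continuous_casimir₂.subtype_mk _))

end AngleContinuity

/-! ### A bound for the length of the spectrum -/

section LogIntegral

theorem intervalIntegrable_log_sub (c s t : ℝ) :
    IntervalIntegrable (fun x => Real.log (x - c)) MeasureTheory.volume s t := by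
  simpa using (intervalIntegral.intervalIntegrable_log' (a := s - c) (b := t - c)).comp_sub_right c

/-- The integral of `log |x - c|` over an interval that contains `c` is smallest if `c` is the
midpoint. -/
theorem le_integral_log_sub {s t c : ℝ} (hc : c ∈ Set.Icc s t) :
    (t - s) * Real.log ((t - s) / 2) - (t - s) ≤ ∫ x in s..t, Real.log (x - c) := by
  rw [intervalIntegral.integral_comp_sub_right (fun x => Real.log x), integral_log]
  have h := Real.convexOn_mul_log.2 (Set.mem_Ici.2 (sub_nonneg.2 hc.1))
    (Set.mem_Ici.2 (sub_nonneg.2 hc.2)) (show (0 : ℝ) ≤ 1 / 2 by norm_num)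
    (show (0 : ℝ) ≤ 1 / 2 by norm_num) (by norm_num)
  simp only [smul_eq_mul] at h
  rw [show (1 / 2 * (c - s) + 1 / 2 * (t - c) : ℝ) = (t - s) / 2 by ring] at h
  rw [← Real.log_neg_eq_log (s - c), neg_sub]
  linarith

end LogIntegral

section SpectralLength

variable {N : ℕ} (b a : ZMod N → ℝ)

/-- Off the spectrum this is `log |Δ² - 4|`, written as a sum of logarithms of linear factors. -/
def logDiscr (N : ℕ) (b a : ZMod N → ℝ) (x : ℝ) : ℝ :=
  -(2 * N * Real.log (casimir₂ N a)) + ∑ i ∈ Finset.range (2 * N), Real.log (x - lam N b a (i + 1))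

theorem intervalIntegrable_sum_log_sub (s t : ℝ) :
    IntervalIntegrable (fun x => ∑ i ∈ Finset.range (2 * N), Real.log (x - lam N b a (i + 1)))
      MeasureTheory.volume s t := by
  simpa only [Finset.sum_fn] using IntervalIntegrable.sum (Finset.range (2 * N))
    (f := fun i x => Real.log (x - lam N b a (i + 1))) fun i _ => intervalIntegrable_log_sub _ s t

theorem intervalIntegrable_logDiscr (s t : ℝ) :
    IntervalIntegrable (logDiscr N b a) MeasureTheory.volume s t :=
  intervalIntegrable_const.add (intervalIntegrable_sum_log_sub b a s t)

theorem log_discr_sq_sub_four (hN : 2 ≤ N) (ha : ∀ k, 0 < a k) {i : ℕ} (hi : i + 1 < 2 * N) {x : ℝ}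
    (hx : x ∈ Set.Ioo (lam N b a (i + 1)) (lam N b a (i + 2))) :
    logDiscr N b a x = Real.log ((discr N b a).eval x ^ 2 - 4) := by
  have hne : ∀ j ∈ Finset.range (2 * N), x - lam N b a (j + 1) ≠ 0 := fun j hj => by
    rw [Finset.mem_range] at hj
    rcases le_or_gt j i with h | h
    · have := lam_le_lam b a hN (i := j + 1) (j := i + 1) (by omega) (by omega) (by omega)
      exact (sub_pos.2 (this.trans_lt hx.1)).ne'
    · have := lam_le_lam b a hN (i := i + 2) (j := j + 1) (by omega) (by omega) (by omega)
      exact (sub_neg.2 (hx.2.trans_le this)).ne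
  have hC := casimir₂_pos N a ha
  rw [discr_sq_sub_four_eq_prod b a hN ha, Real.log_mul (by positivity)
    (Finset.prod_ne_zero_iff.2 hne), Real.log_prod hne, logDiscr, Real.log_pow, Real.log_inv,
    Real.log_pow]
  push_cast
  ring

theorem le_integral_logDiscr (hN : 2 ≤ N) :
    2 * N * ((lam N b a (2 * N) - lam N b a 1) *
      (Real.log ((lam N b a (2 * N) - lam N b a 1) / 2) - 1 - Real.log (casimir₂ N a))) ≤
        ∫ x in (lam N b a 1)..(lam N b a (2 * N)), logDiscr N b a x := by
  unfold logDiscr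
  rw [intervalIntegral.integral_add intervalIntegrable_const
      (intervalIntegrable_sum_log_sub b a _ _),
    intervalIntegral.integral_finsetSum fun i _ => intervalIntegrable_log_sub _ _ _,
    intervalIntegral.integral_const, smul_eq_mul]
  have h : ∑ _i ∈ Finset.range (2 * N), ((lam N b a (2 * N) - lam N b a 1) *
      Real.log ((lam N b a (2 * N) - lam N b a 1) / 2) - (lam N b a (2 * N) - lam N b a 1)) ≤
      ∑ i ∈ Finset.range (2 * N), ∫ x in (lam N b a 1)..(lam N b a (2 * N)),
        Real.log (x - lam N b a (i + 1)) := by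
    refine Finset.sum_le_sum fun i hi => le_integral_log_sub ?_
    rw [Finset.mem_range] at hi
    exact ⟨lam_le_lam b a hN le_rfl (by omega) (by omega),
      lam_le_lam b a hN (by omega) (by omega) le_rfl⟩
  rw [Finset.sum_const, Finset.card_range, nsmul_eq_mul] at h
  push_cast at h
  linarith

/-- On a band `|Δ| ≤ 2`, so that `log |Δ² - 4|` is at most `2 log 2`. -/
theorem integral_logDiscr_band_le (hN : 2 ≤ N) (ha : ∀ k, 0 < a k) {j : ℕ} (hj : j < N) :
    ∫ x in (lam N b a (2 * j + 1))..(lam N b a (2 * j + 2)), logDiscr N b a x ≤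
      2 * Real.log 2 * (lam N b a (2 * j + 2) - lam N b a (2 * j + 1)) := by
  have h : ∫ x in (lam N b a (2 * j + 1))..(lam N b a (2 * j + 2)), logDiscr N b a x ≤
      ∫ _ in (lam N b a (2 * j + 1))..(lam N b a (2 * j + 2)), 2 * Real.log 2 := by
    refine intervalIntegral.integral_mono_on_of_le_Ioo (lam_odd_lt_even b a hN ha hj).le
      (intervalIntegrable_logDiscr b a _ _) intervalIntegrable_const fun x hx => ?_
    have hP := discr_sq_sub_four_neg b a hN ha hj hx.1 hx.2
    rw [log_discr_sq_sub_four b a hN ha (by omega) hx, ← Real.log_neg_eq_log,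
      show 2 * Real.log 2 = Real.log (2 ^ 2) by rw [Real.log_pow]; norm_num]
    exact Real.log_le_log (by linarith) (by nlinarith [sq_nonneg ((discr N b a).eval x)])
  rw [intervalIntegral.integral_const, smul_eq_mul] at h
  linarith

/-- On a gap `√(Δ² - 4) ≤ 2 exp (arcosh |Δ / 2|)`, and the integral of `arcosh |Δ / 2|` is a
multiple of the action. -/
theorem integral_logDiscr_gap_le (hN : 2 ≤ N) (ha : ∀ k, 0 < a k) {k : ℕ} (hk₁ : 1 ≤ k)
    (hk₂ : k ≤ N - 1) :
    ∫ x in (lam N b a (2 * k))..(lam N b a (2 * k + 1)), logDiscr N b a x ≤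
      2 * Real.log 2 * (lam N b a (2 * k + 1) - lam N b a (2 * k)) +
        2 * Real.pi * action N b a k := by
  have hle := lam_even_le_odd b a hN hk₁ hk₂
  have h1 : ∀ x ∈ Set.Icc (lam N b a (2 * k)) (lam N b a (2 * k + 1)),
      1 ≤ (-1) ^ (N - k) * (discr N b a).eval x / 2 := fun x hx => by
    linarith [two_le_sign_mul_discr b a hN ha hk₁ hk₂ hx]
  have hint : IntervalIntegrable
      (fun x => Real.arcosh ((-1) ^ (N - k) * (discr N b a).eval x / 2)) MeasureTheory.volume
      (lam N b a (2 * k)) (lam N b a (2 * k + 1)) := by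
    refine ContinuousOn.intervalIntegrable ?_
    rw [Set.uIcc_of_le hle]
    exact Real.continuousOn_arcosh.comp
      ((continuous_const.mul (discr N b a).continuous).div_const 2).continuousOn h1
  have h : ∫ x in (lam N b a (2 * k))..(lam N b a (2 * k + 1)), logDiscr N b a x ≤
      ∫ x in (lam N b a (2 * k))..(lam N b a (2 * k + 1)),
        (2 * Real.log 2 + 2 * Real.arcosh ((-1) ^ (N - k) * (discr N b a).eval x / 2)) := by
    refine intervalIntegral.integral_mono_on_of_le_Ioo hle
      (intervalIntegrable_logDiscr b a _ _) (intervalIntegrable_const.add (hint.const_mul 2))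
      fun x hx => ?_
    have hy := h1 x ⟨hx.1.le, hx.2.le⟩
    have hx' : x ∈ Set.Ioo (lam N b a ((2 * k - 1) + 1)) (lam N b a ((2 * k - 1) + 2)) := by
      rwa [show 2 * k - 1 + 1 = 2 * k by omega, show 2 * k - 1 + 2 = 2 * k + 1 by omega]
    rw [log_discr_sq_sub_four b a hN ha (by omega) hx']
    set y := (-1) ^ (N - k) * (discr N b a).eval x / 2 with hydef
    have hP : (discr N b a).eval x ^ 2 - 4 = 4 * (y ^ 2 - 1) := by
      rw [hydef, div_pow, mul_pow, ← pow_mul, mul_comm (N - k), pow_mul, neg_one_sq, one_pow]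
      ring
    have hy0 := Real.arcosh_nonneg hy
    rw [hP]
    rcases hy.eq_or_lt with h | h
    · rw [← h, one_pow, sub_self, mul_zero, Real.log_zero]
      rw [← h] at hy0
      have := Real.log_nonneg (show (1 : ℝ) ≤ 2 by norm_num)
      linarith
    · have hpos : 0 < y ^ 2 - 1 := by nlinarith
      have hsq : √(y ^ 2 - 1) ≤ Real.exp (Real.arcosh y) := by
        rw [Real.exp_arcosh hy]; linarith
      rw [Real.log_mul (by norm_num) hpos.ne', show (4 : ℝ) = 2 ^ 2 by norm_num, Real.log_pow]
      have := Real.log_le_log (Real.sqrt_pos.2 hpos) hsq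
      rw [Real.log_exp, Real.log_sqrt hpos.le] at this
      push_cast
      linarith
  rw [intervalIntegral.integral_add intervalIntegrable_const (hint.const_mul 2),
    intervalIntegral.integral_const, intervalIntegral.integral_const_mul,
    ← action_eq_integral_arcosh b a hN ha hk₁ hk₂, smul_eq_mul] at h
  linarith

theorem integral_logDiscr_le (hN : 2 ≤ N) (ha : ∀ k, 0 < a k) {M : ℝ} (hM : 0 ≤ M)
    (hI : ∀ k, 1 ≤ k → k ≤ N - 1 → action N b a k ≤ M) :
    ∫ x in (lam N b a 1)..(lam N b a (2 * N)), logDiscr N b a x ≤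
      2 * Real.log 2 * (lam N b a (2 * N) - lam N b a 1) + 2 * N * (2 * Real.pi * M) := by
  have hpi := Real.pi_pos
  have hM' : 0 ≤ 2 * Real.pi * M := by positivity
  have hsum := intervalIntegral.sum_integral_adjacent_intervals (f := logDiscr N b a)
    (μ := MeasureTheory.volume) (a := fun i => lam N b a (i + 1)) (n := 2 * N - 1)
    fun i _ => intervalIntegrable_logDiscr b a _ _
  have hstep : ∀ i ∈ Finset.range (2 * N - 1),
      ∫ x in (lam N b a (i + 1))..(lam N b a (i + 1 + 1)), logDiscr N b a x ≤
        2 * Real.log 2 * (lam N b a (i + 1 + 1) - lam N b a (i + 1)) + 2 * Real.pi * M := by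
    intro i hi
    rw [Finset.mem_range] at hi
    rcases Nat.even_or_odd' i with ⟨j, rfl | rfl⟩
    · exact (integral_logDiscr_band_le b a hN ha (by omega)).trans (by linarith)
    · have h := integral_logDiscr_gap_le b a hN ha (k := j + 1) (by omega) (by omega)
      rw [show 2 * (j + 1) = 2 * j + 1 + 1 by ring] at h
      refine h.trans ?_
      gcongr
      exact hI _ (by omega) (by omega)
  have h := Finset.sum_le_sum hstep
  rw [hsum, Finset.sum_add_distrib, ← Finset.mul_sum,
    Finset.sum_range_sub (fun i => lam N b a (i + 1)), Finset.sum_const, Finset.card_range,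
    nsmul_eq_mul] at h
  simp only [zero_add, Nat.sub_add_cancel (show 1 ≤ 2 * N by omega)] at h
  refine h.trans ?_
  have : ((2 * N - 1 : ℕ) : ℝ) ≤ 2 * N := by
    rw [Nat.cast_sub (by omega)]; push_cast; linarith
  gcongr

/-- The actions and the Casimir function `C₂` bound the length of the spectrum. -/
theorem spectral_length_le (hN : 2 ≤ N) (ha : ∀ k, 0 < a k) {M : ℝ} (hM : 0 ≤ M)
    (hI : ∀ k, 1 ≤ k → k ≤ N - 1 → action N b a k ≤ M) :
    lam N b a (2 * N) - lam N b a 1 ≤ 4 * Real.exp 2 * casimir₂ N a + 2 * Real.pi * M := by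
  have hpi := Real.pi_pos
  have hC := casimir₂_pos N a ha
  have h := (le_integral_logDiscr b a hN).trans (integral_logDiscr_le b a hN ha hM hI)
  set L := lam N b a (2 * N) - lam N b a 1
  by_contra! hlt
  have hpos : 0 < 4 * Real.exp 2 * casimir₂ N a := by positivity
  have hM' : 0 ≤ 2 * Real.pi * M := by positivity
  have hL : 0 < L := by linarith
  have hlog : 2 + Real.log 2 + Real.log (casimir₂ N a) ≤ Real.log (L / 2) := by
    have h2 : Real.log (Real.exp 2 * 2 * casimir₂ N a) =
        2 + Real.log 2 + Real.log (casimir₂ N a) := by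
      rw [Real.log_mul (by positivity) hC.ne', Real.log_mul (by positivity) (by norm_num),
        Real.log_exp]
    rw [← h2]
    exact Real.log_le_log (by positivity) (by linarith)
  have hlog2 := Real.log_pos (show (1 : ℝ) < 2 by norm_num)
  have hN' : (2 : ℝ) ≤ N := by exact_mod_cast hN
  have h1 : 2 * N * (L * (1 + Real.log 2)) ≤
      2 * N * (L * (Real.log (L / 2) - 1 - Real.log (casimir₂ N a))) := by
    gcongr
    linarith
  have h2 : 2 * Real.log 2 * L ≤ 2 * N * (L * Real.log 2) := by
    have := mul_pos hL hlog2
    nlinarith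
  have h3 : 2 * N * L ≤ 2 * N * (2 * Real.pi * M) := by linarith
  have h4 : L ≤ 2 * Real.pi * M := le_of_mul_le_mul_left h3 (by positivity)
  linarith

end SpectralLength

/-! ### Properness -/

section EntryBound

open Matrix in
/-- The sum of the squares of all entries is the trace of `A²`, the sum of the squares of the
eigenvalues. -/
theorem sq_apply_le_of_abs_eigenvalues_le {n : Type*} [Fintype n] [DecidableEq n]
    {A : Matrix n n ℝ} (hA : A.IsHermitian) {R : ℝ} (hR : ∀ i, |hA.eigenvalues i| ≤ R) (i j : n) :
    A i j ^ 2 ≤ Fintype.card n * R ^ 2 := by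
  have htr : (A * A).trace = ∑ k, hA.eigenvalues k ^ 2 := by
    conv_lhs => rw [hA.spectral_theorem, ← map_mul, Unitary.conjStarAlgAut_apply,
      Matrix.trace_mul_cycle, Unitary.coe_star_mul_self, one_mul, diagonal_mul_diagonal,
      trace_diagonal]
    exact Finset.sum_congr rfl fun k _ => by simp [sq]
  have hsum : (A * A).trace = ∑ k, ∑ l, A k l ^ 2 := by
    refine Finset.sum_congr rfl fun k _ => ?_
    rw [diag_apply, mul_apply]
    refine Finset.sum_congr rfl fun l _ => ?_
    have h := hA.apply k l
    rw [star_trivial] at h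
    rw [sq, h]
  calc A i j ^ 2 ≤ ∑ l, A i l ^ 2 :=
        Finset.single_le_sum (f := fun l => A i l ^ 2) (fun _ _ => sq_nonneg _) (Finset.mem_univ j)
    _ ≤ ∑ k, ∑ l, A k l ^ 2 :=
        Finset.single_le_sum (f := fun k => ∑ l, A k l ^ 2)
          (fun _ _ => Finset.sum_nonneg fun _ _ => sq_nonneg _) (Finset.mem_univ i)
    _ = ∑ k, hA.eigenvalues k ^ 2 := by rw [← hsum, htr]
    _ ≤ ∑ _k : n, R ^ 2 := Finset.sum_le_sum fun k _ => sq_le_sq' (abs_le.1 (hR k)).1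
        (abs_le.1 (hR k)).2
    _ = Fintype.card n * R ^ 2 := by rw [Finset.sum_const, Finset.card_univ, nsmul_eq_mul]

variable {N : ℕ} (b a : ZMod N → ℝ)

/-- The trace of `Q`. -/
theorem sum_lam (hN : 2 ≤ N) :
    ∑ i ∈ Finset.range (2 * N), lam N b a (i + 1) = -(2 * N * casimir₁ N b) := by
  have hN0 : (N : ℝ) ≠ 0 := by positivity
  have h := Matrix.trace_eq_sum_roots_charpoly_of_splits
    (jacobiQ_isHermitian b a hN).splits_charpoly
  rw [charpoly_eq_prod b a hN,
    roots_prod _ _ (Finset.prod_ne_zero_iff.2 fun i _ => X_sub_C_ne_zero _)] at h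
  simp only [roots_X_sub_C] at h
  rw [Multiset.bind_singleton] at h
  have hdiag : (jacobiQ N b a).trace = ∑ i ∈ Finset.range (2 * N), b (i + 1 : ℕ) := by
    rw [Matrix.trace, ← Fin.sum_univ_eq_sum_range (fun i => b (i + 1 : ℕ))]
    exact Finset.sum_congr rfl fun i _ => by simp [jacobiQ]
  have hshift : ∀ i : ℕ, b ((N + i + 1 : ℕ) : ZMod N) = b (i + 1 : ℕ) := fun i => by
    push_cast; rw [ZMod.natCast_self, zero_add]
  change _ = ∑ i ∈ Finset.range (2 * N), lam N b a (i + 1) at h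
  have hIcc : ∑ n ∈ Finset.Icc 1 N, b (n : ℕ) = ∑ i ∈ Finset.range N, b (i + 1 : ℕ) := by
    rw [Finset.range_eq_Ico, Finset.sum_Ico_add' (fun i : ℕ => b (i : ZMod N)) 0 N 1]
    rfl
  rw [← h, hdiag, two_mul, Finset.sum_range_add, casimir₁, hIcc]
  simp only [hshift]
  field_simp
  ring

theorem abs_lam_le (hN : 2 ≤ N) {L : ℝ} (hL : lam N b a (2 * N) - lam N b a 1 ≤ L) {j : ℕ}
    (hj₁ : 1 ≤ j) (hj₂ : j ≤ 2 * N) : |lam N b a j| ≤ |casimir₁ N b| + L := by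
  have hN0 : (0 : ℝ) < 2 * N := by positivity
  have hsum := sum_lam b a hN
  have hmem : ∀ i ∈ Finset.range (2 * N), lam N b a 1 ≤ lam N b a (i + 1) ∧
      lam N b a (i + 1) ≤ lam N b a (2 * N) := fun i hi => by
    rw [Finset.mem_range] at hi
    exact ⟨lam_le_lam b a hN le_rfl (by omega) (by omega),
      lam_le_lam b a hN (by omega) (by omega) le_rfl⟩
  have h₁ := Finset.card_nsmul_le_sum _ _ _ fun i hi => (hmem i hi).1
  have h₂ := Finset.sum_le_card_nsmul _ _ _ fun i hi => (hmem i hi).2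
  rw [hsum, Finset.card_range, nsmul_eq_mul] at h₁ h₂
  push_cast at h₁ h₂
  have h₃ : lam N b a 1 ≤ -casimir₁ N b := le_of_mul_le_mul_left (by linarith) hN0
  have h₄ : -casimir₁ N b ≤ lam N b a (2 * N) := le_of_mul_le_mul_left (by linarith) hN0
  have h₅ := lam_le_lam b a hN le_rfl hj₁ hj₂
  have h₆ := lam_le_lam b a hN hj₁ hj₂ le_rfl
  rw [abs_le]
  constructor <;> linarith [le_abs_self (casimir₁ N b), neg_abs_le (casimir₁ N b)]

theorem abs_eigenvalues_jacobiQ_le (hN : 2 ≤ N) {R : ℝ}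
    (hR : ∀ j, 1 ≤ j → j ≤ 2 * N → |lam N b a j| ≤ R) (i : Fin (2 * N)) :
    |(jacobiQ_isHermitian b a hN).eigenvalues i| ≤ R := by
  have h : (jacobiQ N b a).charpoly.eval ((jacobiQ_isHermitian b a hN).eigenvalues i) = 0 := by
    rw [(jacobiQ_isHermitian b a hN).charpoly_eq, eval_prod]
    exact Finset.prod_eq_zero (Finset.mem_univ i) (by simp)
  rw [charpoly_eq_prod b a hN, eval_prod, Finset.prod_eq_zero_iff] at h
  obtain ⟨j, hj, h⟩ := h
  rw [eval_sub, eval_X, eval_C, sub_eq_zero] at h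
  rw [Finset.mem_range] at hj
  rw [h]
  exact hR _ (by omega) (by omega)

theorem exists_natCast_add_one_eq (hN : 2 ≤ N) (k : ZMod N) :
    ∃ i < N, ((i + 1 : ℕ) : ZMod N) = k := by
  have : NeZero N := ⟨by omega⟩
  exact ⟨(k - 1).val, ZMod.val_lt _, by rw [Nat.cast_add, ZMod.natCast_zmod_val, Nat.cast_one,
    sub_add_cancel]⟩

theorem abs_entries_le_of_abs_lam_le (hN : 2 ≤ N) {R : ℝ}
    (hR : ∀ j, 1 ≤ j → j ≤ 2 * N → |lam N b a j| ≤ R) (k : ZMod N) :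
    |b k| ≤ √(2 * N * R ^ 2) ∧ |a k| ≤ √(2 * N * R ^ 2) := by
  have h := sq_apply_le_of_abs_eigenvalues_le (jacobiQ_isHermitian b a hN)
    (abs_eigenvalues_jacobiQ_le b a hN hR)
  rw [Fintype.card_fin] at h
  push_cast at h
  obtain ⟨i, hi, rfl⟩ := exists_natCast_add_one_eq hN k
  have hb := h ⟨i, by omega⟩ ⟨i, by omega⟩
  have ha := h ⟨i, by omega⟩ ⟨i + 1, by omega⟩
  have hmod : (i + 1) % (2 * N) = i + 1 := Nat.mod_eq_of_lt (by omega)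
  simp only [jacobiQ, Matrix.of_apply, if_true, Fin.mk.injEq, hmod, Nat.left_eq_add,
    one_ne_zero, if_false] at hb ha
  exact ⟨Real.abs_le_sqrt hb, Real.abs_le_sqrt ha⟩

theorem casimir₂_pow_le (hN : 2 ≤ N) (ha : ∀ k, 0 < a k) {A : ℝ} (hA : ∀ k, a k ≤ A)
    (k : ZMod N) : casimir₂ N a ^ N ≤ a k * A ^ (N - 1) := by
  obtain ⟨i, hi, rfl⟩ := exists_natCast_add_one_eq hN k
  have hi' := Finset.mem_range.2 hi
  rw [casimir₂_pow a hN ha, ← Finset.mul_prod_erase _ _ hi']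
  refine mul_le_mul_of_nonneg_left ?_ (ha _).le
  refine (Finset.prod_le_prod (fun _ _ => (ha _).le) fun j _ => hA _).trans_eq ?_
  rw [Finset.prod_const, Finset.card_erase_of_mem hi', Finset.card_range]

end EntryBound

section Proper

variable {N : ℕ}

theorem action_le_of_norm_birkhoffCoord_le (b a : ZMod N → ℝ) (hN : 2 ≤ N) (ha : ∀ k, 0 < a k)
    {k : ℕ} (hk₁ : 1 ≤ k) (hk₂ : k ≤ N - 1) {B : ℝ} (hB : ‖birkhoffCoord N b a k‖ ≤ B) :
    action N b a k ≤ B ^ 2 := by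
  by_cases hg : gap N b a k = 0
  · rw [action_eq_zero b a hN ha hk₁ hk₂ hg]
    exact sq_nonneg B
  · rw [birkhoffCoord, if_neg hg, Prod.norm_def, max_le_iff, Real.norm_eq_abs, Real.norm_eq_abs]
      at hB
    have h₁ := sq_le_sq' (abs_le.1 hB.1).1 (abs_le.1 hB.1).2
    have h₂ := sq_le_sq' (abs_le.1 hB.2).1 (abs_le.1 hB.2).2
    have hI := action_nonneg b a hN ha hk₁ hk₂
    rw [mul_pow, Real.sq_sqrt (by positivity)] at h₁ h₂
    have := Real.cos_sq_add_sin_sq (angle N b a k)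
    have h : 2 * action N b a k * (Real.cos (angle N b a k) ^ 2 + Real.sin (angle N b a k) ^ 2) ≤
        2 * B ^ 2 := by linarith
    rw [this] at h
    linarith

theorem isCompact_phaseSpace_box (A δ : ℝ) (hδ : 0 < δ) :
    IsCompact {p : PhaseSpace N | (∀ k, |p.1 k| ≤ A) ∧ ∀ k, (p.2 k : ℝ) ∈ Set.Icc δ A} := by
  have h₁ : IsCompact (Set.univ.pi fun _ : ZMod N => Set.Icc (-A) A) :=
    isCompact_univ_pi fun _ => isCompact_Icc
  have h₂ : IsCompact (Set.univ.pi fun _ : ZMod N =>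
      (Subtype.val ⁻¹' Set.Icc δ A : Set (Set.Ioi (0 : ℝ)))) := by
    refine isCompact_univ_pi fun _ => ?_
    rw [Topology.IsInducing.subtypeVal.isCompact_preimage_iff]
    · exact isCompact_Icc
    · rw [Subtype.range_coe]
      exact fun x hx => hδ.trans_le hx.1
  convert h₁.prod h₂ using 1
  ext p
  simp only [Set.mem_ofPred_eq, Set.mem_prod, Set.mem_univ_pi, Set.mem_Icc, abs_le,
    Set.mem_preimage]

/-- A bounded set of values of `Ω` on which `C₂` stays away from `0` comes from a bounded part of
the phase space on which the `a_k` stay away from `0`. -/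
theorem exists_box_of_bounded_birkhoffMap (hN : 2 ≤ N) {B c : ℝ} (hc : 0 < c) :
    ∃ A δ : ℝ, 0 < δ ∧ ∀ p : PhaseSpace N, ‖(birkhoffMap N p).1‖ ≤ B →
      |casimir₁ N p.1| ≤ B → casimir₂ N (aSeq p) ≤ B → c ≤ casimir₂ N (aSeq p) →
        (∀ k, |p.1 k| ≤ A) ∧ ∀ k, (p.2 k : ℝ) ∈ Set.Icc δ A := by
  have hpi := Real.pi_pos
  -- `R` bounds the spectrum, by `abs_lam_le` and `spectral_length_le` with actions at most `B ^ 2`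
  set R := B + (4 * Real.exp 2 * B + 2 * Real.pi * B ^ 2) with hRdef
  -- the summand `1` only makes `A` positive
  set A := √(2 * N * R ^ 2) + 1 with hAdef
  have hA : 0 < A := by positivity
  refine ⟨A, c ^ N / A ^ (N - 1), by positivity, fun p hp h₁ h₂ hc₂ => ?_⟩
  have hI : ∀ k, 1 ≤ k → k ≤ N - 1 → action N p.1 (aSeq p) k ≤ B ^ 2 := fun k hk₁ hk₂ => by
    refine action_le_of_norm_birkhoffCoord_le p.1 (aSeq p) hN (aSeq_pos p) hk₁ hk₂ ?_
    have h := (norm_le_pi_norm (birkhoffMap N p).1 ⟨k - 1, by omega⟩).trans hp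
    simpa only [birkhoffMap, Nat.sub_add_cancel hk₁] using h
  have hL := spectral_length_le p.1 (aSeq p) hN (aSeq_pos p) (sq_nonneg B) hI
  have hL' : lam N p.1 (aSeq p) (2 * N) - lam N p.1 (aSeq p) 1 ≤
      4 * Real.exp 2 * B + 2 * Real.pi * B ^ 2 := hL.trans (by gcongr)
  have hR : ∀ j, 1 ≤ j → j ≤ 2 * N → |lam N p.1 (aSeq p) j| ≤ R := fun j hj₁ hj₂ =>
    (abs_lam_le p.1 (aSeq p) hN hL' hj₁ hj₂).trans (by rw [hRdef]; gcongr)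
  have hentry := abs_entries_le_of_abs_lam_le p.1 (aSeq p) hN hR
  have haA : ∀ k, aSeq p k ≤ A := fun k =>
    (le_abs_self _).trans ((hentry k).2.trans (by linarith))
  refine ⟨fun k => (hentry k).1.trans (by linarith), fun k => ⟨?_, haA k⟩⟩
  rw [div_le_iff₀ (by positivity)]
  exact (pow_le_pow_left₀ hc.le hc₂ N).trans
    (casimir₂_pow_le (aSeq p) hN (aSeq_pos p) haA k)

end Proper

end Toda

end

theorem mainTheorem8 (N : ℕ) (hN : 2 ≤ N) (K : Set (Toda.ModelSpace N)) (hK : IsCompact K) :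
    IsCompact (Toda.birkhoffMap N ⁻¹' K) := by
  obtain ⟨B, hB⟩ := hK.exists_bound_of_continuousOn
    (f := fun q => (q.1, q.2.1, (q.2.2 : ℝ))) (by fun_prop)
  rcases K.eq_empty_or_nonempty with rfl | hne
  · simp
  obtain ⟨q₀, hq₀, hmin⟩ := hK.exists_isMinOn hne
    (f := fun q : Toda.ModelSpace N => (q.2.2 : ℝ)) (by fun_prop)
  obtain ⟨A, δ, hδ, hbox⟩ := Toda.exists_box_of_bounded_birkhoffMap hN q₀.2.2.2
  refine (Toda.isCompact_phaseSpace_box A δ hδ).of_isClosed_subset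
    (hK.isClosed.preimage (Toda.continuous_birkhoffMap hN)) fun p hp => ?_
  have h := hB _ hp
  simp only [Prod.norm_def, max_le_iff] at h
  exact hbox p h.1 h.2.1 ((le_abs_self _).trans h.2.2) (hmin hp)
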